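/- **Setting.** $\Lambda$ is the set of ordinary $\lambda$-terms. Values $v$ are abstractions $\lambda x.t$ with $t\in\Lambda$. For $t\in\Lambda$ and a set of variables $\theta$, the skeletal decomposition $\mathrm{sk}_\theta(t)$ is a pair of a $\lambda$-term and a list of explicit substitutions: $\mathrm{sk}_\theta(t)=(z,\langle\cdot\rangle[z{\leftarrow}t])$ with $z$ fresh, if $t$ is not a variable and $\mathrm{fv}(t)\cap\theta=\emptyset$; otherwise $\mathrm{sk}_\theta(x)=(x,\langle\cdot\rangle)$; $\mathrm{sk}_\theta(\lambda x.t)=(\lambda x.s,F)$ if $\mathrm{sk}_{\theta\cup\{x\}}(t)=(s,F)$; and $\mathrm{sk}_\theta(t\,u)=(s\,p,F'\langle F\rangle)$ if $\mathrm{sk}_\theta(t)=(s,F)$ and $\mathrm{sk}_\theta(u)=(p,F')$. The skeleton and the flesh of $\lambda x.t$ are $\lambda x.s$ and $F$, where $\mathrm{sk}_{\{x\}}(t)=(s,F)$. The terms of $\Lambda_{\mathsf{sk}}$, taken modulo $\alpha$, are $t,u::=x\mid v\mid t\,u\mid t[x{\leftarrow}u]\mid t[\![x{\leftarrow}v]\!]$,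 where $v$ equals its skeleton in the last case. Substitution contexts are $S::=\langle\cdot\rangle\mid S[x{\leftarrow}u]\mid S[\![x{\leftarrow}v]\!]$ and evaluation contexts are $E::=\langle\cdot\rangle\mid E\,u\mid E[x{\leftarrow}u]\mid E[\![x{\leftarrow}v]\!]\mid E\langle x\rangle[x{\leftarrow}E']$, with $x$ not captured by $E$ in the last case. The strategy $\to_{\mathsf{skneed}}$ is the closure under evaluation contexts of the following rules, where $S$, $E$ and $F$ do not capture variables by accident: - ($\mathsf{dB}$) $S\langle\lambda x.t\rangle u\mapsto S\langle t[x{\leftarrow}u]\rangle$; - ($\mathsf{sk}$) $E\langle x\rangle[x{\leftarrow}S\langle v\rangle]\mapsto S\langle F\langle E\langle x\rangle[\![x{\leftarrow}v']\!]\rangle\rangle$, with $x$ not captured by $E$, where $v'$ and $F$ are the skeleton and the flesh of $v$; - ($\mathsf{ss}$) $E\langle x\rangle[\![x{\leftarrow}v]\!]\mapsto E\langle v\rangle[\![x{\leftarrow}v]\!]$, with $x$ not captured by $E$. Structural equivalence $\equiv$ is the least equivalence relation closed under evaluation contexts such that $E\langle t[x{\leftarrow}u]\rangle\equiv E\langle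 t\rangle[x{\leftarrow}u]$ whenever $E$ captures no free variable of $u$ and $x$ does not occur free in $E$, and $E\langle t[\![x{\leftarrow}v]\!]\rangle\equiv E\langle t\rangle[\![x{\leftarrow}v]\!]$ whenever $E$ captures no free variable of $v$ and $x$ does not occur free in $E$ (bound names being chosen so that $E$ does not bind $x$). Let $\equiv_{\mathsf n}\;\subseteq\;\equiv$ be the relation defined in the same way with the stronger condition that $E$ captures no free variable of $t[x{\leftarrow}u]$ (respectively of $t[\![x{\leftarrow}v]\!]$). **The Skeletal MAD.** States are quadruples $(C,t,S,E)$ of a chain, a pre-term of $\Lambda$ (with names, not modulo $\alpha$), a stack and an environment: $S::=\epsilon\mid t::S$; $E::=\epsilon\mid[x{\leftarrow}t]::E\mid[\![x{\leftarrow}v]\!]::E$; $C::=\epsilon\mid C::(x,S,E[x{\leftarrow}\cdot])$. A state is initial for a closed $t\in\Lambda$ if it is $(\epsilon,t',\epsilon,\epsilon)$ with $t'=_\alpha t$ having pairwise distinct bound names. The search transitions are - $\mathsf{sea}_1$: $(C,t\,u,S,E)\leadsto(C,t,u::S,E)$; - $\mathsf{sea}_2$: $(C,x,S,E::[x{\leftarrow}t]::E')\leadsto(C::(x,S,E[x{\leftarrow}\cdot]),t,\epsilon,E')$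 if $t$ is not a value; - $\mathsf{sea}_3$: $(C::(x,S,E[x{\leftarrow}\cdot]),v,\epsilon,E')\leadsto(C,x,S,E::[x{\leftarrow}v]::E')$; and the principal transitions are - $\beta$: $(C,\lambda x.t,u::S,E)\leadsto(C,t,S,[x{\leftarrow}u]::E)$; - $\mathsf{sk}$: $(C,x,S,E::[x{\leftarrow}v]::E')\leadsto(C,x,S,E::[\![x{\leftarrow}v']\!]::E_F::E')$, where $v'$ and $F$ are the skeleton and the flesh of $v$, with distinct fresh names for the variables of the flesh, and $E_F$ is $F$ seen as an environment; - $\mathsf{ss}$: $(C,x,S,E::[\![x{\leftarrow}v]\!]::E')\leadsto(C,w,S,E::[\![x{\leftarrow}v]\!]::E')$, where $w=_\alpha v$ is any pre-term with pairwise distinct bound names, not occurring in the state on the left. The read-back of a state is $\underline{(C,t,S,E)}=\underline E\langle\underline C\langle\underline S\langle t\rangle\rangle\rangle$, taken modulo $\alpha$, where $\underline\epsilon=\langle\cdot\rangle$, $\underline{t::S}=\underline S\langle\langle\cdot\rangle t\rangle$, $\underline{[x{\leftarrow}t]::E}=\underline E\langle\langle\cdot\rangle[x{\leftarrow}t]\rangle$,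 $\underline{[\![x{\leftarrow}v]\!]::E}=\underline E\langle\langle\cdot\rangle[\![x{\leftarrow}v]\!]\rangle$ and $\underline{C::(x,S,E[x{\leftarrow}\cdot])}=\underline E\langle\underline C\langle\underline S\langle x\rangle\rangle\rangle[x{\leftarrow}\langle\cdot\rangle]$. A state is reachable if some run leads to it from an initial state, and final if no transition applies to it. The label $\beta$ of the machine corresponds to the label $\mathsf{dB}$ of the calculus. **Theorem.** The read-back of a state that is initial for $t$ is $t$, and the read-back of every reachable state is in $\Lambda_{\mathsf{sk}}$. The pair $(\to_{\mathsf{skneed}},\equiv)$ is a structural strategy: $\equiv$ is an equivalence relation and a strong bisimulation, that is, if $t\equiv u$ and $t\to_a t'$ with $a\in\{\mathsf{dB},\mathsf{sk},\mathsf{ss}\}$, then $u\to_a u'$ and $t'\equiv u'$ for some $u'$. The Skeletal MAD and $(\to_{\mathsf{skneed}},\equiv)$ form a distillery. Namely, for every reachable state $Q$: 1. *Principal projection*: if $Q\leadsto_\beta Q'$ then $\underline Q\to_{\mathsf{dB}}\equiv\underline{Q'}$; if $Q\leadsto_{\mathsf{sk}}Q'$ then $\underline Q\to_{\mathsf{sk}}\underline{Q'}$;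 if $Q\leadsto_{\mathsf{ss}}Q'$ then $\underline Q\to_{\mathsf{ss}}\underline{Q'}$. 2. *Search transparency*: if $Q\leadsto_{\mathsf{sea}_1,\mathsf{sea}_2,\mathsf{sea}_3}Q'$ then $\underline Q=\underline{Q'}$. 3. *Search terminates*: $\leadsto_{\mathsf{sea}_1,\mathsf{sea}_2,\mathsf{sea}_3}$ is terminating. 4. *Determinism*: if $t\to_a u$ and $t\to_{a'}u'$ are steps of $\to_{\mathsf{skneed}}$ then $a=a'$ and $u=u'$. 5. *Halt*: if $Q$ is final then $Q=(\epsilon,v,\epsilon,E)$ for a value $v$ and an environment $E$, and $\underline Q$ is $\to_{\mathsf{skneed}}$-normal. **Corollary.** The Skeletal MAD and $(\to_{\mathsf{skneed}},\equiv)$ are mechanically bisimilar: for every closed $t\in\Lambda$ and every state $Q$ initial for $t$, - for every run $r:Q\leadsto^*Q'$ there is an evaluation $e:t\to_{\mathsf{skneed}}^*u$ with $u\equiv\underline{Q'}$; - for every evaluation $e:t\to_{\mathsf{skneed}}^*u$ there is a run $r:Q\leadsto^*Q'$ with $\underline{Q'}\equiv u$; - in both cases, for each of the labels $\beta$ (corresponding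 to $\mathsf{dB}$), $\mathsf{sk}$ and $\mathsf{ss}$, the number of transitions of $r$ and the number of steps of $e$ with that label are equal. All properties 1–5 and the corollary also hold with $\equiv_{\mathsf n}$ in place of $\equiv$. -/

import Mathlib

/-! Skeletal call-by-need: the calculus (terms modulo α, in de Bruijn form), the abstract machine
(on named pre-terms), its read-back, and the notions of distillery and mechanical bisimulation. -/

namespace SkNeed

/-! ### Terms modulo α

Terms are identified up to α-renaming, hence represented with de Bruijn indices. -/

/-- Ordinary λ-terms, without explicit substitutions. -/
inductive Lam : Type
  | var (i : ℕ) : Lam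
  | lam (b : Lam) : Lam
  | app (t u : Lam) : Lam
  deriving DecidableEq

/-- Extension of a renaming of indices under a binder. -/
def up (ξ : ℕ → ℕ) : ℕ → ℕ
  | 0 => 0
  | i + 1 => ξ i + 1

namespace Lam

/-- Renaming of the free variables. -/
def ren : (ℕ → ℕ) → Lam → Lam
  | ξ, var i => var (ξ i)
  | ξ, lam b => lam (ren (up ξ) b)
  | ξ, app t u => app (ren ξ t) (ren ξ u)

/-- `occ i t` : the free variable `i` occurs in `t`. -/
def occ : ℕ → Lam → Bool
  | i, var j => i == j
  | i, lam b => occ (i + 1) b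
  | i, app t u => occ i t || occ i u

/-- `t` has no free variables. -/
def Closed (t : Lam) : Prop := ∀ i, t.occ i = false

def isVar : Lam → Bool
  | var _ => true
  | _ => false

/-- The sub-term `t`, found under `d` binders, is extracted by a skeletal decomposition: it is not
a variable and none of the `d` binders (the set `θ`) occurs in it. -/
def Extract (d : ℕ) (t : Lam) : Prop := t.isVar = false ∧ ∀ i < d, t.occ i = false

instance (d : ℕ) (t : Lam) : Decidable (t.Extract d) := by unfold Extract; infer_instance

/-- The extracted sub-terms of `t`, from left to right; `t` is found under `d` binders, the
extracted sub-terms live outside of these binders. -/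
def fleshAt : ℕ → Lam → List Lam
  | _, var _ => []
  | d, lam b => if (lam b).Extract d then [(lam b).ren (fun i => i - d)] else fleshAt (d + 1) b
  | d, app t u =>
      if (app t u).Extract d then [(app t u).ren (fun i => i - d)]
      else fleshAt d t ++ fleshAt d u

/-- The skeleton of `t`, found under `d` binders. It lives under the same `d` binders, themselves in
the scope of `k` new variables (the flesh variables, with indices `d, …, d + k - 1`); the extracted
sub-terms are replaced from left to right by the flesh variables number `o, o + 1, …`. -/
def skelAt : (d o k : ℕ) → Lam → Lam
  | d, _, k, var i => if i < d then var i else var (i + k)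
  | d, o, k, lam b => if (lam b).Extract d then var (d + o) else lam (skelAt (d + 1) o k b)
  | d, o, k, app t u =>
      if (app t u).Extract d then var (d + o)
      else app (skelAt d o k t) (skelAt d (o + (fleshAt d t).length) k u)

/-- The sub-terms extracted from the value `λ. b`. -/
def fleshList (b : Lam) : List Lam := fleshAt 1 b

/-- The body of the skeleton of the value `λ. b`. -/
def skeleton (b : Lam) : Lam := skelAt 1 0 b.fleshList.length b

end Lam

/-- Terms of the skeletal calculus: variables, values `λ. b` with an ordinary body `b`,
applications, explicit substitutions `t[x←u]` and skeletal substitutions `t⟦x←λ. b⟧`, where `x` is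
the index `0` in `t` and is not bound in the content of the substitution. -/
inductive Tm : Type
  | var (i : ℕ) : Tm
  | lam (b : Lam) : Tm
  | app (t u : Tm) : Tm
  | sub (t u : Tm) : Tm
  | ssub (t : Tm) (b : Lam) : Tm
  deriving DecidableEq

def Lam.toTm : Lam → Tm
  | .var i => .var i
  | .lam b => .lam b
  | .app t u => .app t.toTm u.toTm

namespace Tm

def ren : (ℕ → ℕ) → Tm → Tm
  | ξ, var i => var (ξ i)
  | ξ, lam b => lam (b.ren (up ξ))
  | ξ, app t u => app (ren ξ t) (ren ξ u)
  | ξ, sub t u => sub (ren (up ξ) t) (ren ξ u)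
  | ξ, ssub t b => ssub (ren (up ξ) t) (b.ren (up ξ))

def occ : ℕ → Tm → Bool
  | i, var j => i == j
  | i, lam b => b.occ (i + 1)
  | i, app t u => occ i t || occ i u
  | i, sub t u => occ (i + 1) t || occ i u
  | i, ssub t b => occ (i + 1) t || b.occ (i + 1)

/-- Weakening by `n` variables. -/
def shift (n : ℕ) (t : Tm) : Tm := t.ren (fun i => i + n)

/-- The skeletal substitutions of the term only contain skeletal values, that is, values equal to
their skeleton. -/
def IsSk : Tm → Prop
  | var _ => True
  | lam _ => True
  | app t u => IsSk t ∧ IsSk u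
  | sub t u => IsSk t ∧ IsSk u
  | ssub t b => IsSk t ∧ b.skeleton = b

end Tm

/-! ### Contexts -/

/-- Substitution contexts: lists of explicit and skeletal substitutions around a hole. -/
inductive SCtx : Type
  | hole : SCtx
  | sub (S : SCtx) (u : Tm) : SCtx
  | ssub (S : SCtx) (b : Lam) : SCtx

namespace SCtx

def plug : SCtx → Tm → Tm
  | hole, t => t
  | sub S u, t => .sub (S.plug t) u
  | ssub S b, t => .ssub (S.plug t) b

/-- The number of variables captured by the context. -/
def depth : SCtx → ℕ
  | hole => 0
  | sub S _ => S.depth + 1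
  | ssub S _ => S.depth + 1

/-- The substitution context `S⟨·⟩[x₁←t₁]…[xₖ←tₖ]` where the terms `t₁, …, tₖ` live outside
of the scope of all the `xᵢ`. -/
def addList : SCtx → List Lam → SCtx
  | S, [] => S
  | S, t :: l => addList (sub S (t.toTm.shift l.length)) l

end SCtx

/-- The flesh of the value `λ. b`, as a substitution context. -/
def flesh (b : Lam) : SCtx := SCtx.hole.addList b.fleshList

/-- Skeletal evaluation contexts. The context `dem E E'` is `E⟨x⟩[x←E']`, where `E` does not
capture `x`. -/
inductive ECtx : Type
  | hole : ECtx
  | app (E : ECtx) (u : Tm) : ECtx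
  | sub (E : ECtx) (u : Tm) : ECtx
  | ssub (E : ECtx) (b : Lam) : ECtx
  | dem (E E' : ECtx) : ECtx

namespace ECtx

/-- The number of variables captured by the context, that is, the size of its domain. In the hole,
these are the indices smaller than the depth. -/
def depth : ECtx → ℕ
  | hole => 0
  | app E _ => E.depth
  | sub E _ => E.depth + 1
  | ssub E _ => E.depth + 1
  | dem _ E' => E'.depth

/-- Plugging, which can capture variables. In `dem E E'` the hole of `E` contains the variable
bound by the substitution, that has index `E.depth` there. -/
def plug : ECtx → Tm → Tm
  | hole, t => t
  | app E u, t => .app (E.plug t) u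
  | sub E u, t => .sub (E.plug t) u
  | ssub E b, t => .ssub (E.plug t) b
  | dem E E', t => .sub (E.plug (.var E.depth)) (E'.plug t)

/-- Renaming of the free variables of a context. -/
def ren : (ℕ → ℕ) → ECtx → ECtx
  | _, hole => hole
  | ξ, app E u => app (ren ξ E) (u.ren ξ)
  | ξ, sub E u => sub (ren (up ξ) E) (u.ren ξ)
  | ξ, ssub E b => ssub (ren (up ξ) E) (b.ren (up ξ))
  | ξ, dem E E' => dem (ren (up ξ) E) (ren ξ E')

/-- For a term in the scope of a substitution on `x`: the term `E⟨x⟩`, where `x` is the variable of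
that substitution and is not captured by `E`. -/
def plugVar (E : ECtx) : Tm := E.plug (.var E.depth)

end ECtx

/-! ### The skeletal call-by-need strategy -/

/-- Labels of the steps of the calculus and of the principal transitions of the machine (the label
`dB` of the calculus is the label `β` of the machine). -/
inductive PLabel : Type
  | dB | sk | ss
  deriving DecidableEq

/-- Root rules: distant β, skeletonization, skeletal substitution. -/
inductive Root : PLabel → Tm → Tm → Prop
  /-- `S⟨λx.t⟩u ↦ S⟨t[x←u]⟩` -/
  | dB (S : SCtx) (b : Lam) (u : Tm) :
      Root .dB (.app (S.plug (.lam b)) u) (S.plug (.sub b.toTm (u.shift S.depth)))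
  /-- `E⟨x⟩[x←S⟨v⟩] ↦ S⟨F⟨E⟨x⟩⟦x←v'⟧⟩⟩` where `v'` is the skeleton and `F` the flesh of `v` -/
  | sk (E : ECtx) (S : SCtx) (b : Lam) :
      Root .sk (.sub E.plugVar (S.plug (.lam b)))
        (S.plug ((flesh b).plug
          (.ssub (E.plugVar.ren (up (fun i => i + ((flesh b).depth + S.depth)))) b.skeleton)))
  /-- `E⟨x⟩⟦x←v⟧ ↦ E⟨v⟩⟦x←v⟧` -/
  | ss (E : ECtx) (b : Lam) :
      Root .ss (.ssub E.plugVar b) (.ssub (E.plug ((Tm.lam b).shift (E.depth + 1))) b)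

/-- The skeletal call-by-need strategy: root rules closed by evaluation contexts. -/
inductive Step : PLabel → Tm → Tm → Prop
  | ctx {a : PLabel} {l r : Tm} (E : ECtx) : Root a l r → Step a (E.plug l) (E.plug r)

/-! ### Structural equivalence -/

/-- Exchange of a variable (index `0`) with the `n` variables bound just outside of it. -/
def rot (n : ℕ) : ℕ → ℕ
  | 0 => n
  | i + 1 => if i < n then i else i + 1

/-- `E⟨t[x←u]⟩ ≡ E⟨t⟩[x←u]` and `E⟨t⟦x←v⟧⟩ ≡ E⟨t⟩⟦x←v⟧`, when `E` captures no variable of the moved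
substitution and `x` is not free in `E`. Both conditions are expressed by the weakenings. -/
inductive StrRoot : Tm → Tm → Prop
  | es (E : ECtx) (t u : Tm) :
      StrRoot (E.plug (.sub t (u.shift E.depth)))
        (.sub ((E.ren Nat.succ).plug (t.ren (rot E.depth))) u)
  | skes (E : ECtx) (t : Tm) (b : Lam) :
      StrRoot (E.plug (.ssub t (b.ren (up (fun i => i + E.depth)))))
        (.ssub ((E.ren Nat.succ).plug (t.ren (rot E.depth))) b)

/-- The same equations, under the narrower condition that `E` captures no free variable of the whole
term `t[x←u]` (respectively `t⟦x←v⟧`): it captures no variable of `t` either. -/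
inductive StrRootNarrow : Tm → Tm → Prop
  | es (E : ECtx) (t u : Tm) (h : ∀ i < E.depth, t.occ (i + 1) = false) :
      StrRootNarrow (E.plug (.sub t (u.shift E.depth)))
        (.sub ((E.ren Nat.succ).plug (t.ren (rot E.depth))) u)
  | skes (E : ECtx) (t : Tm) (b : Lam) (h : ∀ i < E.depth, t.occ (i + 1) = false) :
      StrRootNarrow (E.plug (.ssub t (b.ren (up (fun i => i + E.depth)))))
        (.ssub ((E.ren Nat.succ).plug (t.ren (rot E.depth))) b)

/-- Closure of a relation by reflexivity, symmetry, transitivity and evaluation contexts. -/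
inductive EvClosure (R : Tm → Tm → Prop) : Tm → Tm → Prop
  | root {t u : Tm} : R t u → EvClosure R t u
  | refl (t : Tm) : EvClosure R t t
  | symm {t u : Tm} : EvClosure R t u → EvClosure R u t
  | trans {t u s : Tm} : EvClosure R t u → EvClosure R u s → EvClosure R t s
  | ev {t u : Tm} (E : ECtx) : EvClosure R t u → EvClosure R (E.plug t) (E.plug u)

/-- Structural equivalence. -/
def StrEq : Tm → Tm → Prop := EvClosure StrRoot

/-- Structural equivalence, with the narrower side condition. -/
def StrEqNarrow : Tm → Tm → Prop := EvClosure StrRootNarrow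

/-! ### Abstract machines, distilleries and mechanical bisimulations -/

/-- Abstract machines implementing a calculus with terms `T`; principal transitions carry labels
in `A`. -/
structure Machine (T A : Type) where
  State : Type
  principal : A → State → State → Prop
  search : State → State → Prop
  init : T → State → Prop
  decode : State → T

namespace Machine

variable {T A : Type} (M : Machine T A)

/-- Runs, with the sequence of the labels of their transitions, where `none` is the label of search
transitions. -/
inductive Run : M.State → List (Option A) → M.State → Prop
  | nil (Q : M.State) : Run Q [] Q
  | principal {a : A} {r : List (Option A)} {Q Q' Q'' : M.State} :
      M.principal a Q Q' → Run Q' r Q'' → Run Q (some a :: r) Q''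
  | search {r : List (Option A)} {Q Q' Q'' : M.State} :
      M.search Q Q' → Run Q' r Q'' → Run Q (none :: r) Q''

/-- States that are reachable from an initial state. -/
def Reachable (Q : M.State) : Prop := ∃ t Q₀ r, M.init t Q₀ ∧ M.Run Q₀ r Q

/-- No transition applies. -/
def Final (Q : M.State) : Prop := ∀ Q', (∀ a, ¬ M.principal a Q Q') ∧ ¬ M.search Q Q'

end Machine

section

variable {T A : Type}

/-- Evaluation sequences, with the sequence of their labels. -/
inductive Evaluation (step : A → T → T → Prop) : T → List A → T → Prop
  | nil (t : T) : Evaluation step t [] t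
  | cons {a : A} {e : List A} {t u s : T} :
      step a t u → Evaluation step u e s → Evaluation step t (a :: e) s

/-- No step applies. -/
def IsNormal (step : A → T → T → Prop) (t : T) : Prop := ∀ a u, ¬ step a t u

/-- A strategy with an equivalence relation that is a strong bisimulation, label by label. -/
structure IsStructuralStrategy (step : A → T → T → Prop) (equiv : T → T → Prop) : Prop where
  equivalence : Equivalence equiv
  bisim : ∀ a t u t', equiv t u → step a t t' → ∃ u', step a u u' ∧ equiv t' u'

/-- Distilleries. -/
structure IsDistillery (M : Machine T A) (step : A → T → T → Prop) (equiv : T → T → Prop) :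
    Prop where
  projection : ∀ a Q Q', M.Reachable Q → M.principal a Q Q' →
    ∃ u, step a (M.decode Q) u ∧ equiv u (M.decode Q')
  transparency : ∀ Q Q', M.Reachable Q → M.search Q Q' → M.decode Q = M.decode Q'
  termination : WellFounded (fun Q' Q => M.search Q Q')
  determinism : ∀ a a' t u u', step a t u → step a' t u' → a = a' ∧ u = u'
  halt : ∀ Q, M.Reachable Q → M.Final Q → IsNormal step (M.decode Q)

/-- Mechanical bisimulations: runs to evaluations and evaluations to runs, both with the same number
of `a`-transitions and of `a`-steps for every principal label `a`. -/
structure MechBisimilar [DecidableEq A] (M : Machine T A) (step : A → T → T → Prop)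
    (equiv : T → T → Prop) : Prop where
  runs_to_evaluations : ∀ t Q r Q', M.init t Q → M.Run Q r Q' →
    ∃ e u, Evaluation step t e u ∧ equiv u (M.decode Q') ∧ ∀ a, e.count a = r.count (some a)
  evaluations_to_runs : ∀ t Q e u, M.init t Q → Evaluation step t e u →
    ∃ r Q', M.Run Q r Q' ∧ equiv (M.decode Q') u ∧ ∀ a, e.count a = r.count (some a)

end

/-! ### Pre-terms

The machine works on pre-terms, with names and without implicit α-renaming. The names are the
natural numbers. -/

/-- Pre-terms without substitutions. -/
inductive PLam : Type
  | var (x : ℕ) : PLam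
  | lam (x : ℕ) (b : PLam) : PLam
  | app (t u : PLam) : PLam
  deriving DecidableEq

/-- The index of the name `x` in the scope of the binders `Γ` (innermost first); distinct names not
bound in `Γ` are given distinct indices after the ones of `Γ`. -/
def index (Γ : List ℕ) (x : ℕ) : ℕ := if x ∈ Γ then Γ.idxOf x else Γ.length + x

namespace PLam

def fv : PLam → Finset ℕ
  | var x => {x}
  | lam x b => (fv b).erase x
  | app t u => fv t ∪ fv u

/-- All names, free, bound or binding. -/
def names : PLam → List ℕ
  | var x => [x]
  | lam x b => x :: names b
  | app t u => names t ++ names u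

/-- The bound names, one for each abstraction. -/
def binders : PLam → List ℕ
  | var _ => []
  | lam x b => x :: binders b
  | app t u => binders t ++ binders u

/-- The bound names are pairwise distinct. -/
def WellBound (t : PLam) : Prop := t.binders.Nodup

/-- The term modulo α represented by a pre-term in the scope of `Γ`. -/
def toLam : List ℕ → PLam → Lam
  | Γ, var x => .var (index Γ x)
  | Γ, lam x b => .lam (toLam (x :: Γ) b)
  | Γ, app t u => .app (toLam Γ t) (toLam Γ u)

def AlphaEq (t u : PLam) : Prop := t.toLam [] = u.toLam []

def IsValue : PLam → Prop
  | lam _ _ => True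
  | _ => False

/-- `SkelDec θ t s F` : the skeletal decomposition of `t` relative to `θ` is `(s, F)`, where the
substitution context `⟨·⟩[x₁←t₁]…[xₖ←tₖ]` is given as the list `F` of the `(xᵢ, tᵢ)`. The freshness
of the `xᵢ` is required separately. -/
inductive SkelDec : Finset ℕ → PLam → PLam → List (ℕ × PLam) → Prop
  | extract {θ : Finset ℕ} {t : PLam} (z : ℕ) :
      (∀ x, t ≠ var x) → Disjoint t.fv θ → SkelDec θ t (var z) [(z, t)]
  | var {θ : Finset ℕ} (x : ℕ) : SkelDec θ (var x) (var x) []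
  | lam {θ : Finset ℕ} {x : ℕ} {b s : PLam} {F : List (ℕ × PLam)} :
      ¬ Disjoint (lam x b).fv θ → SkelDec (insert x θ) b s F → SkelDec θ (lam x b) (lam x s) F
  | app {θ : Finset ℕ} {t u s p : PLam} {F G : List (ℕ × PLam)} :
      ¬ Disjoint (app t u).fv θ → SkelDec θ t s F → SkelDec θ u p G →
      SkelDec θ (app t u) (app s p) (F ++ G)

end PLam

/-- Pre-terms with explicit substitutions `t[x←u]` and skeletal substitutions `t⟦x←λy.b⟧`. -/
inductive PTm : Type
  | var (x : ℕ) : PTm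
  | lam (x : ℕ) (b : PLam) : PTm
  | app (t u : PTm) : PTm
  | sub (t : PTm) (x : ℕ) (u : PTm) : PTm
  | ssub (t : PTm) (x : ℕ) (y : ℕ) (b : PLam) : PTm

def PLam.toPTm : PLam → PTm
  | .var x => .var x
  | .lam x b => .lam x b
  | .app t u => .app t.toPTm u.toPTm

/-- The term modulo α represented by a pre-term in the scope of `Γ`. -/
def PTm.toTm : List ℕ → PTm → Tm
  | Γ, .var x => .var (index Γ x)
  | Γ, .lam x b => .lam (b.toLam (x :: Γ))
  | Γ, .app t u => .app (t.toTm Γ) (u.toTm Γ)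
  | Γ, .sub t x u => .sub (t.toTm (x :: Γ)) (u.toTm Γ)
  | Γ, .ssub t x y b => .ssub (t.toTm (x :: Γ)) (b.toLam (y :: Γ))

/-! ### The skeletal MAD -/

/-- Environment entries `[x←t]` and `⟦x←λy.b⟧`. -/
inductive Entry : Type
  | es (x : ℕ) (t : PLam) : Entry
  | skes (x : ℕ) (y : ℕ) (b : PLam) : Entry

/-- Items `(x, S, E[x←·])` of the chain. -/
structure Item where
  name : ℕ
  stack : List PLam
  env : List Entry

/-- States. The head of the list `chain` is the item added last; the heads of the stack and of the
environment are their leftmost elements. -/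
structure State where
  chain : List Item
  code : PLam
  stack : List PLam
  env : List Entry

def Entry.names : Entry → List ℕ
  | .es x t => x :: t.names
  | .skes x y b => x :: y :: b.names

def Item.names (I : Item) : List ℕ :=
  I.name :: (I.stack.flatMap PLam.names ++ I.env.flatMap Entry.names)

/-- All the names occurring in a state, in any form. -/
def State.names (Q : State) : List ℕ :=
  Q.chain.flatMap Item.names ++ Q.code.names ++ Q.stack.flatMap PLam.names ++
    Q.env.flatMap Entry.names

/-- The entries induced by a flesh. -/
def fleshEnv (F : List (ℕ × PLam)) : List Entry := F.map (fun p => .es p.1 p.2)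

inductive SLabel : Type
  | sea1 | sea2 | sea3

/-- Search transitions. -/
inductive Search : SLabel → State → State → Prop
  | sea1 (C : List Item) (t u : PLam) (S : List PLam) (E : List Entry) :
      Search .sea1 ⟨C, .app t u, S, E⟩ ⟨C, t, u :: S, E⟩
  | sea2 (C : List Item) (x : ℕ) (t : PLam) (S : List PLam) (E E' : List Entry) :
      ¬ t.IsValue →
      Search .sea2 ⟨C, .var x, S, E ++ .es x t :: E'⟩ ⟨⟨x, S, E⟩ :: C, t, [], E'⟩
  | sea3 (C : List Item) (x : ℕ) (v : PLam) (S : List PLam) (E E' : List Entry) :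
      v.IsValue →
      Search .sea3 ⟨⟨x, S, E⟩ :: C, v, [], E'⟩ ⟨C, .var x, S, E ++ .es x v :: E'⟩

/-- Principal transitions. -/
inductive Principal : PLabel → State → State → Prop
  | beta (C : List Item) (x : ℕ) (t u : PLam) (S : List PLam) (E : List Entry) :
      Principal .dB ⟨C, .lam x t, u :: S, E⟩ ⟨C, t, S, .es x u :: E⟩
  /-- The value of the entry on `x` is replaced by its skeleton, and its flesh is added to the
  environment; the names of the flesh are distinct and fresh. -/
  | sk (C : List Item) (x y : ℕ) (b s : PLam) (F : List (ℕ × PLam)) (S : List PLam)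
      (E E' : List Entry) :
      PLam.SkelDec {y} b s F → (F.map Prod.fst).Nodup →
      (∀ z ∈ F.map Prod.fst, z ∉ State.names ⟨C, .var x, S, E ++ .es x (.lam y b) :: E'⟩) →
      Principal .sk ⟨C, .var x, S, E ++ .es x (.lam y b) :: E'⟩
        ⟨C, .var x, S, E ++ .skes x y s :: (fleshEnv F ++ E')⟩
  /-- The code `w` is any well-bound renaming of the value, with fresh bound names. -/
  | ss (C : List Item) (x y : ℕ) (b w : PLam) (S : List PLam) (E E' : List Entry) :
      w.AlphaEq (.lam y b) → w.WellBound →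
      (∀ z ∈ w.binders, z ∉ State.names ⟨C, .var x, S, E ++ .skes x y b :: E'⟩) →
      Principal .ss ⟨C, .var x, S, E ++ .skes x y b :: E'⟩ ⟨C, w, S, E ++ .skes x y b :: E'⟩

/-- Initialization: the code is a well-bound pre-term representing a closed ordinary λ-term. -/
def Init (t : Tm) (Q : State) : Prop :=
  ∃ (s : Lam) (p : PLam), s.Closed ∧ t = s.toTm ∧ p.toLam [] = s ∧ p.WellBound ∧ Q = ⟨[], p, [], []⟩

/-! Read-back: stacks, environments and chains are read back as contexts, that is, as the operations
of plugging a pre-term in these contexts. -/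

def readStack : List PLam → PTm → PTm
  | [], t => t
  | u :: S, t => readStack S (.app t u.toPTm)

def readEnv : List Entry → PTm → PTm
  | [], t => t
  | .es x u :: E, t => readEnv E (.sub t x u.toPTm)
  | .skes x y b :: E, t => readEnv E (.ssub t x y b)

def readChain : List Item → PTm → PTm
  | [], t => t
  | I :: C, t => .sub (readEnv I.env (readChain C (readStack I.stack (.var I.name)))) I.name t

def readBack (Q : State) : PTm :=
  readEnv Q.env (readChain Q.chain (readStack Q.stack Q.code.toPTm))

/-- The skeletal MAD. States are read back to terms modulo α. -/
def SkMAD : Machine Tm PLabel where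
  State := State
  principal := Principal
  search := fun Q Q' => ∃ l, Search l Q Q'
  init := Init
  decode := fun Q => (readBack Q).toTm []

end SkNeed

open SkNeed

namespace SkNeed

/-! ### Renamings -/

/-! The strategy is a partial function in disguise. Following the frames of evaluation contexts,
every term has exactly one head: it is an answer S⟨v⟩, it is E⟨x⟩ for a needed free variable x, or
it contains the next redex. `Tm.head` computes this head and `Tm.next` the contractum. By
`Step.next_eq` a step forces head `.red` and is the value of `next`; by `Tm.head_cases` head `.red`
conversely yields a step. Determinism follows, and so does the normality of answers.

Structural equivalence is cut into moves of one substitution through one frame. `ElemEq c` has the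
frame ⟨·⟩w, the frame E⟨x⟩[x←⟨·⟩], and, only when `c` holds, the exchange of two adjacent
substitutions. `ElemEq True` is ≡ (`strEq_iff`), while `ElemEq False` is contained in the narrow
relation (`ElemEq.strEqNarrow`). An induction on the derivation shows that related terms have the
same head and related results for every way of consuming them (`Match`, `ElemEq.toMatch`). The
critical case is a skeletonization whose substitution also moves out of a context: the substitution
context of the answer, the flesh and the new skeletal substitution must all leave that context,
which is `ElemEq.plug_skelAns`. Hence `ElemEq c` is a strong bisimulation for every `c`.

On the machine side, `read_ctx` reads a state back as an evaluation context filled with its code, so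
a principal transition becomes a root rule. For sk and ss the contractum is the new read-back
exactly. After β the new substitution still has to cross the stack and the chain to reach the
environment; these frames capture nothing, so no exchange of substitutions is needed and `ElemEq c`
suffices for every `c`. Capture is excluded by the invariant `State.Inv`: distinct bound names,
scoping, and skeletal values in skeletal entries. Scoping and the existence of fresh names leave an
answer as the only final shape; a weight that drops at each search transition gives termination.

Bisimilarity is then abstract: any distillery over a structural strategy yields it. The results are
proved for `ElemEq c` and transported along inclusions, so the narrow relation itself is never
required to be a bisimulation. -/

theorem up_apply (ξ : ℕ → ℕ) (i : ℕ) : up ξ i = if i = 0 then 0 else ξ (i - 1) + 1 := by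
  cases i <;> simp [up]

theorem rot_apply (n i : ℕ) : rot n i = if i = 0 then n else if i ≤ n then i - 1 else i := by
  cases i with
  | zero => simp [rot]
  | succ i => simp [rot]

/-- Extension of a renaming under `d` binders. -/
def upn (d : ℕ) (ξ : ℕ → ℕ) : ℕ → ℕ := fun i => if i < d then i else ξ (i - d) + d

theorem upn_zero (ξ : ℕ → ℕ) : upn 0 ξ = ξ := by
  funext i; simp [upn]

theorem up_upn (d : ℕ) (ξ : ℕ → ℕ) : up (upn d ξ) = upn (d + 1) ξ := by
  funext i
  cases i with
  | zero => simp [up, upn]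
  | succ i => simp only [up, upn, Nat.add_lt_add_iff_right, Nat.add_sub_add_right]; split_ifs <;> omega

theorem upn_up (d : ℕ) (ξ : ℕ → ℕ) : upn d (up ξ) = upn (d + 1) ξ := by
  induction d with
  | zero => rw [upn_zero, ← up_upn, upn_zero]
  | succ d ih => rw [← up_upn, ih, up_upn]

theorem upn_one (ξ : ℕ → ℕ) : upn 1 ξ = up ξ := by
  rw [← upn_up, upn_zero]

theorem up_up (ξ ζ : ℕ → ℕ) : (fun i => up ξ (up ζ i)) = up (fun i => ξ (ζ i)) := by
  funext i; cases i <;> rfl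

namespace Lam

theorem ren_ren (t : Lam) : ∀ ξ ζ : ℕ → ℕ, (t.ren ζ).ren ξ = t.ren (fun i => ξ (ζ i)) := by
  induction t with
  | var i => intros; rfl
  | lam b ih => intros; simp only [ren, ih, up_up]
  | app t u iht ihu => intros; simp only [ren, iht, ihu]

theorem ren_congr (t : Lam) :
    ∀ ξ ζ : ℕ → ℕ, (∀ i, t.occ i = true → ξ i = ζ i) → t.ren ξ = t.ren ζ := by
  induction t with
  | var i => intro ξ ζ h; simp only [ren]; rw [h i (by simp [occ])]
  | lam b ih =>
    intro ξ ζ h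
    simp only [ren]
    rw [ih (up ξ) (up ζ)]
    intro i hi
    cases i with
    | zero => rfl
    | succ i => simp only [up]; rw [h i hi]
  | app t u iht ihu =>
    intro ξ ζ h
    simp only [ren]
    rw [iht ξ ζ (fun i hi => h i (by simp [occ, hi])), ihu ξ ζ (fun i hi => h i (by simp [occ, hi]))]

theorem occ_ren_upn (t : Lam) :
    ∀ (d : ℕ) (ξ : ℕ → ℕ) (i : ℕ), i < d → (t.ren (upn d ξ)).occ i = t.occ i := by
  induction t with
  | var j =>
    intro d ξ i hi
    simp only [ren, occ, upn]
    split_ifs with h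
    · rfl
    · rw [Bool.eq_iff_iff, beq_iff_eq, beq_iff_eq]; omega
  | lam b ih => intro d ξ i hi; simp only [ren, occ, up_upn]; exact ih _ _ _ (by omega)
  | app t u iht ihu => intro d ξ i hi; simp only [ren, occ, iht d ξ i hi, ihu d ξ i hi]

/-- Extraction inspects only the `d` innermost indices, which `upn d ξ` fixes and to which it sends
nothing else. -/
theorem extract_ren (t : Lam) (d : ℕ) (ξ : ℕ → ℕ) :
    (t.ren (upn d ξ)).Extract d ↔ t.Extract d := by
  have h1 : (t.ren (upn d ξ)).isVar = t.isVar := by cases t <;> rfl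
  unfold Extract
  rw [h1]
  refine and_congr Iff.rfl (forall₂_congr fun i hi => ?_)
  rw [occ_ren_upn t d ξ i hi]

/-- An extractable term contains no index below `d`, so the truncated subtraction is never actually
truncated. -/
theorem ren_sub_ren (t : Lam) (d : ℕ) (ξ : ℕ → ℕ) (h : t.Extract d) :
    (t.ren (upn d ξ)).ren (fun i => i - d) = (t.ren (fun i => i - d)).ren ξ := by
  rw [ren_ren, ren_ren]
  refine ren_congr _ _ _ fun i hi => ?_
  have : ¬ i < d := fun hd => by simp [h.2 i hd] at hi
  simp [upn, this]

theorem fleshAt_ren (t : Lam) :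
    ∀ (d : ℕ) (ξ : ℕ → ℕ), fleshAt d (t.ren (upn d ξ)) = (fleshAt d t).map (ren ξ) := by
  induction t with
  | var i => intros; rfl
  | lam b ih =>
    intro d ξ
    have h1 := extract_ren (lam b) d ξ
    have h2 := ren_sub_ren (lam b) d ξ
    simp only [ren] at h1 h2
    simp only [ren, fleshAt, h1]
    split_ifs with h
    · simp only [List.map_cons, List.map_nil, ren, h2 h]
    · rw [up_upn, ih]
  | app t u iht ihu =>
    intro d ξ
    have h1 := extract_ren (app t u) d ξ
    have h2 := ren_sub_ren (app t u) d ξ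
    simp only [ren] at h1 h2
    simp only [ren, fleshAt, h1]
    split_ifs with h
    · simp only [List.map_cons, List.map_nil, ren, h2 h]
    · rw [List.map_append, iht, ihu]

/-- The bound on `o` keeps every flesh variable created inside `t` below `d + k`, where the lifted
renaming is the identity; without it these variables could be renamed. -/
theorem skelAt_ren (t : Lam) :
    ∀ (d o k : ℕ) (ξ : ℕ → ℕ), o + (fleshAt d t).length ≤ k →
      skelAt d o k (t.ren (upn d ξ)) = (skelAt d o k t).ren (upn (d + k) ξ) := by
  induction t with
  | var i =>
    intro d o k ξ _
    simp only [ren, skelAt, upn]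
    by_cases h : i < d
    · simp [h, ren, upn, Nat.lt_add_right k h]
    · have h1 : ¬ ξ (i - d) + d < d := by omega
      have h2 : ¬ i + k < d + k := by omega
      simp only [h, if_false, h1, ren, upn, h2, show i + k - (d + k) = i - d by omega, Nat.add_assoc]
  | lam b ih =>
    intro d o k ξ hk
    have h1 := extract_ren (lam b) d ξ
    simp only [ren] at h1
    simp only [ren, skelAt, h1]
    simp only [fleshAt] at hk
    split_ifs with h
    · rw [if_pos h] at hk
      simp only [List.length_singleton] at hk
      simp only [ren, upn]
      rw [if_pos (by omega)]
    · rw [if_neg h] at hk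
      rw [up_upn, ih _ _ _ _ hk]
      simp only [ren, up_upn]
      rw [show d + 1 + k = d + k + 1 by omega]
  | app t u iht ihu =>
    intro d o k ξ hk
    have h1 := extract_ren (app t u) d ξ
    simp only [ren] at h1
    simp only [ren, skelAt, h1]
    simp only [fleshAt] at hk
    split_ifs with h
    · rw [if_pos h] at hk
      simp only [List.length_singleton] at hk
      simp only [ren, upn]
      rw [if_pos (by omega)]
    · rw [if_neg h] at hk
      simp only [List.length_append] at hk
      rw [iht _ _ _ _ (by omega), fleshAt_ren, List.length_map, ihu _ _ _ _ (by omega)]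
      simp only [ren]

theorem fleshList_ren (b : Lam) (ξ : ℕ → ℕ) :
    (b.ren (up ξ)).fleshList = b.fleshList.map (ren ξ) := by
  unfold fleshList; rw [← upn_one, fleshAt_ren]

theorem skeleton_ren (b : Lam) (ξ : ℕ → ℕ) :
    (b.ren (up ξ)).skeleton = b.skeleton.ren (up (upn b.fleshList.length ξ)) := by
  unfold skeleton
  rw [fleshList_ren, List.length_map, ← upn_one, skelAt_ren _ _ _ _ _ (by simp [fleshList]),
    up_upn, Nat.add_comm]

theorem toTm_ren (t : Lam) (ξ : ℕ → ℕ) : (t.ren ξ).toTm = t.toTm.ren ξ := by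
  induction t with
  | var i => rfl
  | lam b _ => rfl
  | app t u iht ihu => simp only [ren, toTm, Tm.ren, iht, ihu]

end Lam

/-! ### Substitutions and contexts -/

/-- The content of an explicit or skeletal substitution. -/
inductive Sb : Type
  | es (u : Tm) : Sb
  | skes (b : Lam) : Sb

def Sb.ren (ξ : ℕ → ℕ) : Sb → Sb
  | es u => es (u.ren ξ)
  | skes b => skes (b.ren (up ξ))

def Sb.shift (n : ℕ) (σ : Sb) : Sb := σ.ren (fun i => i + n)

namespace Tm

def wrap (t : Tm) : Sb → Tm
  | .es u => sub t u
  | .skes b => ssub t b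

theorem wrap_ren (t : Tm) (σ : Sb) (ξ : ℕ → ℕ) :
    (t.wrap σ).ren ξ = (t.ren (up ξ)).wrap (σ.ren ξ) := by
  cases σ <;> rfl

theorem ren_ren (t : Tm) : ∀ ξ ζ : ℕ → ℕ, (t.ren ζ).ren ξ = t.ren (fun i => ξ (ζ i)) := by
  induction t with
  | var i => intros; rfl
  | lam b => intros; simp only [ren, Lam.ren_ren, up_up]
  | app t u iht ihu => intros; simp only [ren, iht, ihu]
  | sub t u iht ihu => intros; simp only [ren, iht, ihu, up_up]
  | ssub t b iht => intros; simp only [ren, iht, Lam.ren_ren, up_up]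

theorem shift_ren (t : Tm) (n : ℕ) (ξ : ℕ → ℕ) :
    (t.shift n).ren (upn n ξ) = (t.ren ξ).shift n := by
  unfold shift; rw [ren_ren, ren_ren]; congr 1; funext i; simp [upn]

theorem shift_one_ren (t : Tm) (ξ : ℕ → ℕ) : (t.shift 1).ren (up ξ) = (t.ren ξ).shift 1 := by
  rw [← upn_one, shift_ren]

theorem shift_shift (t : Tm) (m n : ℕ) : (t.shift m).shift n = t.shift (m + n) := by
  unfold shift; rw [ren_ren]; congr 1; funext i; omega

theorem ren_id (t : Tm) (ξ : ℕ → ℕ) (h : ∀ i, ξ i = i) : t.ren ξ = t := by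
  have hl : ∀ (b : Lam) (ξ : ℕ → ℕ), (∀ i, ξ i = i) → b.ren ξ = b := by
    intro b
    induction b with
    | var i => intro ξ h; simp only [Lam.ren, h]
    | lam b ih => intro ξ h; simp only [Lam.ren]; rw [ih]; intro i; cases i <;> simp [up, h]
    | app t u iht ihu => intro ξ h; simp only [Lam.ren]; rw [iht _ h, ihu _ h]
  have hu : ∀ ξ : ℕ → ℕ, (∀ i, ξ i = i) → ∀ i, up ξ i = i := by
    intro ξ h i; cases i <;> simp [up, h]
  induction t generalizing ξ with
  | var i => simp only [ren, h]
  | lam b => simp only [ren]; rw [hl _ _ (hu _ h)]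
  | app t u iht ihu => simp only [ren]; rw [iht _ h, ihu _ h]
  | sub t u iht ihu => simp only [ren]; rw [iht _ (hu _ h), ihu _ h]
  | ssub t b iht => simp only [ren]; rw [iht _ (hu _ h), hl _ _ (hu _ h)]

theorem shift_zero (t : Tm) : t.shift 0 = t := ren_id _ _ fun _ => rfl

end Tm

theorem Sb.ren_ren (σ : Sb) (ξ ζ : ℕ → ℕ) : (σ.ren ζ).ren ξ = σ.ren (fun i => ξ (ζ i)) := by
  cases σ <;> simp only [Sb.ren, Tm.ren_ren, Lam.ren_ren, up_up]

theorem Sb.shift_one_ren (σ : Sb) (ξ : ℕ → ℕ) : (σ.shift 1).ren (up ξ) = (σ.ren ξ).shift 1 := by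
  unfold shift; rw [ren_ren, ren_ren]; congr 1

namespace ECtx

theorem depth_ren (E : ECtx) : ∀ ξ : ℕ → ℕ, (E.ren ξ).depth = E.depth := by
  induction E <;> intros <;> simp_all [ren, depth]

theorem plug_ren (E : ECtx) :
    ∀ (t : Tm) (ξ : ℕ → ℕ), (E.plug t).ren ξ = (E.ren ξ).plug (t.ren (upn E.depth ξ)) := by
  induction E with
  | hole => intros; simp [ren, plug, depth, upn_zero]
  | app E u ih => intros; simp only [ren, plug, depth, Tm.ren, ih]
  | sub E u ih => intros; simp only [ren, plug, depth, Tm.ren, ih, upn_up]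
  | ssub E b ih => intros; simp only [ren, plug, depth, Tm.ren, ih, upn_up]
  | dem E E' ih ih' =>
    intros; simp only [ren, plug, depth, Tm.ren, ih, ih', upn_up, depth_ren]; simp [upn]

theorem ren_ren (E : ECtx) : ∀ ξ ζ : ℕ → ℕ, (E.ren ζ).ren ξ = E.ren (fun i => ξ (ζ i)) := by
  induction E with
  | hole => intros; rfl
  | app E u ih => intros; simp only [ren, ih, Tm.ren_ren]
  | sub E u ih => intros; simp only [ren, ih, Tm.ren_ren, up_up]
  | ssub E b ih => intros; simp only [ren, ih, Lam.ren_ren, up_up]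
  | dem E E' ih ih' => intros; simp only [ren, ih, ih', up_up]

theorem ren_id (E : ECtx) : E.ren (fun i => i + 0) = E := by
  have hl : ∀ b : Lam, b.ren (up fun i => i + 0) = b := fun b => by
    have := Tm.ren_id (.lam b) (fun i => i + 0) (fun _ => rfl)
    simpa [Tm.ren] using this
  have h : ∀ (E : ECtx) (ξ : ℕ → ℕ), (∀ i, ξ i = i) → E.ren ξ = E := by
    intro E
    have hu : ∀ ξ : ℕ → ℕ, (∀ i, ξ i = i) → ∀ i, up ξ i = i := by
      intro ξ h i; cases i <;> simp [up, h]
    induction E with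
    | hole => intros; rfl
    | app E u ih => intro ξ h; simp only [ren]; rw [ih _ h, Tm.ren_id _ _ h]
    | sub E u ih => intro ξ h; simp only [ren]; rw [ih _ (hu _ h), Tm.ren_id _ _ h]
    | ssub E b ih =>
      intro ξ h; simp only [ren]; rw [ih _ (hu _ h)]
      have hξ : ξ = fun i => i + 0 := funext h
      rw [hξ, hl]
    | dem E E' ih ih' => intro ξ h; simp only [ren]; rw [ih _ (hu _ h), ih' _ h]
  exact h E _ fun _ => rfl

/-- The context `⟨·⟩[x←u]` or `⟨·⟩⟦x←v⟧`. -/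
def ofSb : Sb → ECtx
  | .es u => sub hole u
  | .skes b => ssub hole b

theorem ofSb_plug (σ : Sb) (t : Tm) : (ofSb σ).plug t = t.wrap σ := by cases σ <;> rfl

theorem ofSb_depth (σ : Sb) : (ofSb σ).depth = 1 := by cases σ <;> rfl

theorem ofSb_ren (σ : Sb) (ξ : ℕ → ℕ) : (ofSb σ).ren ξ = ofSb (σ.ren ξ) := by cases σ <;> rfl

end ECtx

/-! ### The strategy as a function -/

/-- The head of a term: an answer `S⟨v⟩`, a needed variable, or a redex. -/
inductive Head : Type
  | ans
  | need (i : ℕ)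
  | red
  deriving DecidableEq

namespace Head

/-- The head of a term under one more substitution, when the variable of the substitution is not
needed. -/
def pred : Head → Head
  | need (i + 1) => need i
  | h => h

/-- The head of an application or of a demanded substitution, given the head of the demanded
sub-term. -/
def fire : Head → Head
  | ans => red
  | h => h

def ren (ξ : ℕ → ℕ) : Head → Head
  | need i => need (ξ i)
  | h => h

end Head

namespace Tm

/-- The clauses mirror the frames of evaluation contexts: the content of an explicit substitution is
inspected only if the body needs its variable. A needed skeletal variable is already a redex, since
its content is a value. -/
def head : Tm → Head
  | var i => .need i
  | lam _ => .ans
  | app t _ => t.head.fire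
  | sub t u => if t.head = .need 0 then u.head.fire else t.head.pred
  | ssub t _ => if t.head = .need 0 then .red else t.head.pred

/-- Replacement of the occurrence of the needed variable. -/
def substNeeded : Tm → Tm → Tm
  | var _, v => v
  | lam b, _ => lam b
  | app t u, v => app (t.substNeeded v) u
  | sub t u, v =>
    if t.head = .need 0 then sub t (u.substNeeded v) else sub (t.substNeeded (v.shift 1)) u
  | ssub t b, v => ssub (t.substNeeded (v.shift 1)) b

/-- The contractum of the application of an answer. -/
def betaAns : Tm → Tm → Tm
  | lam b, u => sub b.toTm u
  | sub t w, u => sub (t.betaAns (u.shift 1)) w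
  | ssub t b, u => ssub (t.betaAns (u.shift 1)) b
  | t, u => app t u

/-- `⟨t⟩[x₁←t₁]…[xₖ←tₖ]` where the `tᵢ` live outside of the scope of all the `xᵢ`. -/
def subList : List Lam → Tm → Tm
  | [], t => t
  | a :: l, t => subList l (sub t (a.toTm.shift l.length))

/-- The contractum of `s[x←u]`, where `u` is an answer. -/
def skelAns : Tm → Tm → Tm
  | lam b, s =>
    subList b.fleshList (ssub (s.ren (up (fun i => i + b.fleshList.length))) b.skeleton)
  | sub t w, s => sub (t.skelAns (s.ren (up Nat.succ))) w
  | ssub t b, s => ssub (t.skelAns (s.ren (up Nat.succ))) b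
  | t, s => sub s t

/-- The step from a term whose head is a redex. -/
def next : Tm → PLabel × Tm
  -- Variables and values have no step. These placeholders commute with renamings, so that
  -- `next_ren` needs no hypothesis on the head.
  | var i => (.dB, var i)
  | lam b => (.dB, lam b)
  | app t u =>
    if t.head = .ans then (.dB, t.betaAns u) else (t.next.1, app t.next.2 u)
  | sub t u =>
    if t.head = .need 0 then
      if u.head = .ans then (.sk, u.skelAns t) else (u.next.1, sub t u.next.2)
    else (t.next.1, sub t.next.2 u)
  | ssub t b =>
    if t.head = .need 0 then (.ss, ssub (t.substNeeded ((lam b).shift 1)) b)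
    else (t.next.1, ssub t.next.2 b)

/-! ### Equivariance of the head and of the one-step function under renamings. -/

/-- Only index 0 is sent to 0 by `up ξ`, even if `ξ` is not injective; hence a renaming never
changes which branch of the functions on terms is taken. -/
theorem head_ren_up_eq (h : Head) (ξ : ℕ → ℕ) : h.ren (up ξ) = .need 0 ↔ h = .need 0 := by
  cases h with
  | need i => cases i <;> simp [Head.ren, up]
  | ans => simp [Head.ren]
  | red => simp [Head.ren]

theorem head_fire_ren (h : Head) (ξ : ℕ → ℕ) : (h.ren ξ).fire = h.fire.ren ξ := by
  cases h <;> rfl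

theorem head_pred_ren (h : Head) (ξ : ℕ → ℕ) (h0 : h ≠ .need 0) :
    (h.ren (up ξ)).pred = h.pred.ren ξ := by
  cases h with
  | need i => cases i with
    | zero => exact absurd rfl h0
    | succ i => rfl
  | ans => rfl
  | red => rfl

theorem head_ren_eq_ans (h : Head) (ξ : ℕ → ℕ) : h.ren ξ = .ans ↔ h = .ans := by
  cases h <;> simp [Head.ren]

theorem head_ren (t : Tm) : ∀ ξ : ℕ → ℕ, (t.ren ξ).head = t.head.ren ξ := by
  induction t with
  | var i => intros; rfl
  | lam b => intros; rfl
  | app t u iht _ => intros; simp only [ren, head, iht, head_fire_ren]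
  | sub t u iht ihu =>
    intro ξ
    simp only [ren, head, iht, ihu, head_ren_up_eq]
    split_ifs with h
    · rw [head_fire_ren]
    · rw [head_pred_ren _ _ h]
  | ssub t b iht =>
    intro ξ
    simp only [ren, head, iht, head_ren_up_eq]
    split_ifs with h
    · rfl
    · rw [head_pred_ren _ _ h]

theorem substNeeded_ren (t : Tm) : ∀ (v : Tm) (ξ : ℕ → ℕ),
    (t.substNeeded v).ren ξ = (t.ren ξ).substNeeded (v.ren ξ) := by
  induction t with
  | var i => intros; rfl
  | lam b => intros; rfl
  | app t u iht _ => intros; simp only [ren, substNeeded, iht]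
  | sub t u iht ihu =>
    intro v ξ
    simp only [ren, substNeeded, head_ren, head_ren_up_eq]
    split_ifs with h
    · simp only [ren, ihu]
    · simp only [ren, iht, shift_one_ren]
  | ssub t b iht => intro v ξ; simp only [ren, substNeeded, iht, shift_one_ren]

theorem betaAns_ren (t : Tm) : ∀ (u : Tm) (ξ : ℕ → ℕ),
    (t.betaAns u).ren ξ = (t.ren ξ).betaAns (u.ren ξ) := by
  induction t with
  | var i => intros; rfl
  | lam b => intros; simp only [betaAns, ren, Lam.toTm_ren]
  | app t u _ _ => intros; rfl
  | sub t w iht _ => intros; simp only [betaAns, ren, iht, shift_one_ren]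
  | ssub t b iht => intros; simp only [betaAns, ren, iht, shift_one_ren]

theorem subList_ren (l : List Lam) : ∀ (t : Tm) (ξ : ℕ → ℕ),
    (subList l t).ren ξ = subList (l.map (Lam.ren ξ)) (t.ren (upn l.length ξ)) := by
  induction l with
  | nil => intros; simp [subList, upn_zero]
  | cons a l ih =>
    intro t ξ
    simp only [subList, ih, ren, List.map_cons, List.length_map, List.length_cons, up_upn,
      shift_ren, Lam.toTm_ren]

theorem skelAns_ren (t : Tm) : ∀ (s : Tm) (ξ : ℕ → ℕ),
    (t.skelAns s).ren ξ = (t.ren ξ).skelAns (s.ren (up ξ)) := by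
  induction t with
  | var i => intros; rfl
  | lam b =>
    intro s ξ
    simp only [skelAns, ren, subList_ren, Lam.fleshList_ren, List.length_map, Lam.skeleton_ren,
      ren_ren, up_up]
    congr 4
    funext i; simp [upn]
  | app t u _ _ => intros; rfl
  | sub t w iht _ => intros; simp only [skelAns, ren, iht, ren_ren, up_up]; rfl
  | ssub t b iht => intros; simp only [skelAns, ren, iht, ren_ren, up_up]; rfl

theorem next_ren (t : Tm) : ∀ ξ : ℕ → ℕ, (t.ren ξ).next = (t.next.1, t.next.2.ren ξ) := by
  induction t with
  | var i => intros; rfl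
  | lam b => intros; rfl
  | app t u iht _ =>
    intro ξ
    simp only [ren, next, head_ren, head_ren_eq_ans]
    split_ifs with h
    · simp only [betaAns_ren]
    · simp only [iht, ren]
  | sub t u iht ihu =>
    intro ξ
    simp only [ren, next, head_ren, head_ren_up_eq, head_ren_eq_ans]
    split_ifs with h h'
    · simp only [skelAns_ren]
    · simp only [ihu, ren]
    · simp only [iht, ren]
  | ssub t b iht =>
    intro ξ
    simp only [ren, next, head_ren, head_ren_up_eq]
    split_ifs with h
    · simp only [ren, substNeeded_ren, shift_one_ren]
    · simp only [iht, ren]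

end Tm

/-! ### The functional presentation is the strategy -/

theorem SCtx.plug_addList (l : List Lam) : ∀ (S : SCtx) (t : Tm),
    (S.addList l).plug t = Tm.subList l (S.plug t) := by
  induction l with
  | nil => intros; rfl
  | cons a l ih => intros; simp only [addList, ih, plug, Tm.subList]

theorem SCtx.depth_addList (l : List Lam) : ∀ S : SCtx,
    (S.addList l).depth = S.depth + l.length := by
  induction l with
  | nil => intros; rfl
  | cons a l ih => intros; simp only [addList, ih, depth, List.length_cons]; omega

theorem flesh_plug (b : Lam) (t : Tm) : (flesh b).plug t = Tm.subList b.fleshList t := by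
  rw [flesh, SCtx.plug_addList]; rfl

theorem flesh_depth (b : Lam) : (flesh b).depth = b.fleshList.length := by
  rw [flesh, SCtx.depth_addList]; simp [SCtx.depth]

theorem SCtx.head_plug (S : SCtx) (b : Lam) : (S.plug (.lam b)).head = .ans := by
  induction S with
  | hole => rfl
  | sub S u ih => simp [plug, Tm.head, ih, Head.pred]
  | ssub S u ih => simp [plug, Tm.head, ih, Head.pred]

theorem SCtx.betaAns_plug (S : SCtx) (b : Lam) : ∀ u : Tm,
    (S.plug (.lam b)).betaAns u = S.plug (.sub b.toTm (u.shift S.depth)) := by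
  induction S with
  | hole => intro u; simp only [plug, Tm.betaAns, depth, Tm.shift_zero]
  | sub S w ih => intro u; simp only [plug, Tm.betaAns, depth, ih, Tm.shift_shift, Nat.add_comm 1]
  | ssub S w ih => intro u; simp only [plug, Tm.betaAns, depth, ih, Tm.shift_shift, Nat.add_comm 1]

theorem SCtx.skelAns_plug (S : SCtx) (b : Lam) : ∀ s : Tm,
    (S.plug (.lam b)).skelAns s = S.plug ((flesh b).plug
      (.ssub (s.ren (up (fun i => i + ((flesh b).depth + S.depth)))) b.skeleton)) := by
  induction S with
  | hole => intro u; simp only [plug, Tm.skelAns, depth, flesh_plug, flesh_depth, Nat.add_zero]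
  | sub S w ih =>
    intro s; simp only [plug, Tm.skelAns, depth, ih, Tm.ren_ren, up_up]
    congr 6; funext i; omega
  | ssub S w ih =>
    intro s; simp only [plug, Tm.skelAns, depth, ih, Tm.ren_ren, up_up]
    congr 6; funext i; omega

/-- The index `i` outside of the context has to vary: crossing a substitution frame turns the needed
variable `i` into `i + 1`, which `Head.pred` undoes. -/
theorem ECtx.head_plug_var (E : ECtx) : ∀ i, (E.plug (.var (E.depth + i))).head = .need i := by
  induction E with
  | hole => intro i; simp [plug, depth, Tm.head]
  | app E u ih => intro i; simp [plug, depth, Tm.head, ih, Head.fire]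
  | sub E u ih =>
    intro i
    have := ih (i + 1)
    simp only [plug, depth, Tm.head, show E.depth + 1 + i = E.depth + (i + 1) by omega, this]
    simp [Head.pred]
  | ssub E u ih =>
    intro i
    have := ih (i + 1)
    simp only [plug, depth, Tm.head, show E.depth + 1 + i = E.depth + (i + 1) by omega, this]
    simp [Head.pred]
  | dem E E' ih ih' =>
    intro i
    have := ih 0
    rw [Nat.add_zero] at this
    simp [plug, depth, Tm.head, this, ih', Head.fire]

theorem ECtx.head_plugVar (E : ECtx) : (E.plug (.var E.depth)).head = .need 0 :=
  E.head_plug_var 0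

theorem ECtx.substNeeded_plug_var (E : ECtx) : ∀ (i : ℕ) (v : Tm),
    (E.plug (.var (E.depth + i))).substNeeded v = E.plug (v.shift E.depth) := by
  induction E with
  | hole => intro i v; simp [plug, depth, Tm.substNeeded, Tm.shift_zero]
  | app E u ih => intro i v; simp [plug, depth, Tm.substNeeded, ih]
  | sub E u ih =>
    intro i v
    have := E.head_plug_var (i + 1)
    simp only [plug, depth, Tm.substNeeded, show E.depth + 1 + i = E.depth + (i + 1) by omega, this,
      ih, Tm.shift_shift, Nat.add_comm 1]
    simp
  | ssub E u ih =>
    intro i v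
    simp only [plug, depth, Tm.substNeeded, show E.depth + 1 + i = E.depth + (i + 1) by omega,
      ih, Tm.shift_shift, Nat.add_comm 1]
  | dem E E' ih ih' =>
    intro i v
    simp [plug, depth, Tm.substNeeded, E.head_plugVar, ih']

/-- Both `Head.fire` and `Head.pred` fix `.red`, so at each frame `next` takes the branch that
recurses towards the hole. -/
theorem ECtx.plug_red (E : ECtx) (t : Tm) (h : t.head = .red) :
    (E.plug t).head = .red ∧ (E.plug t).next = (t.next.1, E.plug t.next.2) := by
  induction E with
  | hole => exact ⟨h, rfl⟩
  | app E u ih => simp [plug, Tm.head, Tm.next, ih, Head.fire]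
  | sub E u ih => simp [plug, Tm.head, Tm.next, ih, Head.pred]
  | ssub E u ih => simp [plug, Tm.head, Tm.next, ih, Head.pred]
  | dem E E' _ ih' => simp [plug, Tm.head, Tm.next, ih', Head.fire, E.head_plugVar]

theorem Root.next_eq {a : PLabel} {l r : Tm} (h : Root a l r) :
    l.head = .red ∧ l.next = (a, r) := by
  cases h with
  | dB S b u => simp [Tm.head, Tm.next, S.head_plug, Head.fire, S.betaAns_plug]
  | sk E S b =>
    simp [Tm.head, Tm.next, S.head_plug, Head.fire, S.skelAns_plug, ECtx.plugVar, E.head_plugVar]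
  | ss E b =>
    have := E.substNeeded_plug_var 0 ((Tm.lam b).shift 1)
    rw [Nat.add_zero, Tm.shift_shift, Nat.add_comm 1] at this
    simp [Tm.head, Tm.next, ECtx.plugVar, E.head_plugVar, this]

theorem Step.next_eq {a : PLabel} {t u : Tm} (h : Step a t u) :
    t.head = .red ∧ t.next = (a, u) := by
  obtain ⟨E, h⟩ := h
  have h1 := h.next_eq
  have h2 := E.plug_red _ h1.1
  exact ⟨h2.1, by rw [h2.2, h1.2]⟩

theorem Step.deterministic {a a' : PLabel} {t u u' : Tm} (h : Step a t u) (h' : Step a' t u') :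
    a = a' ∧ u = u' := by
  have := h.next_eq.2.symm.trans h'.next_eq.2
  exact Prod.mk.inj this

def ECtx.comp : ECtx → ECtx → ECtx
  | hole, K => K
  | app E u, K => app (E.comp K) u
  | sub E u, K => sub (E.comp K) u
  | ssub E b, K => ssub (E.comp K) b
  | dem E E', K => dem E (E'.comp K)

theorem ECtx.comp_plug (E K : ECtx) (t : Tm) : (E.comp K).plug t = E.plug (K.plug t) := by
  induction E <;> simp_all [comp, plug]

theorem ECtx.comp_depth (E K : ECtx) : (E.comp K).depth = K.depth + E.depth := by
  induction E <;> simp_all [comp, depth] <;> omega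

theorem Step.plug {a : PLabel} {t u : Tm} (h : Step a t u) (E : ECtx) :
    Step a (E.plug t) (E.plug u) := by
  obtain ⟨K, h⟩ := h
  rw [← ECtx.comp_plug, ← ECtx.comp_plug]
  exact .ctx _ h

/-- The converse direction: the context is rebuilt from the computed head, one frame per
constructor. This gives the existence of steps and also turns hypotheses on heads back into
decompositions S⟨v⟩ or E⟨x⟩. -/
theorem Tm.head_cases (t : Tm) :
    (t.head = .ans → ∃ (S : SCtx) (b : Lam), t = S.plug (.lam b)) ∧
    (∀ i, t.head = .need i → ∃ E : ECtx, t = E.plug (.var (E.depth + i))) ∧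
    (t.head = .red → ∃ a u, Step a t u) := by
  induction t with
  | var i =>
    refine ⟨by simp [head], fun j hj => ⟨.hole, ?_⟩, by simp [head]⟩
    simp only [head, Head.need.injEq] at hj
    simp [ECtx.plug, ECtx.depth, hj]
  | lam b => exact ⟨fun _ => ⟨.hole, b, rfl⟩, by simp [head], by simp [head]⟩
  | app t u iht _ =>
    obtain ⟨h1, h2, h3⟩ := iht
    simp only [head]
    cases ht : t.head with
    | ans =>
      obtain ⟨S, b, rfl⟩ := h1 ht
      exact ⟨by simp [Head.fire], by simp [Head.fire], fun _ => ⟨_, _, .ctx .hole (.dB S b u)⟩⟩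
    | need j =>
      obtain ⟨E, hE⟩ := h2 j ht
      refine ⟨by simp [Head.fire], fun i hi => ⟨.app E u, ?_⟩, by simp [Head.fire]⟩
      simp only [Head.fire, Head.need.injEq] at hi
      simp [ECtx.plug, ECtx.depth, hE, hi]
    | red =>
      obtain ⟨a, t', h⟩ := h3 ht
      exact ⟨by simp [Head.fire], by simp [Head.fire],
        fun _ => ⟨a, _, h.plug (.app .hole u)⟩⟩
  | sub t u iht ihu =>
    obtain ⟨h1, h2, h3⟩ := iht
    obtain ⟨g1, g2, g3⟩ := ihu
    simp only [head]
    cases ht : t.head with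
    | ans =>
      obtain ⟨S, b, rfl⟩ := h1 ht
      exact ⟨fun _ => ⟨.sub S u, b, rfl⟩, by simp [Head.pred], by simp [Head.pred]⟩
    | need j =>
      cases j with
      | zero =>
        obtain ⟨E, hE⟩ := h2 0 ht
        rw [Nat.add_zero] at hE
        simp only [if_true]
        cases hu : u.head with
        | ans =>
          obtain ⟨S, b, rfl⟩ := g1 hu
          have h := Step.ctx .hole (Root.sk E S b)
          rw [ECtx.plugVar, ← hE] at h
          exact ⟨by simp [Head.fire], by simp [Head.fire], fun _ => ⟨_, _, h⟩⟩
        | need j =>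
          obtain ⟨E', hE'⟩ := g2 j hu
          refine ⟨by simp [Head.fire], fun i hi => ⟨.dem E E', ?_⟩, by simp [Head.fire]⟩
          simp only [Head.fire, Head.need.injEq] at hi
          simp only [ECtx.plug, ECtx.depth, ← hi, ← hE, ← hE']
        | red =>
          obtain ⟨a, u', h⟩ := g3 hu
          refine ⟨by simp [Head.fire], by simp [Head.fire],
            fun _ => ⟨a, ?_, ?_⟩⟩
          · exact sub t u'
          · rw [hE]; exact h.plug (.dem E .hole)
      | succ j =>
        obtain ⟨E, hE⟩ := h2 (j + 1) ht
        refine ⟨by simp [Head.pred], fun i hi => ⟨.sub E u, ?_⟩, by simp [Head.pred]⟩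
        simp only [Head.pred, Head.need.injEq, Nat.succ_ne_zero, if_false] at hi
        simp only [ECtx.plug, ECtx.depth, ← hi]
        rw [hE]; congr 3; omega
    | red =>
      obtain ⟨a, t', h⟩ := h3 ht
      exact ⟨by simp [Head.pred], by simp [Head.pred],
        fun _ => ⟨a, _, h.plug (.sub .hole u)⟩⟩
  | ssub t v iht =>
    obtain ⟨h1, h2, h3⟩ := iht
    simp only [head]
    cases ht : t.head with
    | ans =>
      obtain ⟨S, b, rfl⟩ := h1 ht
      exact ⟨fun _ => ⟨.ssub S v, b, rfl⟩, by simp [Head.pred], by simp [Head.pred]⟩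
    | need j =>
      cases j with
      | zero =>
        obtain ⟨E, hE⟩ := h2 0 ht
        rw [Nat.add_zero] at hE
        simp only [if_true]
        have h := Step.ctx .hole (Root.ss E v)
        rw [ECtx.plugVar, ← hE] at h
        exact ⟨by simp, by simp, fun _ => ⟨_, _, h⟩⟩
      | succ j =>
        obtain ⟨E, hE⟩ := h2 (j + 1) ht
        refine ⟨by simp [Head.pred], fun i hi => ⟨.ssub E v, ?_⟩, by simp [Head.pred]⟩
        simp only [Head.pred, Head.need.injEq, Nat.succ_ne_zero, if_false] at hi
        simp only [ECtx.plug, ECtx.depth, ← hi]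
        rw [hE]; congr 3; omega
    | red =>
      obtain ⟨a, t', h⟩ := h3 ht
      exact ⟨by simp [Head.pred], by simp [Head.pred],
        fun _ => ⟨a, _, h.plug (.ssub .hole v)⟩⟩

theorem Step.of_head_eq_red {t : Tm} (h : t.head = .red) : Step t.next.1 t t.next.2 := by
  obtain ⟨a, u, hs⟩ := t.head_cases.2.2 h
  rw [hs.next_eq.2]; exact hs

/-! ### Elementary structural equivalence -/

theorem Sb.shift_zero (σ : Sb) : σ.shift 0 = σ := by
  cases σ with
  | es u => exact congrArg Sb.es u.shift_zero
  | skes b =>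
    have := Tm.shift_zero (.lam b)
    simp only [Tm.shift, Tm.ren, Tm.lam.injEq] at this
    exact congrArg Sb.skes this

theorem Sb.shift_shift (σ : Sb) (m n : ℕ) : (σ.shift m).shift n = σ.shift (m + n) := by
  unfold shift; rw [ren_ren]; congr 1; funext i; omega

/-- Structural equivalence, generated by the moves of a substitution through a single frame; moves
through another substitution are only allowed if `c` holds. -/
inductive ElemEq (c : Prop) : Tm → Tm → Prop
  | app (t : Tm) (σ : Sb) (w : Tm) :
      ElemEq c (.app (t.wrap σ) w) ((Tm.app t (w.shift 1)).wrap σ)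
  | dem (s t : Tm) (σ : Sb) : s.head = .need 0 →
      ElemEq c (.sub s (t.wrap σ)) ((Tm.sub (s.ren (up Nat.succ)) t).wrap σ)
  | comm (t : Tm) (σ τ : Sb) : c →
      ElemEq c ((t.wrap (σ.shift 1)).wrap τ) (((t.ren (rot 1)).wrap (τ.shift 1)).wrap σ)
  | refl (t : Tm) : ElemEq c t t
  | symm {t u : Tm} : ElemEq c t u → ElemEq c u t
  | trans {t u s : Tm} : ElemEq c t u → ElemEq c u s → ElemEq c t s
  | appL {t u : Tm} (w : Tm) : ElemEq c t u → ElemEq c (.app t w) (.app u w)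
  | wrapL {t u : Tm} (σ : Sb) : ElemEq c t u → ElemEq c (t.wrap σ) (u.wrap σ)
  | subR {t u : Tm} (s : Tm) : s.head = .need 0 → ElemEq c t u → ElemEq c (.sub s t) (.sub s u)

namespace ElemEq

variable {c : Prop}

theorem of_eq {t u : Tm} (h : t = u) : ElemEq c t u := h ▸ .refl t

theorem plug {t u : Tm} (h : ElemEq c t u) (E : ECtx) : ElemEq c (E.plug t) (E.plug u) := by
  induction E with
  | hole => exact h
  | app E w ih => exact .appL w ih
  | sub E w ih => exact .wrapL (.es w) ih
  | ssub E b ih => exact .wrapL (.skes b) ih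
  | dem E E' _ ih' => exact .subR _ E.head_plugVar ih'

/-- The substitution is pulled out one frame at a time. Application and demand frames capture
nothing; a substitution frame requires an exchange, hence `c`, and it is excluded when the depth is
zero. -/
theorem move_aux (E : ECtx) : ∀ (t : Tm) (σ : Sb), c ∨ E.depth = 0 →
    ElemEq c (E.plug (t.wrap (σ.shift E.depth)))
      (((E.ren Nat.succ).plug (t.ren (rot E.depth))).wrap σ) := by
  -- The common case of the two substitution frames: the induction hypothesis brings `σ` just below
  -- `τ`, `comm` exchanges them, and the two renamings obtained are compared pointwise.
  have hwrap : ∀ (E : ECtx) (τ : Sb),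
      (∀ (t : Tm) (σ : Sb), c → ElemEq c (E.plug (t.wrap (σ.shift E.depth)))
        (((E.ren Nat.succ).plug (t.ren (rot E.depth))).wrap σ)) →
      ∀ (t : Tm) (σ : Sb), c → ElemEq c ((E.plug (t.wrap (σ.shift (E.depth + 1)))).wrap τ)
        ((((E.ren (up Nat.succ)).plug (t.ren (rot (E.depth + 1)))).wrap (τ.ren Nat.succ)).wrap σ) := by
    intro E τ ih t σ h
    have h1 := (ih t (σ.shift 1) h).wrapL τ
    rw [Sb.shift_shift, Nat.add_comm 1] at h1
    refine h1.trans ((comm _ σ τ h).trans (of_eq ?_))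
    rw [ECtx.plug_ren, ECtx.ren_ren, Tm.ren_ren, ECtx.depth_ren]
    congr 3
    · congr 1; funext i; simp only [rot_apply, up_apply, Nat.succ_eq_add_one]; grind
    · congr 1; funext i; simp only [rot_apply, upn]; grind
  induction E with
  | hole =>
    intro t σ _
    simp only [ECtx.plug, ECtx.depth, ECtx.ren, Sb.shift_zero]
    rw [Tm.ren_id t (rot 0) (by intro i; simp only [rot_apply]; grind)]
    exact .refl _
  | app E u ih => intro t σ h; exact (appL u (ih t σ h)).trans (.app _ _ _)
  | sub E u ih =>
    intro t σ h
    have hc : c := h.resolve_right (by simp [ECtx.depth])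
    exact hwrap E (.es u) (fun t σ h => ih t σ (.inl h)) t σ hc
  | ssub E b ih =>
    intro t σ h
    have hc : c := h.resolve_right (by simp [ECtx.depth])
    exact hwrap E (.skes b) (fun t σ h => ih t σ (.inl h)) t σ hc
  | dem E E' _ ih' =>
    intro t σ h
    refine (subR _ E.head_plugVar (ih' t σ h)).trans ((dem _ _ _ E.head_plugVar).trans (of_eq ?_))
    simp only [ECtx.plug, ECtx.depth, ECtx.ren, ECtx.plug_ren, Tm.ren, ECtx.depth_ren, upn_up]
    simp [upn]

/-- A substitution moves out of a context; if the context captures variables, this needs `c`. -/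
theorem move (E : ECtx) (t : Tm) (σ : Sb) (h : c ∨ E.depth = 0) :
    ElemEq c (E.plug (t.wrap (σ.shift E.depth)))
      (((E.ren Nat.succ).plug (t.ren (rot E.depth))).wrap σ) := move_aux E t σ h

theorem ren {t u : Tm} (h : ElemEq c t u) : ∀ ξ : ℕ → ℕ, ElemEq c (t.ren ξ) (u.ren ξ) := by
  induction h with
  | app t σ w =>
    intro ξ
    simp only [Tm.ren, Tm.wrap_ren, Tm.shift_one_ren]
    exact .app _ _ _
  | dem s t σ h =>
    intro ξ
    simp only [Tm.ren, Tm.wrap_ren]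
    have : (s.ren (up Nat.succ)).ren (up (up ξ)) = (s.ren (up ξ)).ren (up Nat.succ) := by
      rw [Tm.ren_ren, Tm.ren_ren, up_up, up_up]; rfl
    rw [this]
    exact .dem _ _ _ (by rw [Tm.head_ren, Tm.head_ren_up_eq, h])
  | comm t σ τ h =>
    intro ξ
    simp only [Tm.wrap_ren, Sb.shift_one_ren]
    -- `rot 1` transposes the indices 0 and 1 and fixes the rest, while `up (up ξ)` fixes 0 and 1
    -- and sends all other indices above them.
    have : (t.ren (rot 1)).ren (up (up ξ)) = (t.ren (up (up ξ))).ren (rot 1) := by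
      rw [Tm.ren_ren, Tm.ren_ren]; congr 1; funext i
      rcases i with _ | _ | i <;> simp [up, rot]
    rw [this]
    exact .comm _ _ _ h
  | refl t => intro ξ; exact .refl _
  | symm _ ih => intro ξ; exact (ih ξ).symm
  | trans _ _ ih ih' => intro ξ; exact (ih ξ).trans (ih' ξ)
  | appL w _ ih => intro ξ; exact .appL _ (ih ξ)
  | wrapL σ _ ih => intro ξ; rw [Tm.wrap_ren, Tm.wrap_ren]; exact .wrapL _ (ih _)
  | subR s h _ ih =>
    intro ξ; exact .subR _ (by rw [Tm.head_ren, Tm.head_ren_up_eq, h]) (ih ξ)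

theorem subList {t u : Tm} (h : ElemEq c t u) (l : List Lam) :
    ElemEq c (Tm.subList l t) (Tm.subList l u) := by
  induction l generalizing t u with
  | nil => exact h
  | cons a l ih => exact ih (.wrapL (.es _) h)

theorem skelAns {s s' : Tm} (h : ElemEq c s s') (t : Tm) (ht : t.head = .ans) :
    ElemEq c (t.skelAns s) (t.skelAns s') := by
  obtain ⟨S, b, rfl⟩ := t.head_cases.1 ht
  clear ht
  induction S generalizing s s' with
  | hole => exact (wrapL (.skes _) (h.ren _)).subList _
  | sub S w ih => exact .wrapL (.es _) (ih (h.ren _))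
  | ssub S b ih => exact .wrapL (.skes _) (ih (h.ren _))

end ElemEq

/-! ### Moving a flesh and a skeletonized answer out of a context. -/

/-- Exchange of `k` variables with the `d` variables bound just outside of them. -/
def rotn (k d i : ℕ) : ℕ :=
  if i < k then i + d else if i < k + d then i - k else i

namespace ElemEq

variable {c : Prop}

/-- The head of the list is the innermost substitution. The induction hypothesis first extrudes all
the others; the context is then renamed below them and `move` extrudes the innermost one. -/
theorem plug_subList (E : ECtx) (h : c ∨ E.depth = 0) (l : List Lam) (t : Tm) :
    ElemEq c (E.plug (Tm.subList (l.map (Lam.ren (fun i => i + E.depth))) t))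
      (Tm.subList l ((E.ren (fun i => i + l.length)).plug (t.ren (rotn l.length E.depth)))) := by
  induction l generalizing t with
  | nil =>
    simp only [List.map_nil, Tm.subList, List.length_nil]
    rw [ECtx.ren_id, Tm.ren_id]
    · exact .refl _
    · intro i; simp only [rotn]; grind
  | cons a l ih =>
    refine (ih _).trans ?_
    have h1 := move (E.ren (fun i => i + l.length)) (t.ren (up (rotn l.length E.depth)))
      (.es (a.toTm.shift l.length)) (by rw [ECtx.depth_ren]; exact h)
    have h2 := h1.subList l
    refine (of_eq ?_).trans (h2.trans (of_eq ?_))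
    · simp only [Tm.ren, Tm.wrap, Sb.shift, Sb.ren, List.length_map, Lam.toTm_ren, Tm.shift,
        Tm.ren_ren, ECtx.depth_ren]
      congr 4; funext i; simp only [rotn]; grind
    · simp only [Tm.subList, Tm.wrap, ECtx.ren_ren, Tm.ren_ren, List.length_cons, ECtx.depth_ren]
      congr 4
      funext i; simp only [rotn, rot_apply, up_apply]; grind

/-- Skeletonizing inside `E` agrees with moving the substitution out and skeletonizing there. For an
answer S⟨v⟩, the substitutions of S are extruded one by one, then the flesh of v, then its skeletal
substitution. -/
theorem plug_skelAns (E : ECtx) (h : c ∨ E.depth = 0) (t u : Tm) (hu : u.head = .ans) :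
    ElemEq c (E.plug ((u.shift E.depth).skelAns t))
      (u.skelAns ((E.ren Nat.succ).plug (t.ren (rot E.depth)))) := by
  obtain ⟨S, b, rfl⟩ := u.head_cases.1 hu
  clear hu
  -- The common inductive step: `σ`, the outermost substitution of the answer, leaves `E`, and the
  -- rest is treated in the context weakened by its variable.
  have hS : ∀ (S : SCtx) (σ : Sb),
      (∀ E : ECtx, c ∨ E.depth = 0 → ∀ t : Tm,
        ElemEq c (E.plug (((S.plug (.lam b)).shift E.depth).skelAns t))
          ((S.plug (.lam b)).skelAns ((E.ren Nat.succ).plug (t.ren (rot E.depth))))) →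
      ∀ E : ECtx, c ∨ E.depth = 0 → ∀ t : Tm,
        ElemEq c (E.plug (Tm.wrap (((S.plug (.lam b)).ren (up (fun i => i + E.depth))).skelAns
            (t.ren (up Nat.succ))) (σ.shift E.depth)))
          (((S.plug (.lam b)).skelAns
            (((E.ren Nat.succ).plug (t.ren (rot E.depth))).ren (up Nat.succ))).wrap σ) := by
    intro S σ ih E h t
    refine (move E _ σ h).trans (wrapL σ ?_)
    have h1 := ih (E.ren Nat.succ) (by rw [ECtx.depth_ren]; exact h) ((t.ren (up Nat.succ)).ren (up (rot E.depth)))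
    refine (of_eq ?_).trans (h1.trans (of_eq ?_))
    · rw [Tm.skelAns_ren, ECtx.depth_ren]
      congr 2
      rw [Tm.shift, Tm.ren_ren]; congr 1; funext i
      simp only [rot_apply, up_apply]; grind
    · rw [ECtx.plug_ren, ECtx.depth_ren, ECtx.ren_ren, ECtx.ren_ren, Tm.ren_ren,
        Tm.ren_ren, Tm.ren_ren]
      congr 2; congr 1; funext i
      simp only [rot_apply, up_apply, upn, Nat.succ_eq_add_one]; grind
  induction S generalizing E t with
  | hole =>
    simp only [SCtx.plug, Tm.shift, Tm.ren, Tm.skelAns, Lam.fleshList_ren, List.length_map,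
      Lam.skeleton_ren]
    refine (plug_subList E h _ _).trans (subList ?_ _)
    have h1 := move (E.ren (fun i => i + b.fleshList.length))
      ((t.ren (up (fun i => i + b.fleshList.length))).ren (up (rotn b.fleshList.length E.depth)))
      (.skes b.skeleton) (by rw [ECtx.depth_ren]; exact h)
    refine (of_eq ?_).trans (h1.trans (of_eq ?_))
    · simp only [Tm.ren, Tm.wrap, Sb.shift, Sb.ren, Lam.ren_ren, ECtx.depth_ren]
      congr 3; funext i
      simp only [rotn, up_apply, upn]; grind
    · simp only [Tm.wrap, ECtx.plug_ren, ECtx.ren_ren, Tm.ren_ren, ECtx.depth_ren]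
      congr 2; congr 1; funext i
      simp only [rotn, rot_apply, up_apply, upn]; grind
  | sub S w ih => exact hS S (.es w) ih E h t
  | ssub S w ih => exact hS S (.skes w) ih E h t

end ElemEq

/-! ### Structural equivalence is a strong bisimulation -/

namespace Tm

theorem head_wrap {t : Tm} (h : t.head ≠ .need 0) (σ : Sb) : (t.wrap σ).head = t.head.pred := by
  cases σ <;> simp [wrap, head, h]

theorem next_wrap {t : Tm} (h : t.head ≠ .need 0) (σ : Sb) :
    (t.wrap σ).next = (t.next.1, t.next.2.wrap σ) := by
  cases σ <;> simp [wrap, next, h]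

theorem substNeeded_wrap {t : Tm} (h : t.head ≠ .need 0) (σ : Sb) (v : Tm) :
    (t.wrap σ).substNeeded v = (t.substNeeded (v.shift 1)).wrap σ := by
  cases σ <;> simp [wrap, substNeeded, h]

theorem betaAns_wrap (t : Tm) (σ : Sb) (u : Tm) :
    (t.wrap σ).betaAns u = (t.betaAns (u.shift 1)).wrap σ := by
  cases σ <;> rfl

theorem skelAns_wrap (t : Tm) (σ : Sb) (s : Tm) :
    (t.wrap σ).skelAns s = (t.skelAns (s.ren (up Nat.succ))).wrap σ := by
  cases σ <;> rfl

end Tm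

theorem Head.pred_eq_ans {h : Head} : h.pred = .ans ↔ h = .ans := by
  rcases h with _ | i | _
  · simp [pred]
  · cases i <;> simp [pred]
  · simp [pred]

theorem Head.pred_eq_red {h : Head} : h.pred = .red ↔ h = .red := by
  rcases h with _ | i | _
  · simp [pred]
  · cases i <;> simp [pred]
  · simp [pred]

theorem Head.pred_eq_need {h : Head} {i : ℕ} (h0 : h ≠ .need 0) :
    h.pred = .need i ↔ h = .need (i + 1) := by
  rcases h with _ | j | _
  · simp [pred]
  · cases j with
    | zero => exact absurd rfl h0
    | succ j => simp [pred]
  · simp [pred]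

namespace Tm

theorem head_app_of {t : Tm} {h : Head} (ht : t.head = h) (w : Tm) :
    (app t w).head = h.fire := by
  rw [head, ht]

theorem next_app_ans {t : Tm} (ht : t.head = .ans) (w : Tm) :
    (app t w).next = (.dB, t.betaAns w) := by
  simp [next, ht]

theorem next_app {t : Tm} (ht : t.head ≠ .ans) (w : Tm) :
    (app t w).next = (t.next.1, app t.next.2 w) := by
  simp [next, ht]

theorem substNeeded_app (t w v : Tm) : (app t w).substNeeded v = app (t.substNeeded v) w := rfl

theorem head_sub_of {t u : Tm} {h : Head} (ht : t.head = .need 0) (hu : u.head = h) :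
    (sub t u).head = h.fire := by
  simp [head, ht, hu]

theorem next_sub_ans {t u : Tm} (ht : t.head = .need 0) (hu : u.head = .ans) :
    (sub t u).next = (.sk, u.skelAns t) := by
  simp [next, ht, hu]

theorem next_sub {t u : Tm} (ht : t.head = .need 0) (hu : u.head ≠ .ans) :
    (sub t u).next = (u.next.1, sub t u.next.2) := by
  simp [next, ht, hu]

theorem substNeeded_sub {t : Tm} (ht : t.head = .need 0) (u v : Tm) :
    (sub t u).substNeeded v = sub t (u.substNeeded v) := by
  simp [substNeeded, ht]

theorem head_ssub {t : Tm} (ht : t.head = .need 0) (b : Lam) : (ssub t b).head = .red := by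
  simp [head, ht]

theorem next_ssub {t : Tm} (ht : t.head = .need 0) (b : Lam) :
    (ssub t b).next = (.ss, ssub (t.substNeeded ((lam b).shift 1)) b) := by
  simp [next, ht]

theorem ren_rot_zero (t : Tm) : t.ren (rot 0) = t :=
  ren_id _ _ fun i => by simp only [rot_apply]; grind

theorem shift_two_ren_rot (t : Tm) : (t.shift 2).ren (rot 1) = t.shift 2 := by
  rw [shift, ren_ren]; rfl

end Tm

/-- Both terms have the same head and behave in the same way, up to structural equivalence. -/
structure Match (c : Prop) (t u : Tm) : Prop where
  head_eq : t.head = u.head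
  beta : t.head = .ans → ∀ w, ElemEq c (t.betaAns w) (u.betaAns w)
  skel : t.head = .ans → ∀ s, ElemEq c (t.skelAns s) (u.skelAns s)
  subst : ∀ i, t.head = .need i → ∀ v, ElemEq c (t.substNeeded v) (u.substNeeded v)
  label : t.head = .red → t.next.1 = u.next.1
  step : t.head = .red → ElemEq c t.next.2 u.next.2

namespace Match

variable {c : Prop}

theorem refl (t : Tm) : Match c t t :=
  ⟨rfl, fun _ _ => .refl _, fun _ _ => .refl _, fun _ _ _ => .refl _, fun _ => rfl, fun _ => .refl _⟩

theorem symm {t u : Tm} (m : Match c t u) : Match c u t where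
  head_eq := m.head_eq.symm
  beta h w := (m.beta (m.head_eq.trans h) w).symm
  skel h w := (m.skel (m.head_eq.trans h) w).symm
  subst i h w := (m.subst i (m.head_eq.trans h) w).symm
  label h := (m.label (m.head_eq.trans h)).symm
  step h := (m.step (m.head_eq.trans h)).symm

theorem trans {t u s : Tm} (m : Match c t u) (n : Match c u s) : Match c t s where
  head_eq := m.head_eq.trans n.head_eq
  beta h w := (m.beta h w).trans (n.beta (m.head_eq.symm.trans h) w)
  skel h w := (m.skel h w).trans (n.skel (m.head_eq.symm.trans h) w)
  subst i h w := (m.subst i h w).trans (n.subst i (m.head_eq.symm.trans h) w)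
  label h := (m.label h).trans (n.label (m.head_eq.symm.trans h))
  step h := (m.step h).trans (n.step (m.head_eq.symm.trans h))

/-- A fixed head leaves a single relevant field of `Match`; the other fields hold vacuously. -/
theorem of_need {t u : Tm} {i : ℕ} (ht : t.head = .need i) (hu : u.head = .need i)
    (h : ∀ v, ElemEq c (t.substNeeded v) (u.substNeeded v)) : Match c t u where
  head_eq := ht.trans hu.symm
  beta h := by simp [ht] at h
  skel h := by simp [ht] at h
  subst _ _ := h
  label h := by simp [ht] at h
  step h := by simp [ht] at h

theorem of_red {t u t' u' : Tm} {a : PLabel} (ht : t.head = .red) (hu : u.head = .red)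
    (ht' : t.next = (a, t')) (hu' : u.next = (a, u')) (h : ElemEq c t' u') : Match c t u where
  head_eq := ht.trans hu.symm
  beta h := by simp [ht] at h
  skel h := by simp [ht] at h
  subst i h := by simp [ht] at h
  label _ := by rw [ht', hu']
  step _ := by rw [ht', hu']; exact h

theorem appL {t u : Tm} (m : Match c t u) (w : Tm) :
    Match c (.app t w) (.app u w) := by
  have e := m.head_eq
  cases ht : t.head with
  | ans =>
    have hu := e.symm.trans ht
    exact of_red (Tm.head_app_of ht w) (Tm.head_app_of hu w) (Tm.next_app_ans ht w)
      (Tm.next_app_ans hu w) (m.beta ht w)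
  | need i =>
    have hu := e.symm.trans ht
    exact of_need (Tm.head_app_of ht w) (Tm.head_app_of hu w) fun v => .appL w (m.subst i ht v)
  | red =>
    have hu := e.symm.trans ht
    refine of_red (Tm.head_app_of ht w) (Tm.head_app_of hu w) (Tm.next_app (by simp [ht]) w) ?_
      (.appL w (m.step ht))
    rw [m.label ht]; exact Tm.next_app (by simp [hu]) w

/-- The match alone is not enough: if the bound variable is needed and the content is an answer, for
instance, the contractum contains the body itself, so the bodies must be known to be equivalent. -/
theorem wrapL {t u : Tm} (m : Match c t u) (σ : Sb) (h : ElemEq c t u) :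
    Match c (t.wrap σ) (u.wrap σ) := by
  have e := m.head_eq
  by_cases ht : t.head = .need 0
  · have hu := e.symm.trans ht
    cases σ with
    | es w =>
      cases hw : w.head with
      | ans =>
        exact of_red (Tm.head_sub_of ht hw) (Tm.head_sub_of hu hw) (Tm.next_sub_ans ht hw)
          (Tm.next_sub_ans hu hw) (h.skelAns w hw)
      | need i =>
        refine of_need (Tm.head_sub_of ht hw) (Tm.head_sub_of hu hw) fun v => ?_
        simp only [Tm.wrap, Tm.substNeeded_sub ht, Tm.substNeeded_sub hu]
        exact .wrapL (.es _) h
      | red =>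
        have hw' : w.head ≠ .ans := by simp [hw]
        exact of_red (Tm.head_sub_of ht hw) (Tm.head_sub_of hu hw) (Tm.next_sub ht hw')
          (Tm.next_sub hu hw') (.wrapL (.es _) h)
    | skes b =>
      exact of_red (Tm.head_ssub ht b) (Tm.head_ssub hu b) (Tm.next_ssub ht b) (Tm.next_ssub hu b)
        (.wrapL (.skes b) (m.subst 0 ht _))
  · have hu : u.head ≠ .need 0 := e ▸ ht
    constructor
    · rw [Tm.head_wrap ht, Tm.head_wrap hu, e]
    · intro hh w
      rw [Tm.head_wrap ht, Head.pred_eq_ans] at hh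
      rw [Tm.betaAns_wrap, Tm.betaAns_wrap]; exact .wrapL σ (m.beta hh _)
    · intro hh w
      rw [Tm.head_wrap ht, Head.pred_eq_ans] at hh
      rw [Tm.skelAns_wrap, Tm.skelAns_wrap]; exact .wrapL σ (m.skel hh _)
    · intro i hh w
      rw [Tm.head_wrap ht, Head.pred_eq_need ht] at hh
      rw [Tm.substNeeded_wrap ht, Tm.substNeeded_wrap hu]; exact .wrapL σ (m.subst _ hh _)
    · intro hh
      rw [Tm.head_wrap ht, Head.pred_eq_red] at hh
      rw [Tm.next_wrap ht, Tm.next_wrap hu]; exact m.label hh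
    · intro hh
      rw [Tm.head_wrap ht, Head.pred_eq_red] at hh
      rw [Tm.next_wrap ht, Tm.next_wrap hu]; exact .wrapL σ (m.step hh)

/-- When the content is an answer the redex is a skeletonization, which is why `Match` asks for
related skeletonizations over every body. -/
theorem subR {t u : Tm} (m : Match c t u) (s : Tm) (hs : s.head = .need 0) :
    Match c (.sub s t) (.sub s u) := by
  have e := m.head_eq
  cases ht : t.head with
  | ans =>
    have hu := e.symm.trans ht
    exact of_red (Tm.head_sub_of hs ht) (Tm.head_sub_of hs hu) (Tm.next_sub_ans hs ht)
      (Tm.next_sub_ans hs hu) (m.skel ht s)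
  | need i =>
    have hu := e.symm.trans ht
    refine of_need (Tm.head_sub_of hs ht) (Tm.head_sub_of hs hu) fun v => ?_
    rw [Tm.substNeeded_sub hs, Tm.substNeeded_sub hs]
    exact .subR s hs (m.subst i ht v)
  | red =>
    have hu := e.symm.trans ht
    refine of_red (Tm.head_sub_of hs ht) (Tm.head_sub_of hs hu) (Tm.next_sub hs (by simp [ht])) ?_
      (.subR s hs (m.step ht))
    rw [m.label ht]; exact Tm.next_sub hs (by simp [hu])

/-- If `t` needs the variable of `σ`, then `σ` decides the step on both sides. Otherwise the step
concerns `t` or the application, and since `betaAns` looks through substitutions, the two dB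
contracta even coincide. -/
theorem app (t : Tm) (σ : Sb) (w : Tm) :
    Match c (.app (t.wrap σ) w) ((Tm.app t (w.shift 1)).wrap σ) := by
  by_cases ht : t.head = .need 0
  · have ht2 : (Tm.app t (w.shift 1)).head = .need 0 := Tm.head_app_of ht _
    cases σ with
    | es u =>
      have h1 : (t.wrap (.es u)).head = u.head.fire := Tm.head_sub_of ht rfl
      have h1' : (t.wrap (.es u)).head ≠ .ans := by rw [h1]; cases u.head <;> simp [Head.fire]
      cases hu : u.head with
      | ans =>
        rw [hu] at h1
        refine of_red (u' := (u.skelAns (Tm.app t (w.shift 1))))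
          (Tm.head_app_of h1 w) (Tm.head_sub_of ht2 hu) (Tm.next_app h1' w) ?_ ?_
        · simp only [Tm.wrap]
          rw [Tm.next_sub_ans ht2 hu, Tm.next_sub_ans ht hu]
        · simp only [Tm.wrap]
          rw [Tm.next_sub_ans ht hu]
          -- The frame ⟨·⟩w has depth zero, so the extrusion needs no exchange and holds for every
          -- `c`.
          have := ElemEq.plug_skelAns (c := c) (.app .hole w) (.inr rfl) t u hu
          simp only [ECtx.plug, ECtx.ren, ECtx.depth, Tm.shift_zero, Tm.ren_rot_zero] at this
          exact this
      | need i =>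
        rw [hu] at h1
        refine of_need (Tm.head_app_of h1 w) (Tm.head_sub_of ht2 hu) fun v => ?_
        simp only [Tm.wrap, Tm.substNeeded_app, Tm.substNeeded_sub ht, Tm.substNeeded_sub ht2]
        exact .app t (.es _) w
      | red =>
        rw [hu] at h1
        have hu' : u.head ≠ .ans := by simp [hu]
        refine of_red (u' := (.sub (Tm.app t (w.shift 1)) u.next.2))
          (Tm.head_app_of h1 w) (Tm.head_sub_of ht2 hu) (Tm.next_app h1' w) ?_ ?_
        · simp only [Tm.wrap]
          rw [Tm.next_sub ht2 hu', Tm.next_sub ht hu']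
        · simp only [Tm.wrap]
          rw [Tm.next_sub ht hu']
          exact .app t (.es _) w
    | skes b =>
      have h1 : (t.wrap (.skes b)).head = .red := Tm.head_ssub ht b
      refine of_red (u' := (.ssub ((Tm.app t (w.shift 1)).substNeeded ((Tm.lam b).shift 1)) b))
        (Tm.head_app_of h1 w) (Tm.head_ssub ht2 b) (Tm.next_app (by simp [h1]) w) ?_ ?_
      · simp only [Tm.wrap]
        rw [Tm.next_ssub ht2, Tm.next_ssub ht]
      · simp only [Tm.wrap]
        rw [Tm.next_ssub ht]
        exact .app _ (.skes b) w
  · have ht2 : (Tm.app t (w.shift 1)).head ≠ .need 0 := by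
      rw [Tm.head]; cases h : t.head <;> simp_all [Head.fire]
    have h1 := Tm.head_wrap ht σ
    have h2 := Tm.head_wrap ht2 σ
    have n1 := Tm.next_wrap ht σ
    have n2 := Tm.next_wrap ht2 σ
    cases hh : t.head with
    | ans =>
      have h3 : (t.wrap σ).head = .ans := by rw [h1, hh]; rfl
      rw [Tm.next_app_ans hh] at n2
      refine of_red (Tm.head_app_of h3 w) (by rw [h2, Tm.head, hh]; rfl) (Tm.next_app_ans h3 w) n2 ?_
      rw [Tm.betaAns_wrap]; exact .refl _
    | need i =>
      obtain ⟨i, rfl⟩ := Nat.exists_eq_succ_of_ne_zero (fun h : i = 0 => ht (h ▸ hh))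
      refine of_need (i := i) (by rw [Tm.head, h1, hh]; rfl) (by rw [h2, Tm.head, hh]; rfl)
        fun v => ?_
      rw [Tm.substNeeded_wrap ht2, Tm.substNeeded, Tm.substNeeded, Tm.substNeeded_wrap ht]
      exact .app _ σ w
    | red =>
      have h3 : (t.wrap σ).head = .red := by rw [h1, hh]; rfl
      rw [Tm.next_app (by simp [hh])] at n2
      have n3 := Tm.next_app (t := t.wrap σ) (by simp [h3]) w
      rw [n1] at n3
      exact of_red (Tm.head_app_of h3 w) (by rw [h2, Tm.head, hh]; rfl) n3 n2 (.app _ σ w)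

theorem dem (s t : Tm) (σ : Sb) (hs : s.head = .need 0) :
    Match c (.sub s (t.wrap σ)) ((Tm.sub (s.ren (up Nat.succ)) t).wrap σ) := by
  have hs' : (s.ren (up Nat.succ)).head = .need 0 := by rw [Tm.head_ren, hs]; rfl
  have hd : (Tm.sub (s.ren (up Nat.succ)) t).head = t.head.fire := Tm.head_sub_of hs' rfl
  by_cases ht : t.head = .need 0
  · have ht2 : (Tm.sub (s.ren (up Nat.succ)) t).head = .need 0 := by rw [hd, ht]; rfl
    cases σ with
    | es u =>
      have h1 : (t.wrap (.es u)).head = u.head.fire := Tm.head_sub_of ht rfl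
      have h1' : (t.wrap (.es u)).head ≠ .ans := by rw [h1]; cases u.head <;> simp [Head.fire]
      cases hu : u.head with
      | ans =>
        rw [hu] at h1
        refine of_red (u' := (u.skelAns (Tm.sub (s.ren (up Nat.succ)) t)))
          (Tm.head_sub_of hs h1) (Tm.head_sub_of ht2 hu) (Tm.next_sub hs h1') ?_ ?_
        · simp only [Tm.wrap]
          rw [Tm.next_sub_ans ht2 hu, Tm.next_sub_ans ht hu]
        · simp only [Tm.wrap]
          rw [Tm.next_sub_ans ht hu]
          -- Recovering `E` from the head of `s` presents the demand frame as an evaluation context,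
          -- again of depth zero.
          obtain ⟨E, rfl⟩ := s.head_cases.2.1 0 hs
          have := ElemEq.plug_skelAns (c := c) (.dem E .hole) (.inr rfl) t u hu
          simp only [ECtx.plug, ECtx.ren, ECtx.depth, Tm.shift_zero, Tm.ren_rot_zero] at this
          rw [Nat.add_zero, ECtx.plug_ren]
          simpa [Tm.ren, upn, ECtx.depth_ren, up] using this
      | need i =>
        rw [hu] at h1
        refine of_need (Tm.head_sub_of hs h1) (Tm.head_sub_of ht2 hu) fun v => ?_
        simp only [Tm.wrap, Tm.substNeeded_sub ht, Tm.substNeeded_sub ht2, Tm.substNeeded_sub hs]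
        exact .dem s t (.es _) hs
      | red =>
        rw [hu] at h1
        have hu' : u.head ≠ .ans := by simp [hu]
        refine of_red (u' := (.sub (Tm.sub (s.ren (up Nat.succ)) t) u.next.2))
          (Tm.head_sub_of hs h1) (Tm.head_sub_of ht2 hu) (Tm.next_sub hs h1') ?_ ?_
        · simp only [Tm.wrap]
          rw [Tm.next_sub ht2 hu', Tm.next_sub ht hu']
        · simp only [Tm.wrap]
          rw [Tm.next_sub ht hu']
          exact .dem s t (.es _) hs
    | skes b =>
      have h1 : (t.wrap (.skes b)).head = .red := Tm.head_ssub ht b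
      refine of_red (u' := (.ssub ((Tm.sub (s.ren (up Nat.succ)) t).substNeeded ((Tm.lam b).shift 1)) b))
        (Tm.head_sub_of hs h1) (Tm.head_ssub ht2 b) (Tm.next_sub hs (by simp [h1])) ?_ ?_
      · simp only [Tm.wrap]
        rw [Tm.next_ssub ht2, Tm.next_ssub ht]
      · simp only [Tm.wrap]
        rw [Tm.next_ssub ht, Tm.substNeeded_sub hs']
        exact .dem s _ (.skes b) hs
  · have ht2 : (Tm.sub (s.ren (up Nat.succ)) t).head ≠ .need 0 := by
      rw [hd]; cases h : t.head <;> simp_all [Head.fire]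
    have h1 := Tm.head_wrap ht σ
    have h2 := Tm.head_wrap ht2 σ
    have n1 := Tm.next_wrap ht σ
    have n2 := Tm.next_wrap ht2 σ
    cases hh : t.head with
    | ans =>
      have h3 : (t.wrap σ).head = .ans := by rw [h1, hh]; rfl
      rw [Tm.next_sub_ans hs' hh] at n2
      refine of_red (Tm.head_sub_of hs h3) (by rw [h2, hd, hh]; rfl) (Tm.next_sub_ans hs h3) n2 ?_
      rw [Tm.skelAns_wrap]; exact .refl _
    | need i =>
      obtain ⟨i, rfl⟩ := Nat.exists_eq_succ_of_ne_zero (fun h : i = 0 => ht (h ▸ hh))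
      have h3 : (t.wrap σ).head = .need i := by rw [h1, hh]; rfl
      refine of_need (Tm.head_sub_of hs h3) (by rw [h2, hd, hh]; rfl) fun v => ?_
      rw [Tm.substNeeded_wrap ht2, Tm.substNeeded_sub hs, Tm.substNeeded_sub hs',
        Tm.substNeeded_wrap ht]
      exact .dem s _ σ hs
    | red =>
      have h3 : (t.wrap σ).head = .red := by rw [h1, hh]; rfl
      rw [Tm.next_sub hs' (by simp [hh])] at n2
      have n3 := Tm.next_sub (u := t.wrap σ) hs (by simp [h3])
      rw [n1] at n3
      exact of_red (Tm.head_sub_of hs h3) (by rw [h2, hd, hh]; rfl) n3 n2 (.dem s _ σ hs)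

/-- Here `σ` is the active substitution and `τ` is inert, on both sides. When the content of `σ` is
an answer, its skeletonization is extruded from the context made of `τ` alone, whose depth is one;
this uses `hc`. -/
theorem comm_of_need_zero (t : Tm) (σ τ : Sb) (hc : c) (ht : t.head = .need 0) :
    Match c ((t.wrap (σ.shift 1)).wrap τ) (((t.ren (rot 1)).wrap (τ.shift 1)).wrap σ) := by
  have ht1 : (t.ren (rot 1)).head = .need 1 := by rw [Tm.head_ren, ht]; rfl
  have ht1' : (t.ren (rot 1)).head ≠ .need 0 := by rw [ht1]; simp
  have ht2 : ((t.ren (rot 1)).wrap (τ.shift 1)).head = .need 0 := by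
    rw [Tm.head_wrap ht1', ht1]; rfl
  cases σ with
  | es u =>
    have hw : (Tm.sub t (u.shift 1)).head = (u.head.ren Nat.succ).fire :=
      Tm.head_sub_of ht (Tm.head_ren u _)
    have hw0 : (Tm.sub t (u.shift 1)).head ≠ .need 0 := by
      rw [hw]; cases u.head <;> simp [Head.ren, Head.fire]
    have h1 := Tm.head_wrap hw0 τ
    have n1 := Tm.next_wrap hw0 τ
    rw [hw] at h1
    change Match c ((Tm.sub t (u.shift 1)).wrap τ)
      (.sub ((t.ren (rot 1)).wrap (τ.shift 1)) u)
    cases hu : u.head with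
    | ans =>
      rw [Tm.next_sub_ans ht (by rw [Tm.shift, Tm.head_ren, hu]; rfl)] at n1
      refine of_red (by rw [h1, hu]; rfl) (Tm.head_sub_of ht2 hu) n1 (Tm.next_sub_ans ht2 hu) ?_
      have := ElemEq.plug_skelAns (c := c) (.ofSb τ) (.inl hc) t u hu
      rw [ECtx.ofSb_plug, ECtx.ofSb_depth, ECtx.ofSb_ren, ECtx.ofSb_plug] at this
      exact this
    | need i =>
      refine of_need (by rw [h1, hu]; rfl) (Tm.head_sub_of ht2 hu) fun v => ?_
      rw [Tm.substNeeded_wrap hw0, Tm.substNeeded_sub ht, Tm.substNeeded_sub ht2]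
      have := ElemEq.comm (c := c) t (.es (u.substNeeded v)) τ hc
      rw [Sb.shift, Sb.ren, Tm.substNeeded_ren] at this
      exact this
    | red =>
      have hu' : u.head ≠ .ans := by simp [hu]
      rw [Tm.next_sub ht (by rw [Tm.shift, Tm.head_ren, hu]; simp [Head.ren]), Tm.shift,
        Tm.next_ren] at n1
      exact of_red (by rw [h1, hu]; rfl) (Tm.head_sub_of ht2 hu) n1 (Tm.next_sub ht2 hu')
        (.comm t (.es u.next.2) τ hc)
  | skes b =>
    have hw0 : (Tm.ssub t (b.ren (up fun i => i + 1))).head = .red := Tm.head_ssub ht _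
    have hw1 : (Tm.ssub t (b.ren (up fun i => i + 1))).head ≠ .need 0 := by rw [hw0]; simp
    have n1 := Tm.next_wrap hw1 τ
    rw [Tm.next_ssub ht] at n1
    change Match c ((Tm.ssub t (b.ren (up fun i => i + 1))).wrap τ)
      (.ssub ((t.ren (rot 1)).wrap (τ.shift 1)) b)
    refine of_red (by rw [Tm.head_wrap hw1, hw0]; rfl) (Tm.head_ssub ht2 b) n1
      (Tm.next_ssub ht2 b) ?_
    rw [Tm.substNeeded_wrap ht1']
    have := ElemEq.comm (c := c) (t.substNeeded ((Tm.lam b).shift 2)) (.skes b) τ hc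
    rw [Tm.substNeeded_ren, Tm.shift_two_ren_rot] at this
    -- The copied value lands below both substitutions, hence the total weakening by two.
    have e : Tm.shift 1 (.lam (b.ren (up fun i => i + 1))) = (Tm.lam b).shift 2 :=
      Tm.shift_shift (.lam b) 1 1
    rw [Tm.shift_shift, e]
    exact this

/-- The head of `t` may need the variable of `σ`, that of `τ`, or neither. The first two cases are
exchanged by symmetry; in the third both substitutions are inert and every operation passes through
them. -/
theorem comm (t : Tm) (σ τ : Sb) (hc : c) :
    Match c ((t.wrap (σ.shift 1)).wrap τ) (((t.ren (rot 1)).wrap (τ.shift 1)).wrap σ) := by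
  by_cases h0 : t.head = .need 0
  · exact comm_of_need_zero t σ τ hc h0
  by_cases h1 : t.head = .need 1
  -- The transposition `rot 1` is an involution, so this is the previous case read from right to
  -- left.
  · have := comm_of_need_zero (t.ren (rot 1)) τ σ hc (by rw [Tm.head_ren, h1]; rfl)
    rw [Tm.ren_ren, Tm.ren_id t (fun i => rot 1 (rot 1 i))
      (by intro i; rcases i with _ | _ | i <;> simp [rot])] at this
    exact this.symm
  have g0 : (t.ren (rot 1)).head ≠ .need 0 := by
    rw [Tm.head_ren]
    rcases h : t.head with _ | i | _
    · simp [Head.ren]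
    · rcases i with _ | _ | i
      · exact absurd h h0
      · exact absurd h h1
      · simp [Head.ren, rot]
    · simp [Head.ren]
  have hw := Tm.head_wrap h0 (σ.shift 1)
  have gw := Tm.head_wrap g0 (τ.shift 1)
  -- As index 1 is not needed, the head seen by the outer substitution does not need its variable.
  have hn : ∀ i, t.head.pred = .need i → ∃ j, i = j + 1 := by
    intro i hi
    rw [Head.pred_eq_need h0] at hi
    exact Nat.exists_eq_succ_of_ne_zero (fun h => h1 (by rw [hi, h]))
  have e : (t.ren (rot 1)).head.pred = t.head.pred := by
    rw [Tm.head_ren]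
    rcases h : t.head with _ | i | _
    · rfl
    · rcases i with _ | _ | i
      · exact absurd h h0
      · exact absurd h h1
      · rfl
    · rfl
  have hw0 : (t.wrap (σ.shift 1)).head ≠ .need 0 := by
    rw [hw]; intro h; obtain ⟨j, hj⟩ := hn _ h; omega
  have gw0 : ((t.ren (rot 1)).wrap (τ.shift 1)).head ≠ .need 0 := by
    rw [gw, e]; intro h; obtain ⟨j, hj⟩ := hn _ h; omega
  constructor
  · rw [Tm.head_wrap hw0, Tm.head_wrap gw0, hw, gw, e]
  · intro _ w
    simp only [Tm.betaAns_wrap, Tm.shift_shift]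
    have := ElemEq.comm (c := c) (t.betaAns (w.shift 2)) σ τ hc
    rw [Tm.betaAns_ren] at this
    rwa [Tm.shift_two_ren_rot] at this
  · intro _ s
    simp only [Tm.skelAns_wrap, Tm.ren_ren]
    have := ElemEq.comm (c := c) (t.skelAns (s.ren (up fun i => i + 2))) σ τ hc
    rw [Tm.skelAns_ren, Tm.ren_ren] at this
    rw [up_up] at this ⊢
    exact this
  · intro i _ v
    rw [Tm.substNeeded_wrap hw0, Tm.substNeeded_wrap gw0, Tm.substNeeded_wrap h0,
      Tm.substNeeded_wrap g0, Tm.shift_shift]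
    have := ElemEq.comm (c := c) (t.substNeeded (v.shift 2)) σ τ hc
    rw [Tm.substNeeded_ren] at this
    rwa [Tm.shift_two_ren_rot] at this
  · intro _
    rw [Tm.next_wrap hw0, Tm.next_wrap gw0, Tm.next_wrap h0, Tm.next_wrap g0, Tm.next_ren]
  · intro _
    rw [Tm.next_wrap hw0, Tm.next_wrap gw0, Tm.next_wrap h0, Tm.next_wrap g0, Tm.next_ren]
    exact .comm _ σ τ hc

end Match

theorem ElemEq.toMatch {c : Prop} {t u : Tm} (h : ElemEq c t u) : Match c t u := by
  induction h with
  | app t σ w => exact .app t σ w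
  | dem s t σ h => exact .dem s t σ h
  | comm t σ τ h => exact .comm t σ τ h
  | refl t => exact .refl t
  | symm _ ih => exact ih.symm
  | trans _ _ ih ih' => exact ih.trans ih'
  | appL w _ ih => exact ih.appL w
  | wrapL σ h ih => exact ih.wrapL σ h
  | subR s hs _ ih => exact ih.subR s hs

/-- Equal heads give `u` a step as soon as `t` has one; both steps are the values of `next`, which
`Match` compares. -/
theorem ElemEq.isStructuralStrategy (c : Prop) : IsStructuralStrategy Step (ElemEq c) where
  equivalence := ⟨.refl, .symm, .trans⟩
  bisim a t u t' h hs := by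
    have m := h.toMatch
    have hr := hs.next_eq.1
    have hu := Step.of_head_eq_red (m.head_eq.symm.trans hr)
    refine ⟨u.next.2, ?_, ?_⟩
    · rw [← m.label hr, hs.next_eq.2] at hu; exact hu
    · have := m.step hr
      rwa [hs.next_eq.2] at this

/-! ### Comparison with the structural equivalences -/

/-- Each elementary move is a move out of a context with a single frame, and each congruence is
closure under such a context; demand frames are recovered from the head hypothesis. -/
theorem ElemEq.to_evClosure {c : Prop} {R : Tm → Tm → Prop}
    (hR : ∀ (E : ECtx) (t : Tm) (σ : Sb), c ∨ E.depth = 0 →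
      R (E.plug (t.wrap (σ.shift E.depth)))
        (((E.ren Nat.succ).plug (t.ren (rot E.depth))).wrap σ))
    {t u : Tm} (h : ElemEq c t u) : EvClosure R t u := by
  induction h with
  | app t σ w =>
    have := hR (.app .hole w) t σ (.inr rfl)
    simp only [ECtx.plug, ECtx.depth, ECtx.ren, Sb.shift_zero, Tm.ren_rot_zero] at this
    exact .root this
  | dem s t σ h =>
    obtain ⟨E, rfl⟩ := s.head_cases.2.1 0 h
    have := hR (.dem E .hole) t σ (.inr rfl)
    simp only [ECtx.plug, ECtx.depth, ECtx.ren, Sb.shift_zero, Tm.ren_rot_zero] at this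
    rw [Nat.add_zero, ECtx.plug_ren]
    refine .root ?_
    simpa [Tm.ren, upn, ECtx.depth_ren, up] using this
  | comm t σ τ h =>
    have := hR (.ofSb τ) t σ (.inl h)
    simp only [ECtx.ofSb_plug, ECtx.ofSb_depth, ECtx.ofSb_ren] at this
    exact .root this
  | refl t => exact .refl t
  | symm _ ih => exact .symm ih
  | trans _ _ ih ih' => exact .trans ih ih'
  | appL w _ ih => exact .ev (.app .hole w) ih
  | wrapL σ _ ih => rw [← ECtx.ofSb_plug, ← ECtx.ofSb_plug]; exact .ev (.ofSb σ) ih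
  | subR s hs _ ih =>
    obtain ⟨E, rfl⟩ := s.head_cases.2.1 0 hs
    exact .ev (.dem E .hole) ih

theorem strEq_iff (t u : Tm) : StrEq t u ↔ ElemEq True t u := by
  constructor
  · intro h
    unfold StrEq at h
    induction h with
    | root h =>
      cases h with
      | es E t u => exact .move E t (.es u) (.inl trivial)
      | skes E t b => exact .move E t (.skes b) (.inl trivial)
    | refl t => exact .refl t
    | symm _ ih => exact ih.symm
    | trans _ _ ih ih' => exact ih.trans ih'
    | ev E _ ih => exact ih.plug E
  · refine fun h => h.to_evClosure fun E t σ _ => ?_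
    cases σ with
    | es u => exact .es E t u
    | skes b => exact .skes E t b

/-- Without exchanges only contexts of depth zero are crossed, and for those the narrow side
condition is vacuous. -/
theorem ElemEq.strEqNarrow {t u : Tm} (h : ElemEq False t u) : StrEqNarrow t u := by
  refine h.to_evClosure fun E t σ h => ?_
  have h0 : E.depth = 0 := h.resolve_left id
  cases σ with
  | es u => exact .es E t u (by omega)
  | skes b => exact .skes E t b (by omega)

theorem ElemEq.mono {c c' : Prop} (hc : c → c') {t u : Tm} (h : ElemEq c t u) : ElemEq c' t u := by
  induction h with
  | app t σ w => exact .app t σ w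
  | dem s t σ h => exact .dem s t σ h
  | comm t σ τ h => exact .comm t σ τ (hc h)
  | refl t => exact .refl t
  | symm _ ih => exact ih.symm
  | trans _ _ ih ih' => exact ih.trans ih'
  | appL w _ ih => exact .appL w ih
  | wrapL σ _ ih => exact .wrapL σ ih
  | subR s hs _ ih => exact .subR s hs ih

theorem ElemEq.strEq {c : Prop} {t u : Tm} (h : ElemEq c t u) : StrEq t u :=
  (strEq_iff t u).2 (h.mono fun _ => trivial)

theorem strEq_isStructuralStrategy : IsStructuralStrategy Step StrEq := by
  have : StrEq = ElemEq True := by funext t u; exact propext (strEq_iff t u)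
  rw [this]; exact ElemEq.isStructuralStrategy True

/-! ### Distilleries are mechanical bisimulations -/

section Distillery

variable {T A : Type} {M : Machine T A} {step : A → T → T → Prop} {equiv : T → T → Prop}

theorem Machine.Run.append {Q Q' Q'' : M.State} {r r' : List (Option A)} (h : M.Run Q r Q')
    (h' : M.Run Q' r' Q'') : M.Run Q (r ++ r') Q'' := by
  induction h with
  | nil => exact h'
  | principal p _ ih => exact .principal p (ih h')
  | search p _ ih => exact .search p (ih h')

theorem Machine.Reachable.run {Q Q' : M.State} {r : List (Option A)} (h : M.Reachable Q)
    (h' : M.Run Q r Q') : M.Reachable Q' := by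
  obtain ⟨t, Q₀, r₀, hi, hr⟩ := h
  exact ⟨t, Q₀, _, hi, hr.append h'⟩

theorem Machine.Reachable.of_init {t : T} {Q : M.State} (h : M.init t Q) : M.Reachable Q :=
  ⟨t, Q, [], h, .nil Q⟩

theorem IsDistillery.mono {equiv' : T → T → Prop} (hD : IsDistillery M step equiv)
    (h : ∀ t u, equiv t u → equiv' t u) : IsDistillery M step equiv' where
  projection a Q Q' hQ p := by
    obtain ⟨u, hu, hu'⟩ := hD.projection a Q Q' hQ p
    exact ⟨u, hu, h _ _ hu'⟩
  transparency := hD.transparency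
  termination := hD.termination
  determinism := hD.determinism
  halt := hD.halt

variable [DecidableEq A]

/-- The starting term is known only up to `equiv`, as projection yields the next read-back only up
to `equiv`; strong bisimulation carries each projected step over to the term reached so far. -/
theorem IsDistillery.run_to_evaluation (hD : IsDistillery M step equiv)
    (hS : IsStructuralStrategy step equiv) {Q Q' : M.State} {r : List (Option A)}
    (h : M.Run Q r Q') (hQ : M.Reachable Q) (t : T) (ht : equiv t (M.decode Q)) :
    ∃ e u, Evaluation step t e u ∧ equiv u (M.decode Q') ∧ ∀ a, e.count a = r.count (some a) := by
  induction h generalizing t with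
  | nil Q => exact ⟨[], t, .nil t, ht, by simp⟩
  | @principal a r Q Q' Q'' p hr ih =>
    obtain ⟨v, hv, hv'⟩ := hD.projection a Q Q' hQ p
    obtain ⟨s, hs, hs'⟩ := hS.bisim a _ _ _ (hS.equivalence.symm ht) hv
    obtain ⟨e, u, he, hu, hc⟩ := ih (hQ.run (.principal p (.nil _))) s
      (hS.equivalence.trans (hS.equivalence.symm hs') hv')
    refine ⟨a :: e, u, .cons hs he, hu, fun b => ?_⟩
    simp only [List.count_cons, hc, beq_iff_eq, Option.some.injEq]
  | @search r Q Q' Q'' p hr ih =>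
    obtain ⟨e, u, he, hu, hc⟩ := ih (hQ.run (.search p (.nil _))) t
      (hD.transparency Q Q' hQ p ▸ ht)
    exact ⟨e, u, he, hu, fun b => by simp [hc]⟩

theorem IsDistillery.search_normalForm (hD : IsDistillery M step equiv) (Q : M.State)
    (hQ : M.Reachable Q) :
    ∃ r Q', M.Run Q r Q' ∧ M.decode Q' = M.decode Q ∧ (∀ a, r.count (some a) = 0) ∧
      ∀ Q'', ¬ M.search Q' Q'' := by
  induction Q using hD.termination.induction with
  | _ Q ih =>
    by_cases h : ∃ Q', M.search Q Q'
    · obtain ⟨Q', p⟩ := h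
      obtain ⟨r, Q'', hr, hd, hc, hn⟩ := ih Q' p (hQ.run (.search p (.nil _)))
      exact ⟨none :: r, Q'', .search p hr, hd.trans (hD.transparency Q Q' hQ p).symm,
        fun a => by simp [hc], hn⟩
    · exact ⟨[], Q, .nil Q, rfl, by simp, fun Q'' p => h ⟨Q'', p⟩⟩

/-- Search is first run to exhaustion, which leaves the read-back unchanged. The read-back is not
normal, so the halt property provides a principal transition, and determinism identifies its
projection with the given step. -/
theorem IsDistillery.evaluation_to_run (hD : IsDistillery M step equiv)
    (hS : IsStructuralStrategy step equiv) {t u : T} {e : List A} (h : Evaluation step t e u)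
    (Q : M.State) (hQ : M.Reachable Q) (ht : equiv t (M.decode Q)) :
    ∃ r Q', M.Run Q r Q' ∧ equiv (M.decode Q') u ∧ ∀ a, e.count a = r.count (some a) := by
  induction h generalizing Q with
  | nil t => exact ⟨[], Q, .nil Q, hS.equivalence.symm ht, by simp⟩
  | @cons a e t u s hs he ih =>
    obtain ⟨r₁, Q₁, hr₁, hd₁, hc₁, hn₁⟩ := hD.search_normalForm Q hQ
    have hQ₁ := hQ.run hr₁
    obtain ⟨v, hv, hv'⟩ := hS.bisim a _ _ _ ht hs
    rw [← hd₁] at hv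
    have hp : ∃ b Q₂, M.principal b Q₁ Q₂ := by
      by_contra hcon
      exact hD.halt Q₁ hQ₁ (fun Q' => ⟨fun b p => hcon ⟨b, Q', p⟩, hn₁ Q'⟩) a v hv
    obtain ⟨b, Q₂, p⟩ := hp
    obtain ⟨w, hw, hw'⟩ := hD.projection b Q₁ Q₂ hQ₁ p
    obtain ⟨rfl, rfl⟩ := hD.determinism _ _ _ _ _ hv hw
    obtain ⟨r₂, Q₃, hr₂, hd₂, hc₂⟩ := ih Q₂ (hQ₁.run (.principal p (.nil _)))
      (hS.equivalence.trans hv' hw')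
    refine ⟨r₁ ++ some a :: r₂, Q₃, hr₁.append (.principal p hr₂), hd₂, fun b => ?_⟩
    simp only [List.count_append, hc₁, List.count_cons, hc₂, beq_iff_eq, Option.some.injEq,
      Nat.zero_add]

theorem IsDistillery.mechBisimilar (hD : IsDistillery M step equiv)
    (hS : IsStructuralStrategy step equiv) (hi : ∀ t Q, M.init t Q → M.decode Q = t) :
    MechBisimilar M step equiv where
  runs_to_evaluations t Q _ _ h hr :=
    hD.run_to_evaluation hS hr (.of_init h) t (hi t Q h ▸ hS.equivalence.refl t)
  evaluations_to_runs t Q _ _ h he :=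
    hD.evaluation_to_run hS he Q (.of_init h) (hi t Q h ▸ hS.equivalence.refl t)

/-- The larger relation need not be a bisimulation; this is how the narrow equivalence is reached.
-/
theorem MechBisimilar.mono {equiv' : T → T → Prop} (hM : MechBisimilar M step equiv)
    (h : ∀ t u, equiv t u → equiv' t u) : MechBisimilar M step equiv' where
  runs_to_evaluations t Q r Q' hi hr := by
    obtain ⟨e, u, he, hu, hc⟩ := hM.runs_to_evaluations t Q r Q' hi hr
    exact ⟨e, u, he, h _ _ hu, hc⟩
  evaluations_to_runs t Q e u hi he := by
    obtain ⟨r, Q', hr, hu, hc⟩ := hM.evaluations_to_runs t Q e u hi he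
    exact ⟨r, Q', hr, h _ _ hu, hc⟩

end Distillery

/-! ### Pre-terms and their representation modulo α -/

theorem index_cons (z : ℕ) (Γ : List ℕ) (x : ℕ) :
    index (z :: Γ) x = if x = z then 0 else index Γ x + 1 := by
  unfold index
  by_cases h : x = z
  · simp [h]
  · by_cases h' : x ∈ Γ
    · simp [h, h', List.idxOf_cons_ne _ (Ne.symm h)]
    · simp [h, h']; omega

theorem index_append_of_mem {Δ : List ℕ} {x : ℕ} (h : x ∈ Δ) (Γ : List ℕ) :
    index (Δ ++ Γ) x = Δ.idxOf x := by
  simp [index, h, List.idxOf_append_of_mem h]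

theorem index_append_of_notMem {Δ : List ℕ} {x : ℕ} (h : x ∉ Δ) (Γ : List ℕ) :
    index (Δ ++ Γ) x = index Γ x + Δ.length := by
  induction Δ with
  | nil => rfl
  | cons z Δ ih =>
    simp only [List.mem_cons, not_or] at h
    rw [List.cons_append, index_cons, if_neg h.1, ih h.2, List.length_cons, Nat.add_assoc]

theorem index_append_lt {Δ Γ : List ℕ} {x : ℕ} :
    index (Δ ++ Γ) x < Δ.length ↔ x ∈ Δ := by
  by_cases h : x ∈ Δ
  · simp [h, index_append_of_mem h, List.idxOf_lt_length_of_mem h]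
  · simp [h, index_append_of_notMem h]

theorem index_nil (x : ℕ) : index [] x = x := by simp [index]

theorem up_index {Γ Γ' : List ℕ} {ξ : ℕ → ℕ} {z y : ℕ}
    (h : y ≠ z → ξ (index Γ y) = index Γ' y) :
    up ξ (index (z :: Γ) y) = index (z :: Γ') y := by
  rw [index_cons, index_cons]
  by_cases hy : y = z
  · simp [hy, up]
  · simp [hy, up, h hy]

namespace PLam

/-- A representation depends on its scope only through the indices of the free names. Weakening,
strengthening and independence of the scope are all instances. -/
theorem toLam_ren (t : PLam) : ∀ (Γ Γ' : List ℕ) (ξ : ℕ → ℕ),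
    (∀ x ∈ t.fv, ξ (index Γ x) = index Γ' x) → t.toLam Γ' = (t.toLam Γ).ren ξ := by
  induction t with
  | var x => intro Γ Γ' ξ h; simp only [toLam, Lam.ren, h x (by simp [fv])]
  | lam z b ih =>
    intro Γ Γ' ξ h
    simp only [toLam, Lam.ren]
    rw [ih (z :: Γ) (z :: Γ') (up ξ) fun y hy => up_index fun hz => h y (by simp [fv, hy, hz])]
  | app t u iht ihu =>
    intro Γ Γ' ξ h
    simp only [toLam, Lam.ren]
    rw [iht Γ Γ' ξ fun x hx => h x (by simp [fv, hx]), ihu Γ Γ' ξ fun x hx => h x (by simp [fv, hx])]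

/-- In the empty scope a name is its own index, so `index Γ` is a renaming from the empty scope to
`Γ`. -/
theorem AlphaEq.toLam_eq {t u : PLam} (h : t.AlphaEq u) (Γ : List ℕ) : t.toLam Γ = u.toLam Γ := by
  rw [toLam_ren t [] Γ (index Γ) (by simp [index_nil]), h,
    ← toLam_ren u [] Γ (index Γ) (by simp [index_nil])]

theorem occ_toLam (t : PLam) : ∀ (Γ : List ℕ) (i : ℕ),
    (t.toLam Γ).occ i = true ↔ ∃ x ∈ t.fv, index Γ x = i := by
  induction t with
  | var x =>
    intro Γ i
    simp only [toLam, Lam.occ, fv, beq_iff_eq, Finset.mem_singleton, exists_eq_left]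
    exact eq_comm
  | lam z b ih =>
    intro Γ i
    simp only [toLam, Lam.occ, ih, index_cons, fv, Finset.mem_erase]
    constructor
    · rintro ⟨x, hx, h⟩
      by_cases hz : x = z
      · simp [hz] at h
      · simp only [hz, if_false, Nat.add_right_cancel_iff] at h; exact ⟨x, ⟨hz, hx⟩, h⟩
    · rintro ⟨x, ⟨hz, hx⟩, h⟩
      exact ⟨x, hx, by simp [hz, h]⟩
  | app t u iht ihu =>
    intro Γ i
    simp only [toLam, Lam.occ, Bool.or_eq_true, iht, ihu, fv, Finset.mem_union]
    grind

theorem AlphaEq.fv_eq {t u : PLam} (h : t.AlphaEq u) : t.fv = u.fv := by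
  ext x
  have : ∀ t : PLam, x ∈ t.fv ↔ (t.toLam []).occ x = true := by simp [occ_toLam, index_nil]
  rw [this, this, h]

theorem mem_names_of_mem_fv {t : PLam} {x : ℕ} (h : x ∈ t.fv) : x ∈ t.names := by
  induction t with
  | var y => simpa [fv, names] using h
  | lam y b ih => simp only [fv, Finset.mem_erase] at h; simp [names, ih h.2]
  | app t u iht ihu =>
    simp only [fv, Finset.mem_union] at h
    simp only [names, List.mem_append]
    exact h.imp iht ihu

theorem mem_names_of_mem_binders {t : PLam} {x : ℕ} (h : x ∈ t.binders) : x ∈ t.names := by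
  induction t with
  | var y => simp [binders] at h
  | lam y b ih => simp only [binders, List.mem_cons] at h; simp only [names, List.mem_cons]; exact h.imp id ih
  | app t u iht ihu =>
    simp only [binders, List.mem_append] at h
    simp only [names, List.mem_append]
    exact h.imp iht ihu

/-! Skeletal decompositions of pre-terms and of terms modulo α. -/

theorem isVar_toLam (t : PLam) (Γ : List ℕ) : (t.toLam Γ).isVar = false ↔ ∀ x, t ≠ var x := by
  cases t <;> simp [toLam, Lam.isVar]

theorem extract_toLam (t : PLam) (Δ Γ : List ℕ) :
    (t.toLam (Δ ++ Γ)).Extract Δ.length ↔ (∀ x, t ≠ var x) ∧ Disjoint t.fv Δ.toFinset := by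
  unfold Lam.Extract
  rw [isVar_toLam, Finset.disjoint_left]
  refine and_congr Iff.rfl ⟨fun h x hx hΔ => ?_, fun h i hi => ?_⟩
  · rw [List.mem_toFinset] at hΔ
    have h1 := h _ (index_append_lt (Γ := Γ).2 hΔ)
    have h2 := (occ_toLam t (Δ ++ Γ) _).2 ⟨x, hx, rfl⟩
    rw [h1] at h2; cases h2
  · rw [Bool.eq_false_iff]
    intro ho
    obtain ⟨x, hx, rfl⟩ := (occ_toLam t _ _).1 ho
    exact h hx (List.mem_toFinset.2 (index_append_lt.1 hi))

theorem toLam_strengthen (t : PLam) (Δ Γ : List ℕ) (h : Disjoint t.fv Δ.toFinset) :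
    (t.toLam (Δ ++ Γ)).ren (fun i => i - Δ.length) = t.toLam Γ := by
  symm
  refine toLam_ren t _ _ _ fun x hx => ?_
  have : x ∉ Δ := fun hd => Finset.disjoint_left.1 h hx (List.mem_toFinset.2 hd)
  rw [index_append_of_notMem this, Nat.add_sub_cancel]

namespace SkelDec

variable {θ : Finset ℕ} {t s : PLam} {F : List (ℕ × PLam)}

theorem fleshAt_eq (h : SkelDec θ t s F) : ∀ (Δ Γ : List ℕ), Δ.toFinset = θ →
    (t.toLam (Δ ++ Γ)).fleshAt Δ.length = F.map (fun p => p.2.toLam Γ) := by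
  induction h with
  | @extract θ t z hv hd =>
    rintro Δ Γ rfl
    have hE := (extract_toLam t Δ Γ).2 ⟨hv, hd⟩
    have hs := toLam_strengthen t Δ Γ hd
    cases t with
    | var x => exact absurd rfl (hv x)
    | lam x b => simp only [toLam] at hE hs ⊢; simp [Lam.fleshAt, hE, hs, toLam]
    | app t u => simp only [toLam] at hE hs ⊢; simp [Lam.fleshAt, hE, hs, toLam]
  | var x => intros; rfl
  | @lam θ x b s F hd _ ih =>
    rintro Δ Γ rfl
    have hE := mt (extract_toLam (.lam x b) Δ Γ).1 (fun h => hd h.2)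
    simp only [toLam] at hE ⊢
    simp only [Lam.fleshAt, hE, if_false]
    exact ih (x :: Δ) Γ (by simp)
  | @app θ t u s p F G hd _ _ iht ihu =>
    rintro Δ Γ rfl
    have hE := mt (extract_toLam (.app t u) Δ Γ).1 (fun h => hd h.2)
    simp only [toLam] at hE ⊢
    simp only [Lam.fleshAt, hE, if_false, iht Δ Γ rfl, ihu Δ Γ rfl, List.map_append]

/-- The lists `pre` and `post` hold the flesh names used before and after `t` in the surrounding
decomposition, so the offset is the length of `pre`. Freshness keeps these names apart from those of
`t` and of the crossed binders. -/
theorem skelAt_eq (h : SkelDec θ t s F) : ∀ (Δ Γ pre post : List ℕ), Δ.toFinset = θ →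
    (pre ++ F.map Prod.fst ++ post).Nodup →
    (∀ z ∈ pre ++ F.map Prod.fst ++ post, z ∉ t.names ∧ z ∉ Δ) →
    (t.toLam (Δ ++ Γ)).skelAt Δ.length pre.length (pre ++ F.map Prod.fst ++ post).length =
      s.toLam (Δ ++ ((pre ++ F.map Prod.fst ++ post) ++ Γ)) := by
  induction h with
  | @extract θ t z hv hd =>
    rintro Δ Γ pre post rfl hn hf
    have hE := (extract_toLam t Δ Γ).2 ⟨hv, hd⟩
    have hz : z ∉ pre := by
      simp only [List.map_cons, List.map_nil, List.append_assoc] at hn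
      have := List.disjoint_of_nodup_append hn
      exact fun h => this h (by simp)
    have hi : index (Δ ++ ((pre ++ [z] ++ post) ++ Γ)) z = Δ.length + pre.length := by
      rw [index_append_of_notMem (hf z (by simp)).2, List.append_assoc, List.append_assoc,
        index_append_of_notMem hz, List.singleton_append, index_cons]
      simp; omega
    cases t with
    | var x => exact absurd rfl (hv x)
    | lam x b =>
      simp only [toLam] at hE ⊢
      simp only [Lam.skelAt, hE, if_true, List.map_cons, List.map_nil, hi]
    | app t u =>
      simp only [toLam] at hE ⊢
      simp only [Lam.skelAt, hE, if_true, List.map_cons, List.map_nil, hi]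
  | var x =>
    intro Δ Γ pre post _ _ hf
    generalize hzs : pre ++ List.map Prod.fst [] ++ post = zs at *
    simp only [toLam, Lam.skelAt, index_append_lt]
    split_ifs with hx
    · rw [index_append_of_mem hx, index_append_of_mem hx]
    · have hx' : x ∉ zs := fun h => (hf x h).1 (by simp [names])
      rw [index_append_of_notMem hx, index_append_of_notMem hx, index_append_of_notMem hx']
      congr 1; omega
  | @lam θ x b s F hd _ ih =>
    rintro Δ Γ pre post rfl hn hf
    have hE := mt (extract_toLam (.lam x b) Δ Γ).1 (fun h => hd h.2)
    simp only [toLam] at hE ⊢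
    simp only [Lam.skelAt, hE, if_false]
    refine congrArg Lam.lam (ih (x :: Δ) Γ pre post (by simp) hn fun z hz => ?_)
    · have := hf z hz
      simp only [names, List.mem_cons, not_or] at this ⊢
      exact ⟨this.1.2, this.1.1, this.2⟩
  | @app θ t u s p F G hd ht _ iht ihu =>
    rintro Δ Γ pre post rfl hn hf
    have hE := mt (extract_toLam (.app t u) Δ Γ).1 (fun h => hd h.2)
    simp only [toLam] at hE ⊢
    simp only [Lam.skelAt, hE, if_false]
    -- Seen from the function the names of `G` belong to `post`; seen from the argument those of `F`
    -- belong to `pre`.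
    have e1 : pre ++ (F ++ G).map Prod.fst ++ post =
        pre ++ F.map Prod.fst ++ (G.map Prod.fst ++ post) := by simp
    have e2 : pre ++ (F ++ G).map Prod.fst ++ post =
        (pre ++ F.map Prod.fst) ++ G.map Prod.fst ++ post := by simp
    congr 1
    · rw [e1] at hn hf ⊢
      refine iht Δ Γ pre _ rfl hn fun z hz => ?_
      have := hf z hz
      simp only [names, List.mem_append, not_or] at this
      exact ⟨this.1.1, this.2⟩
    · rw [e2] at hn hf ⊢
      rw [ht.fleshAt_eq Δ Γ rfl, List.length_map]
      have := ihu Δ Γ (pre ++ F.map Prod.fst) post rfl hn fun z hz => ?_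
      · rw [← this]; simp
      · have := hf z hz
        simp only [names, List.mem_append, not_or] at this
        exact ⟨this.1.2, this.2⟩

/-- Decomposition distributes the abstractions without duplicating any, so the bound names stay
distinct after a transition sk with no renaming. -/
theorem binders_eq (h : SkelDec θ t s F) :
    (t.binders : Multiset ℕ) = s.binders + (F.map fun p => (p.2.binders : Multiset ℕ)).sum := by
  induction h with
  | extract z _ _ => simp [binders]
  | var x => simp [binders]
  | lam _ _ ih =>
    simp only [binders, ← Multiset.cons_coe, ih, Multiset.cons_add]
  | app _ _ _ iht ihu =>
    simp only [binders, ← Multiset.coe_add, iht, ihu, List.map_append, List.sum_append]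
    abel

theorem fv_flesh (h : SkelDec θ t s F) : ∀ p ∈ F, ∀ x ∈ p.2.fv, x ∈ t.fv ∧ x ∉ θ := by
  induction h with
  | @extract θ t z _ hd =>
    intro p hp x hx
    simp only [List.mem_singleton] at hp
    subst hp
    exact ⟨hx, Finset.disjoint_left.1 hd hx⟩
  | var x => simp
  | @lam θ y b s F _ _ ih =>
    intro p hp x hx
    obtain ⟨h1, h2⟩ := ih p hp x hx
    simp only [Finset.mem_insert, not_or] at h2
    exact ⟨by simp [fv, h1, h2.1], h2.2⟩
  | app _ _ _ iht ihu =>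
    intro p hp x hx
    rcases List.mem_append.1 hp with hp | hp
    · exact ⟨by simp [fv, (iht p hp x hx).1], (iht p hp x hx).2⟩
    · exact ⟨by simp [fv, (ihu p hp x hx).1], (ihu p hp x hx).2⟩

theorem fv_skel (h : SkelDec θ t s F) : ∀ x ∈ s.fv, x ∈ t.fv ∨ x ∈ F.map Prod.fst := by
  induction h with
  | extract z _ _ => intro x hx; right; simpa [fv] using hx
  | var x => intro y hy; exact .inl hy
  | @lam θ y b s F _ _ ih =>
    intro x hx
    simp only [fv, Finset.mem_erase] at hx ⊢
    exact (ih x hx.2).imp (fun h => ⟨hx.1, h⟩) id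
  | app _ _ _ iht ihu =>
    intro x hx
    simp only [fv, Finset.mem_union, List.map_append, List.mem_append] at hx ⊢
    rcases hx with hx | hx
    · have := iht x hx; tauto
    · have := ihu x hx; tauto

/-- Extracted sub-terms avoid `θ`, so no occurrence of a variable of `θ` is removed; hence whatever
was not extractable in `t` is still not extractable in its skeleton. -/
theorem mem_fv_skel (h : SkelDec θ t s F) : ∀ x ∈ θ, x ∈ t.fv → x ∈ s.fv := by
  induction h with
  | extract z _ hd => intro x hx ht; exact absurd hx (Finset.disjoint_left.1 hd ht)
  | var x => intro y _ hy; exact hy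
  | @lam θ y b s F _ _ ih =>
    intro x hx ht
    simp only [fv, Finset.mem_erase] at ht ⊢
    exact ⟨ht.1, ih x (by simp [hx]) ht.2⟩
  | app _ _ _ iht ihu =>
    intro x hx ht
    simp only [fv, Finset.mem_union] at ht ⊢
    exact ht.imp (iht x hx) (ihu x hx)

theorem not_disjoint_skel (h : SkelDec θ t s F) (hd : ¬ Disjoint t.fv θ) : ¬ Disjoint s.fv θ := by
  rw [Finset.not_disjoint_iff] at hd ⊢
  obtain ⟨x, hx, hθ⟩ := hd
  exact ⟨x, h.mem_fv_skel x hθ hx, hθ⟩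

/-- Nothing can be extracted from a skeleton. -/
theorem fleshAt_skel (h : SkelDec θ t s F) : ∀ (Δ Γ : List ℕ), Δ.toFinset = θ →
    (s.toLam (Δ ++ Γ)).fleshAt Δ.length = [] := by
  induction h with
  | extract z _ _ => intros; rfl
  | var x => intros; rfl
  | @lam θ x b s F hd hb ih =>
    rintro Δ Γ rfl
    have hE := mt (extract_toLam (.lam x s) Δ Γ).1 (fun h => (hb.lam hd).not_disjoint_skel hd h.2)
    simp only [toLam] at hE ⊢
    simp only [Lam.fleshAt, hE, if_false]
    exact ih (x :: Δ) Γ (by simp)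
  | @app θ t u s p F G hd ht hu iht ihu =>
    rintro Δ Γ rfl
    have hE := mt (extract_toLam (.app s p) Δ Γ).1 (fun h => (ht.app hd hu).not_disjoint_skel hd h.2)
    simp only [toLam] at hE ⊢
    simp only [Lam.fleshAt, hE, if_false, iht Δ Γ rfl, ihu Δ Γ rfl, List.append_nil]

end SkelDec

/-! ### Existence of fresh decompositions and of fresh α-renamings. -/

theorem exists_skelDec (t : PLam) : ∀ (θ A : Finset ℕ), ∃ s F, SkelDec θ t s F ∧
    (F.map Prod.fst).Nodup ∧ ∀ z ∈ F.map Prod.fst, z ∉ A := by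
  have hex : ∀ (t : PLam) (θ A : Finset ℕ), (∀ x, t ≠ var x) → Disjoint t.fv θ →
      ∃ s F, SkelDec θ t s F ∧ (F.map Prod.fst).Nodup ∧ ∀ z ∈ F.map Prod.fst, z ∉ A := by
    intro t θ A hv hd
    obtain ⟨z, hz⟩ := Infinite.exists_notMem_finset A
    exact ⟨_, _, .extract z hv hd, by simp, by simpa using hz⟩
  induction t with
  | var x => intro θ A; exact ⟨_, _, .var x, by simp, by simp⟩
  | lam x b ih =>
    intro θ A
    by_cases hd : Disjoint (lam x b).fv θ
    · exact hex _ _ _ (by simp) hd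
    · obtain ⟨s, F, h, hn, hA⟩ := ih (insert x θ) A
      exact ⟨_, _, .lam hd h, hn, hA⟩
  | app t u iht ihu =>
    intro θ A
    by_cases hd : Disjoint (app t u).fv θ
    · exact hex _ _ _ (by simp) hd
    · obtain ⟨s, F, h, hn, hA⟩ := iht θ A
      -- The flesh names of the argument also avoid those of the function.
      obtain ⟨p, G, h', hn', hA'⟩ := ihu θ (A ∪ (F.map Prod.fst).toFinset)
      refine ⟨_, _, .app hd h h', ?_, ?_⟩
      · rw [List.map_append]
        refine List.nodup_append'.2 ⟨hn, hn', fun z hz hz' => ?_⟩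
        exact hA' z hz' (by simp only [Finset.mem_union, List.mem_toFinset]; exact .inr hz)
      · intro z hz
        rw [List.map_append, List.mem_append] at hz
        rcases hz with hz | hz
        · exact hA z hz
        · exact fun h => hA' z hz (Finset.mem_union_left _ h)

/-- The scopes `Γ` and `Γ'` list the old and new names of the crossed binders, position by position.
Distinctness of `Γ'` makes positions recoverable, and disjointness from the names of `t` prevents
the capture of free names. -/
theorem exists_fresh_toLam (t : PLam) : ∀ (Γ Γ' : List ℕ) (A : Finset ℕ), Γ'.length = Γ.length →
    Γ'.Nodup → (∀ x ∈ Γ', x ∉ t.names) →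
    ∃ w : PLam, w.toLam Γ' = t.toLam Γ ∧ w.WellBound ∧ ∀ z ∈ w.binders, z ∉ A := by
  induction t with
  | var x =>
    intro Γ Γ' A hl hn hx
    by_cases h : x ∈ Γ
    · have hi := List.idxOf_lt_length_of_mem h
      rw [← hl] at hi
      refine ⟨var (Γ'[Γ.idxOf x]), ?_, by simp [WellBound, binders], by simp [binders]⟩
      simp only [toLam, index, h, if_true, List.getElem_mem]
      rw [hn.idxOf_getElem]
    · refine ⟨var x, ?_, by simp [WellBound, binders], by simp [binders]⟩
      have h' : x ∉ Γ' := fun h' => hx x h' (by simp [names])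
      simp only [toLam, index, h, h', if_false, hl]
  | lam x b ih =>
    intro Γ Γ' A hl hn hx
    obtain ⟨z, hz⟩ := Infinite.exists_notMem_finset (A ∪ Γ'.toFinset ∪ b.names.toFinset)
    simp only [Finset.mem_union, List.mem_toFinset, not_or] at hz
    -- Adding `z` to the names to avoid keeps the inner binders distinct from it.
    obtain ⟨w, hw, hb, hA⟩ := ih (x :: Γ) (z :: Γ') (insert z A) (by simp [hl])
      (List.nodup_cons.2 ⟨hz.1.2, hn⟩) (by
        intro y hy
        rcases List.mem_cons.1 hy with rfl | hy
        · exact hz.2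
        · exact fun h => hx y hy (by simp [names, h]))
    refine ⟨lam z w, by simp only [toLam, hw], ?_, ?_⟩
    · exact List.nodup_cons.2 ⟨fun h => hA z h (by simp), hb⟩
    · intro y hy
      rcases List.mem_cons.1 hy with rfl | hy
      · exact hz.1.1
      · exact fun h => hA y hy (by simp [h])
  | app t u iht ihu =>
    intro Γ Γ' A hl hn hx
    obtain ⟨w, hw, hb, hA⟩ := iht Γ Γ' A hl hn fun x h h' => hx x h (by simp [names, h'])
    obtain ⟨w', hw', hb', hA'⟩ := ihu Γ Γ' (A ∪ w.binders.toFinset) hl hn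
      fun x h h' => hx x h (by simp [names, h'])
    refine ⟨app w w', by simp only [toLam, hw, hw'], ?_, ?_⟩
    · refine List.nodup_append'.2 ⟨hb, hb', fun z hz hz' => ?_⟩
      exact hA' z hz' (by simp only [Finset.mem_union, List.mem_toFinset]; exact .inr hz)
    · intro z hz
      rcases List.mem_append.1 hz with hz | hz
      · exact hA z hz
      · exact fun h => hA' z hz (Finset.mem_union_left _ h)

end PLam

/-! ### Read-back -/

namespace PTm

def fv : PTm → Finset ℕ
  | var x => {x}
  | lam x b => b.fv.erase x
  | app t u => fv t ∪ fv u
  | sub t x u => (fv t).erase x ∪ fv u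
  | ssub t x y b => (fv t).erase x ∪ b.fv.erase y

theorem toTm_ren (t : PTm) : ∀ (Γ Γ' : List ℕ) (ξ : ℕ → ℕ),
    (∀ x ∈ t.fv, ξ (index Γ x) = index Γ' x) → t.toTm Γ' = (t.toTm Γ).ren ξ := by
  have hb : ∀ (z : ℕ) (b : PLam) (Γ Γ' : List ℕ) (ξ : ℕ → ℕ),
      (∀ x ∈ b.fv.erase z, ξ (index Γ x) = index Γ' x) →
      b.toLam (z :: Γ') = (b.toLam (z :: Γ)).ren (up ξ) := fun z b Γ Γ' ξ h =>
    b.toLam_ren _ _ _ fun y hy => up_index fun hz => h y (by simp [hy, hz])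
  induction t with
  | var x => intro Γ Γ' ξ h; simp only [toTm, Tm.ren, h x (by simp [fv])]
  | lam z b => intro Γ Γ' ξ h; simp only [toTm, Tm.ren, hb z b Γ Γ' ξ h]
  | app t u iht ihu =>
    intro Γ Γ' ξ h
    simp only [toTm, Tm.ren]
    rw [iht Γ Γ' ξ fun x hx => h x (by simp [fv, hx]), ihu Γ Γ' ξ fun x hx => h x (by simp [fv, hx])]
  | sub t z u iht ihu =>
    intro Γ Γ' ξ h
    simp only [toTm, Tm.ren]
    rw [iht (z :: Γ) (z :: Γ') (up ξ) fun y hy => up_index fun hz => h y (by simp [fv, hy, hz]),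
      ihu Γ Γ' ξ fun x hx => h x (by simp [fv, hx])]
  | ssub t z y b iht =>
    intro Γ Γ' ξ h
    simp only [toTm, Tm.ren]
    rw [iht (z :: Γ) (z :: Γ') (up ξ) fun y hy => up_index fun hz => h y (by simp [fv, hy, hz]),
      hb y b Γ Γ' ξ fun x hx => h x (Finset.mem_union_right _ hx)]

theorem toTm_append (t : PTm) (Δ Γ : List ℕ) (h : ∀ x ∈ t.fv, x ∉ Δ) :
    t.toTm (Δ ++ Γ) = (t.toTm Γ).shift Δ.length :=
  toTm_ren t _ _ _ fun x hx => (index_append_of_notMem (h x hx) Γ).symm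

theorem toTm_cons (t : PTm) (x : ℕ) (Γ : List ℕ) (h : x ∉ t.fv) :
    t.toTm (x :: Γ) = (t.toTm Γ).shift 1 :=
  toTm_append t [x] Γ fun y hy => by rw [List.mem_singleton]; rintro rfl; exact h hy

/-- Weakening under a binder. -/
theorem toTm_cons_append (t : PTm) (y : ℕ) (Δ Γ : List ℕ) (h : ∀ x ∈ t.fv, x ≠ y → x ∉ Δ) :
    t.toTm (y :: (Δ ++ Γ)) = (t.toTm (y :: Γ)).ren (up fun i => i + Δ.length) :=
  toTm_ren t _ _ _ fun x hx => up_index fun hy => (index_append_of_notMem (h x hx hy) Γ).symm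

end PTm

theorem PLam.toTm_toPTm (t : PLam) (Γ : List ℕ) : t.toPTm.toTm Γ = (t.toLam Γ).toTm := by
  induction t generalizing Γ with
  | var x => rfl
  | lam x b _ => rfl
  | app t u iht ihu => simp only [toPTm, PTm.toTm, toLam, Lam.toTm, iht, ihu]

theorem PLam.fv_toPTm (t : PLam) : t.toPTm.fv = t.fv := by
  induction t with
  | var x => rfl
  | lam x b _ => rfl
  | app t u iht ihu => simp only [toPTm, PTm.fv, fv, iht, ihu]

namespace Entry

/-- The name bound by an entry. -/
def name : Entry → ℕ
  | es x _ => x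
  | skes x _ _ => x

def fv : Entry → Finset ℕ
  | es _ t => t.fv
  | skes _ y b => b.fv.erase y

def wrap (t : PTm) : Entry → PTm
  | es x u => .sub t x u.toPTm
  | skes x y b => .ssub t x y b

def toSb (Γ : List ℕ) : Entry → Sb
  | es _ u => .es (u.toLam Γ).toTm
  | skes _ y b => .skes (b.toLam (y :: Γ))

theorem toTm_wrap (e : Entry) (t : PTm) (Γ : List ℕ) :
    (e.wrap t).toTm Γ = (t.toTm (e.name :: Γ)).wrap (e.toSb Γ) := by
  cases e with
  | es x u => simp only [wrap, PTm.toTm, PLam.toTm_toPTm]; rfl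
  | skes x y b => rfl

theorem fv_wrap (e : Entry) (t : PTm) : (e.wrap t).fv = t.fv.erase e.name ∪ e.fv := by
  cases e with
  | es x u => simp only [wrap, PTm.fv, PLam.fv_toPTm]; rfl
  | skes x y b => rfl

end Entry

/-- The domain of an environment. -/
def dom (E : List Entry) : List ℕ := E.map Entry.name

theorem dom_append (E E' : List Entry) : dom (E ++ E') = dom E ++ dom E' := List.map_append

theorem dom_cons (e : Entry) (E : List Entry) : dom (e :: E) = e.name :: dom E := rfl

theorem dom_fleshEnv (F : List (ℕ × PLam)) : dom (fleshEnv F) = F.map Prod.fst := by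
  simp [dom, fleshEnv, Function.comp_def, Entry.name]

theorem readEnv_cons (e : Entry) (E : List Entry) (t : PTm) :
    readEnv (e :: E) t = readEnv E (e.wrap t) := by
  cases e <;> rfl

theorem readEnv_append (E E' : List Entry) (t : PTm) :
    readEnv (E ++ E') t = readEnv E' (readEnv E t) := by
  induction E generalizing t with
  | nil => rfl
  | cons e E ih => rw [List.cons_append, readEnv_cons, readEnv_cons, ih]

theorem readStack_ctx (S : List PLam) (Γ : List ℕ) :
    ∃ K : ECtx, K.depth = 0 ∧ ∀ t, (readStack S t).toTm Γ = K.plug (t.toTm Γ) := by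
  induction S with
  | nil => exact ⟨.hole, rfl, fun t => rfl⟩
  | cons u S ih =>
    obtain ⟨K, hd, hK⟩ := ih
    refine ⟨K.comp (.app .hole (u.toPTm.toTm Γ)), ?_, fun t => ?_⟩
    · rw [ECtx.comp_depth, hd]; rfl
    · rw [ECtx.comp_plug, readStack, hK]; rfl

theorem readEnv_ctx (E : List Entry) (Γ : List ℕ) :
    ∃ K : ECtx, K.depth = E.length ∧ ∀ t, (readEnv E t).toTm Γ = K.plug (t.toTm (dom E ++ Γ)) := by
  induction E with
  | nil => exact ⟨.hole, rfl, fun t => rfl⟩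
  | cons e E ih =>
    obtain ⟨K, hd, hK⟩ := ih
    refine ⟨K.comp (.ofSb (e.toSb (dom E ++ Γ))), ?_, fun t => ?_⟩
    · rw [ECtx.comp_depth, ECtx.ofSb_depth, hd, List.length_cons, Nat.add_comm]
    · rw [ECtx.comp_plug, readEnv_cons, hK, Entry.toTm_wrap, ECtx.ofSb_plug]; rfl

theorem index_dom_append {E : List Entry} {y : ℕ} (h : y ∉ dom E) (Γ : List ℕ) :
    index (dom E ++ y :: Γ) y = E.length := by
  rw [index_append_of_notMem h, index_cons, if_pos rfl, Nat.zero_add, dom, List.length_map]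

/-- The names of the chain are not captured by the corresponding environments. -/
def ChainOk (C : List Item) : Prop := ∀ I ∈ C, I.name ∉ dom I.env

/-- The body of the substitution induced by an item of the chain. -/
def Item.body (I : Item) (C : List Item) : PTm :=
  readEnv I.env (readChain C (readStack I.stack (.var I.name)))

/-- The whole chain is one demand frame: earlier items are nested in the body of the latest one. As
an item's name is not captured by its environment, its index at the hole is the depth of the body's
context. -/
theorem readChain_ctx (C : List Item) (hC : ChainOk C) (Γ : List ℕ) :
    (∃ K : ECtx, K.depth = 0 ∧ ∀ t, (readChain C t).toTm Γ = K.plug (t.toTm Γ)) := by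
  induction C generalizing Γ with
  | nil => exact ⟨.hole, rfl, fun t => rfl⟩
  | cons I C ih =>
    obtain ⟨K₁, hd₁, hK₁⟩ := readEnv_ctx I.env (I.name :: Γ)
    obtain ⟨K₂, hd₂, hK₂⟩ := ih (fun J hJ => hC J (by simp [hJ])) (dom I.env ++ I.name :: Γ)
    obtain ⟨K₃, hd₃, hK₃⟩ := readStack_ctx I.stack (dom I.env ++ I.name :: Γ)
    refine ⟨.dem (K₁.comp (K₂.comp K₃)) .hole, rfl, fun t => ?_⟩
    simp only [readChain, PTm.toTm, ECtx.plug, hK₁, hK₂, hK₃, ECtx.comp_plug, ECtx.comp_depth, hd₁,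
      hd₂, hd₃, index_dom_append (hC I (by simp)), Nat.zero_add]

/-- The read-back of a state as an evaluation context applied to the code. -/
theorem read_ctx (C : List Item) (hC : ChainOk C) (S : List PLam) (E : List Entry) (Γ : List ℕ) :
    ∃ K : ECtx, K.depth = E.length ∧
      ∀ t, (readEnv E (readChain C (readStack S t))).toTm Γ = K.plug (t.toTm (dom E ++ Γ)) := by
  obtain ⟨K₁, hd₁, hK₁⟩ := readEnv_ctx E Γ
  obtain ⟨K₂, hd₂, hK₂⟩ := readChain_ctx C hC (dom E ++ Γ)
  obtain ⟨K₃, hd₃, hK₃⟩ := readStack_ctx S (dom E ++ Γ)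
  refine ⟨K₁.comp (K₂.comp K₃), ?_, fun t => ?_⟩
  · simp [ECtx.comp_depth, hd₁, hd₂, hd₃]
  · rw [hK₁, hK₂, hK₃, ECtx.comp_plug, ECtx.comp_plug]

theorem Item.head_body (I : Item) (C : List Item) (hC : ChainOk (I :: C)) (Γ : List ℕ) :
    ((I.body C).toTm (I.name :: Γ)).head = .need 0 := by
  obtain ⟨K, hd, hK⟩ := read_ctx C (fun J hJ => hC J (by simp [hJ])) I.stack I.env (I.name :: Γ)
  rw [Item.body, hK, PTm.toTm, index_dom_append (hC I (by simp)), ← hd, ECtx.head_plugVar]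

/-! The substitution created by a β-transition moves to the environment. -/

theorem readStack_move (c : Prop) (x : ℕ) (u : PTm) (S : List PLam) (hS : ∀ w ∈ S, x ∉ w.fv)
    (t : PTm) (Γ : List ℕ) :
    ElemEq c ((readStack S (.sub t x u)).toTm Γ) ((PTm.sub (readStack S t) x u).toTm Γ) := by
  induction S generalizing t with
  | nil => exact .refl _
  | cons w S ih =>
    refine ElemEq.trans ?_ (ih (fun w hw => hS w (by simp [hw])) (.app t w.toPTm))
    obtain ⟨K, _, hK⟩ := readStack_ctx S Γ
    rw [readStack, hK, hK]
    refine ElemEq.plug ?_ K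
    simp only [PTm.toTm]
    rw [w.toPTm.toTm_cons x Γ (by rw [PLam.fv_toPTm]; exact hS w (by simp))]
    exact .app _ (.es _) _

/-- A single application of `ElemEq.dem`, because a nonempty chain is one demand frame. No
substitution is exchanged, so the move is available for every `c`, as it is through the stack. -/
theorem readChain_move (c : Prop) (x : ℕ) (u : PTm) (C : List Item) (hC : ChainOk C)
    (hx : ∀ I C', C = I :: C' → x ∉ (I.body C').fv) (t : PTm) (Γ : List ℕ) :
    ElemEq c ((readChain C (.sub t x u)).toTm Γ) ((PTm.sub (readChain C t) x u).toTm Γ) := by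
  cases C with
  | nil => exact .refl _
  | cons I C =>
    have hb := hx I C rfl
    have := ElemEq.dem (c := c) _ (t.toTm (x :: Γ)) (.es (u.toTm Γ)) (I.head_body C hC Γ)
    have e := (I.body C).toTm_cons_append I.name [x] Γ
      (fun y hy _ => by rw [List.mem_singleton]; rintro rfl; exact hb hy)
    rw [List.singleton_append] at e
    simp only [readChain, PTm.toTm]
    change ElemEq c _ (.sub (.sub ((I.body C).toTm (I.name :: x :: Γ)) _) _)
    rw [e]
    exact this

/-! ### Scoping -/

/-- The free names of the entries are bound in the rest of the environment, or belong to `D`. -/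
def EnvScoped : List Entry → List ℕ → Prop
  | [], _ => True
  | e :: E, D => (∀ x ∈ e.fv, x ∈ dom E ++ D) ∧ EnvScoped E D

def StackScoped (S : List PLam) (D : List ℕ) : Prop := ∀ t ∈ S, ∀ x ∈ t.fv, x ∈ D

/-- Scopes grow inwards: the rest of the chain is read inside the environment of the current item.
-/
def ChainScoped : List Item → List ℕ → Prop
  | [], _ => True
  | I :: C, D => StackScoped I.stack (dom I.env ++ I.name :: D) ∧ EnvScoped I.env (I.name :: D) ∧
      ChainScoped C (dom I.env ++ I.name :: D)

theorem EnvScoped.mono {E : List Entry} {D D' : List ℕ} (h : EnvScoped E D) (hD : D ⊆ D') :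
    EnvScoped E D' := by
  induction E with
  | nil => trivial
  | cons e E ih =>
    refine ⟨fun x hx => ?_, ih h.2⟩
    have := h.1 x hx
    rw [List.mem_append] at this ⊢
    exact this.imp id (fun h => hD h)

theorem StackScoped.mono {S : List PLam} {D D' : List ℕ} (h : StackScoped S D) (hD : D ⊆ D') :
    StackScoped S D' := fun t ht x hx => hD (h t ht x hx)

theorem append_cons_subset {l D D' : List ℕ} (x : ℕ) (hD : D ⊆ D') :
    l ++ x :: D ⊆ l ++ x :: D' := by
  intro y; simp only [List.mem_append, List.mem_cons]
  rintro (h | h | h)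
  · exact .inl h
  · exact .inr (.inl h)
  · exact .inr (.inr (hD h))

theorem ChainScoped.mono {C : List Item} {D D' : List ℕ} (h : ChainScoped C D) (hD : D ⊆ D') :
    ChainScoped C D' := by
  induction C generalizing D D' with
  | nil => trivial
  | cons I C ih =>
    exact ⟨h.1.mono (append_cons_subset _ hD), h.2.1.mono (List.cons_subset_cons _ hD),
      ih h.2.2 (append_cons_subset _ hD)⟩

theorem envScoped_append {E E' : List Entry} {D : List ℕ} :
    EnvScoped (E ++ E') D ↔ EnvScoped E (dom E' ++ D) ∧ EnvScoped E' D := by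
  induction E with
  | nil => simp [EnvScoped]
  | cons e E ih => simp only [List.cons_append, EnvScoped, ih, dom_append, List.append_assoc, and_assoc]

theorem fv_readStack {S : List PLam} {D : List ℕ} (h : StackScoped S D) {t : PTm}
    (ht : ∀ x ∈ t.fv, x ∈ D) : ∀ x ∈ (readStack S t).fv, x ∈ D := by
  induction S generalizing t with
  | nil => exact ht
  | cons u S ih =>
    refine ih (fun w hw => h w (by simp [hw])) fun x hx => ?_
    simp only [PTm.fv, Finset.mem_union, PLam.fv_toPTm] at hx
    exact hx.elim (ht x) (h u (by simp) x)

theorem fv_readEnv {E : List Entry} {D : List ℕ} (h : EnvScoped E D) {t : PTm}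
    (ht : ∀ x ∈ t.fv, x ∈ dom E ++ D) : ∀ x ∈ (readEnv E t).fv, x ∈ D := by
  induction E generalizing t with
  | nil => exact ht
  | cons e E ih =>
    rw [readEnv_cons]
    refine ih h.2 fun x hx => ?_
    rw [Entry.fv_wrap, Finset.mem_union, Finset.mem_erase] at hx
    rcases hx with ⟨hn, hx⟩ | hx
    · have := ht x hx
      rw [dom_cons, List.cons_append, List.mem_cons] at this
      exact this.resolve_left hn
    · exact h.1 x hx

theorem fv_readChain {C : List Item} {D : List ℕ} (h : ChainScoped C D) {t : PTm}
    (ht : ∀ x ∈ t.fv, x ∈ D) : ∀ x ∈ (readChain C t).fv, x ∈ D := by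
  induction C generalizing D t with
  | nil => exact ht
  | cons I C ih =>
    intro x hx
    simp only [readChain, PTm.fv, Finset.mem_union, Finset.mem_erase] at hx
    rcases hx with ⟨hn, hx⟩ | hx
    · have := fv_readEnv h.2.1 (ih h.2.2 (fv_readStack h.1
        (t := .var I.name) (by simp [PTm.fv]))) x hx
      exact (List.mem_cons.1 this).resolve_left hn
    · exact ht x hx

theorem fv_read {C : List Item} {S : List PLam} {E : List Entry} {D : List ℕ}
    (hC : ChainScoped C (dom E ++ D)) (hS : StackScoped S (dom E ++ D)) (hE : EnvScoped E D)
    {t : PTm} (ht : ∀ x ∈ t.fv, x ∈ dom E ++ D) :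
    ∀ x ∈ (readEnv E (readChain C (readStack S t))).fv, x ∈ D :=
  fv_readEnv hE (fv_readChain hC (fv_readStack hS ht))

/-! ### Bound names -/

def Entry.bound : Entry → Multiset ℕ
  | es x t => x ::ₘ t.binders
  | skes x y b => x ::ₘ y ::ₘ b.binders

def stackBound (S : List PLam) : Multiset ℕ := (S.map fun t => (t.binders : Multiset ℕ)).sum

def envBound (E : List Entry) : Multiset ℕ := (E.map Entry.bound).sum

def Item.bound (I : Item) : Multiset ℕ := I.name ::ₘ (stackBound I.stack + envBound I.env)

/-- The names bound in a state, by the abstractions, by the environments and by the chain. -/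
def State.bound (Q : State) : Multiset ℕ :=
  (Q.chain.map Item.bound).sum + Q.code.binders + stackBound Q.stack + envBound Q.env

theorem envBound_append (E E' : List Entry) : envBound (E ++ E') = envBound E + envBound E' := by
  simp [envBound]

theorem envBound_cons (e : Entry) (E : List Entry) : envBound (e :: E) = e.bound + envBound E := by
  simp [envBound]

theorem stackBound_cons (t : PLam) (S : List PLam) :
    stackBound (t :: S) = t.binders + stackBound S := by
  simp [stackBound]

theorem dom_le_envBound (E : List Entry) : (dom E : Multiset ℕ) ≤ envBound E := by
  induction E with
  | nil => exact le_refl _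
  | cons e E ih =>
    rw [envBound_cons, dom_cons, ← Multiset.cons_coe, ← Multiset.singleton_add]
    refine add_le_add ?_ ih
    cases e <;> simp [Entry.bound, Entry.name]

theorem mem_sum_map {α : Type} {f : α → Multiset ℕ} {l : List α} {x : ℕ} :
    x ∈ (l.map f).sum ↔ ∃ a ∈ l, x ∈ f a := by
  induction l with
  | nil => simp
  | cons a l ih => simp [ih]

theorem Entry.bound_subset_names {e : Entry} {x : ℕ} (h : x ∈ e.bound) : x ∈ e.names := by
  cases e with
  | es y t =>
    simp only [bound, Multiset.mem_cons, Multiset.mem_coe] at h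
    simp only [names, List.mem_cons]
    exact h.imp id PLam.mem_names_of_mem_binders
  | skes y z b =>
    simp only [bound, Multiset.mem_cons, Multiset.mem_coe] at h
    simp only [names, List.mem_cons]
    exact h.imp id (Or.imp id PLam.mem_names_of_mem_binders)

theorem mem_stack_names {S : List PLam} {x : ℕ} (h : x ∈ stackBound S) :
    x ∈ S.flatMap PLam.names := by
  obtain ⟨t, ht, hx⟩ := mem_sum_map.1 h
  exact List.mem_flatMap.2 ⟨t, ht, PLam.mem_names_of_mem_binders (Multiset.mem_coe.1 hx)⟩

theorem mem_env_names {E : List Entry} {x : ℕ} (h : x ∈ envBound E) :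
    x ∈ E.flatMap Entry.names := by
  obtain ⟨e, he, hx⟩ := mem_sum_map.1 h
  exact List.mem_flatMap.2 ⟨e, he, Entry.bound_subset_names hx⟩

theorem State.bound_subset_names {Q : State} {x : ℕ} (h : x ∈ Q.bound) : x ∈ Q.names := by
  simp only [bound, Multiset.mem_add, Multiset.mem_coe] at h
  simp only [names, List.mem_append]
  refine h.imp (Or.imp (Or.imp (fun h => ?_) PLam.mem_names_of_mem_binders) mem_stack_names)
    mem_env_names
  obtain ⟨I, hI, hx⟩ := mem_sum_map.1 h
  refine List.mem_flatMap.2 ⟨I, hI, ?_⟩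
  simp only [Item.bound, Multiset.mem_cons, Multiset.mem_add] at hx
  simp only [Item.names, List.mem_cons, List.mem_append]
  exact hx.imp id (Or.imp mem_stack_names mem_env_names)

/-! ### The invariant of the machine -/

/-- The skeletal entries contain skeletal values. -/
def Entry.Skeletal : Entry → Prop
  | es _ _ => True
  | skes _ y b => ∀ Γ, (b.toLam (y :: Γ)).fleshAt 1 = []

/-- Distinctness excludes captures in read-backs, scoping makes every lookup of a variable succeed,
and the last two fields put the read-back in the skeletal calculus. -/
structure State.Inv (Q : State) : Prop where
  nodup : Q.bound.Nodup
  code : ∀ x ∈ Q.code.fv, x ∈ dom Q.env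
  stack : StackScoped Q.stack (dom Q.env)
  env : EnvScoped Q.env []
  chain : ChainScoped Q.chain (dom Q.env)
  skel : ∀ e ∈ Q.env, e.Skeletal
  skel_chain : ∀ I ∈ Q.chain, ∀ e ∈ I.env, e.Skeletal

namespace State.Inv

theorem of_init {t : Tm} {Q : State} (h : Init t Q) : Q.Inv := by
  obtain ⟨s, p, hs, rfl, rfl, hp, rfl⟩ := h
  refine ⟨by simpa [State.bound, stackBound, envBound, PLam.WellBound] using hp, ?_, ?_, trivial,
    trivial, by simp, by simp⟩
  · intro x hx
    have h1 := (p.occ_toLam [] x).2 ⟨x, hx, index_nil x⟩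
    rw [hs x] at h1; cases h1
  · intro t ht; simp at ht

theorem chainOk {Q : State} (h : Q.Inv) : ChainOk Q.chain := by
  intro I hI hd
  have h1 : I.bound ≤ Q.bound := by
    refine le_trans ?_ (le_trans (Multiset.le_add_right _ _)
      (le_trans (Multiset.le_add_right _ _) (Multiset.le_add_right _ _)))
    exact List.single_le_sum (by simp) _ (List.mem_map_of_mem hI)
  have h2 := Multiset.nodup_of_le h1 h.nodup
  rw [Item.bound, Multiset.nodup_cons, Multiset.mem_add] at h2
  exact h2.1 (.inr (Multiset.mem_of_le (dom_le_envBound _) (Multiset.mem_coe.2 hd)))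

theorem nodup_dom {Q : State} (h : Q.Inv) : (dom Q.env).Nodup := by
  rw [← Multiset.coe_nodup]
  exact Multiset.nodup_of_le ((dom_le_envBound _).trans (Multiset.le_add_left _ _)) h.nodup

/-- Search only relocates components, so the multiset of bound names is unchanged; its three
equalities are rearrangements of sums. -/
theorem search {Q Q' : State} {l : SLabel} (h : Q.Inv) (hs : Search l Q Q') : Q'.Inv := by
  obtain ⟨h1, h2, h3, h4, h5, h6, h7⟩ := h
  cases hs with
  | sea1 C t u S E =>
    refine ⟨?_, fun x hx => h2 x (by simp [PLam.fv, hx]), ?_, h4, h5, h6, h7⟩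
    · convert h1 using 1
      simp only [State.bound, stackBound_cons, PLam.binders, ← Multiset.coe_add]
      abel
    · intro w hw x hx
      rcases List.mem_cons.1 hw with rfl | hw
      · exact h2 x (by simp [PLam.fv, hx])
      · exact h3 w hw x hx
  | sea2 C x t S E E' hv =>
    rw [envScoped_append] at h4
    obtain ⟨h4, h4', h4''⟩ := h4
    simp only [dom_append, dom_cons, Entry.name, List.append_nil] at *
    refine ⟨?_, h4', by intro t ht; simp at ht, h4'', ⟨h3, h4, h5⟩,
      fun e he => h6 e (by simp [he]), ?_⟩
    · convert h1 using 1
      simp only [State.bound, envBound_append, envBound_cons, Item.bound, Entry.bound,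
        List.map_cons, List.sum_cons, PLam.binders, stackBound, List.map_nil, List.sum_nil,
        Multiset.coe_nil, ← Multiset.singleton_add]
      abel
    · intro I hI e he
      rcases List.mem_cons.1 hI with rfl | hI
      · exact h6 e (by simp at he; simp [he])
      · exact h7 I hI e he
  | sea3 C x v S E E' hv =>
    obtain ⟨h5, h5', h5''⟩ := h5
    refine ⟨?_, ?_, ?_, ?_, ?_, ?_, fun I hI => h7 I (by simp [hI])⟩
    · convert h1 using 1
      simp only [State.bound, envBound_append, envBound_cons, Item.bound, Entry.bound,
        List.map_cons, List.sum_cons, PLam.binders, stackBound, List.map_nil, List.sum_nil,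
        Multiset.coe_nil, ← Multiset.singleton_add]
      abel
    · simp [PLam.fv, dom_append, dom_cons, Entry.name]
    · simpa only [dom_append, dom_cons, Entry.name] using h5
    · refine envScoped_append.2 ⟨?_, ?_, h4⟩
      · simpa [dom_cons, Entry.name] using h5'
      · simpa [Entry.fv] using h2
    · simpa only [dom_append, dom_cons, Entry.name] using h5''
    · intro e he
      rcases List.mem_append.1 he with he | he
      · exact h7 ⟨x, S, E⟩ (by simp) e he
      · rcases List.mem_cons.1 he with rfl | he
        · trivial
        · exact h6 e he

/-- A transition β preserves the multiset of bound names. The others enlarge it, by the flesh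
variables for sk and by the binders of the copy for ss, and freshness makes the added part disjoint
from the old one. -/
theorem principal {Q Q' : State} {a : PLabel} (h : Q.Inv) (hs : Principal a Q Q') : Q'.Inv := by
  obtain ⟨h1, h2, h3, h4, h5, h6, h7⟩ := h
  cases hs with
  | beta C x t u S E =>
    have hsub : dom E ⊆ dom (.es x u :: E) := by rw [dom_cons]; exact List.subset_cons_self _ _
    refine ⟨?_, fun y hy => ?_, fun w hw => ?_, ⟨?_, h4⟩, h5.mono hsub, ?_, h7⟩
    · convert h1 using 1
      simp only [State.bound, stackBound_cons, envBound_cons, Entry.bound, PLam.binders,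
        ← Multiset.cons_coe, ← Multiset.singleton_add]
      abel
    · rw [dom_cons, List.mem_cons]
      by_cases hyx : y = x
      · exact .inl hyx
      · exact .inr (h2 y (by simp [PLam.fv, hy, hyx]))
    · intro y hy; exact hsub (h3 w (by simp [hw]) y hy)
    · intro y hy; rw [List.append_nil]; exact h3 u (by simp) y hy
    · intro e he
      rcases List.mem_cons.1 he with rfl | he
      · trivial
      · exact h6 e he
  | sk C x y b s F S E E' hd hn hf =>
    rw [envScoped_append] at h4
    obtain ⟨h4, h4', h4''⟩ := h4
    simp only [Entry.fv, List.append_nil] at h4'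
    have hsub : dom (.es x (.lam y b) :: E') ⊆ dom (.skes x y s :: (fleshEnv F ++ E')) := by
      simp only [dom_cons, dom_append, Entry.name]
      exact List.cons_subset_cons _ (List.subset_append_right _ _)
    have hsub' : dom (E ++ .es x (.lam y b) :: E') ⊆
        dom (E ++ .skes x y s :: (fleshEnv F ++ E')) := by
      rw [dom_append, dom_append]
      intro z hz
      rw [List.mem_append] at hz ⊢
      exact hz.imp id fun h => hsub h
    have hfl : EnvScoped (fleshEnv F) (dom E' ++ []) := by
      have hfv : ∀ p ∈ F, ∀ z ∈ p.2.fv, z ∈ dom E' := fun p hp z hz => by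
        have := hd.fv_flesh p hp z hz
        exact h4' z (by simpa [PLam.fv, and_comm] using this)
      clear hd hn hf hsub hsub'
      induction F with
      | nil => trivial
      | cons p F ih =>
        refine ⟨fun z hz => ?_, ih fun q hq => hfv q (by simp [hq])⟩
        have := hfv p (by simp) z hz
        simp [this]
    refine ⟨?_, fun z hz => hsub' (h2 z hz), h3.mono hsub', ?_, h5.mono hsub', ?_, h7⟩
    · have e1 : State.bound ⟨C, .var x, S, E ++ .skes x y s :: (fleshEnv F ++ E')⟩ =
          State.bound ⟨C, .var x, S, E ++ .es x (.lam y b) :: E'⟩ + (F.map Prod.fst : Multiset ℕ) := by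
        have e2 : envBound (fleshEnv F) = (F.map Prod.fst : Multiset ℕ) +
            (F.map fun p => (p.2.binders : Multiset ℕ)).sum := by
          clear hd hn hf hsub hsub' hfl
          induction F with
          | nil => rfl
          | cons p F ih =>
            rw [fleshEnv, List.map_cons, envBound_cons]
            change _ + envBound (fleshEnv F) = _
            rw [ih, Entry.bound]
            simp only [List.map_cons, List.sum_cons, ← Multiset.cons_coe, ← Multiset.singleton_add]
            abel
        simp only [State.bound, envBound_append, envBound_cons, Entry.bound, PLam.binders, e2,
          ← Multiset.cons_coe, hd.binders_eq, ← Multiset.singleton_add]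
        abel
      rw [e1, Multiset.nodup_add]
      refine ⟨h1, Multiset.coe_nodup.2 hn, Multiset.disjoint_left.2 fun hz hz' => ?_⟩
      exact hf _ (Multiset.mem_coe.1 hz') (State.bound_subset_names hz)
    · refine envScoped_append.2 ⟨?_, ?_, envScoped_append.2 ⟨hfl, h4''⟩⟩
      · rw [List.append_nil] at h4 ⊢; exact h4.mono hsub
      · intro z hz
        simp only [Entry.fv, Finset.mem_erase] at hz
        rw [List.append_nil, dom_append, dom_fleshEnv, List.mem_append]
        rcases hd.fv_skel z hz.2 with h | h
        · exact .inr (h4' z (by simp [PLam.fv, h, hz.1]))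
        · exact .inl h
    · intro e he
      rcases List.mem_append.1 he with he | he
      · exact h6 e (by simp [he])
      · rcases List.mem_cons.1 he with rfl | he
        · exact fun Γ => hd.fleshAt_skel [y] Γ (by simp)
        · rcases List.mem_append.1 he with he | he
          · obtain ⟨p, _, rfl⟩ := List.mem_map.1 he; trivial
          · exact h6 e (by simp [he])
  | ss C x y b w S E E' hα hw hf =>
    rw [envScoped_append] at h4
    refine ⟨?_, fun z hz => ?_, h3, envScoped_append.2 h4, h5, h6, h7⟩
    · have e1 : State.bound ⟨C, w, S, E ++ .skes x y b :: E'⟩ =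
          State.bound ⟨C, .var x, S, E ++ .skes x y b :: E'⟩ + (w.binders : Multiset ℕ) := by
        simp only [State.bound, PLam.binders, Multiset.coe_nil]
        abel
      rw [e1, Multiset.nodup_add]
      refine ⟨h1, Multiset.coe_nodup.2 hw, Multiset.disjoint_left.2 fun hz hz' => ?_⟩
      exact hf _ (Multiset.mem_coe.1 hz') (State.bound_subset_names hz)
    · have := h4.2.1 z (by rw [hα.fv_eq] at hz; exact hz)
      rw [dom_append, dom_cons]
      simp only [List.append_nil] at this
      simp [this]

theorem of_reachable {Q : State} (h : SkMAD.Reachable Q) : Q.Inv := by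
  obtain ⟨t, Q₀, r, hi, hr⟩ := h
  have h₀ := of_init hi
  clear hi
  induction hr with
  | nil => exact h₀
  | principal p _ ih => exact ih (h₀.principal p)
  | search p _ ih => obtain ⟨l, p⟩ := p; exact ih (h₀.search p)

end State.Inv

/-! ### Termination of the search transitions -/

/-- The number of applications along the left spine, plus one. -/
def PLam.spine : PLam → ℕ
  | app t _ => t.spine + 1
  | _ => 1

/-- Values and skeletal entries weigh nothing, as search never enters them; any other content pays
in advance for the descent along its spine. -/
def Entry.weight : Entry → ℕ
  | es _ (.lam _ _) => 0
  | es _ t => t.spine + 1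
  | skes _ _ _ => 0

def envWeight (E : List Entry) : ℕ := (E.map Entry.weight).sum

/-- Each search transition lowers it by exactly one: sea1 shortens the spine, sea2 spends the extra
unit of the entry, sea3 the unit of the chain item. -/
def State.weight (Q : State) : ℕ :=
  (Q.chain.map fun I => envWeight I.env + 1).sum + Q.code.spine + envWeight Q.env

theorem Search.weight_lt {l : SLabel} {Q Q' : State} (h : Search l Q Q') : Q'.weight < Q.weight := by
  cases h with
  | sea1 C t u S E => simp only [State.weight, PLam.spine]; omega
  | sea2 C x t S E E' hv =>
    have hw : (Entry.es x t).weight = t.spine + 1 := by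
      cases t with
      | lam y b => exact absurd trivial hv
      | var y => rfl
      | app t u => rfl
    simp only [State.weight, envWeight, PLam.spine, List.map_append, List.map_cons, List.sum_append,
      List.sum_cons, hw]
    omega
  | sea3 C x v S E E' hv =>
    cases v with
    | lam y b =>
      simp only [State.weight, envWeight, PLam.spine, List.map_append, List.map_cons,
        List.sum_append, List.sum_cons, Entry.weight]
      omega
    | var y => exact absurd hv (by simp [PLam.IsValue])
    | app t u => exact absurd hv (by simp [PLam.IsValue])

theorem search_wellFounded : WellFounded fun Q' Q => SkMAD.search Q Q' := by
  refine Subrelation.wf (r := InvImage (· < ·) State.weight) ?_ (InvImage.wf _ wellFounded_lt)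
  rintro Q' Q ⟨l, h⟩
  exact h.weight_lt

theorem Search.readBack_eq {l : SLabel} {Q Q' : State} (h : Search l Q Q') :
    readBack Q = readBack Q' := by
  cases h with
  | sea1 C t u S E => rfl
  | sea2 C x t S E E' hv => simp only [readBack, readEnv_append]; rfl
  | sea3 C x v S E E' hv => simp only [readBack, readEnv_append]; rfl

/-! ### Projection of the principal transitions -/

/-- In the environment an entry lies in the scope of the following ones, whereas the flesh of the
calculus has all contents outside. Both agree because no flesh variable is free in the flesh. -/
theorem toTm_readEnv_fleshEnv (F : List (ℕ × PLam)) (Γ : List ℕ) (t : PTm)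
    (h : ∀ p ∈ F, ∀ x ∈ p.2.fv, x ∉ F.map Prod.fst) :
    (readEnv (fleshEnv F) t).toTm Γ =
      Tm.subList (F.map fun p => p.2.toLam Γ) (t.toTm (F.map Prod.fst ++ Γ)) := by
  have h' : ∀ p ∈ F, ∀ x ∈ p.2.fv, ∀ G, G ⊆ F → x ∉ G.map Prod.fst := fun p hp x hx G hG hm =>
    h p hp x hx (List.map_subset _ hG hm)
  clear h
  induction F generalizing t with
  | nil => rfl
  | cons p F ih =>
    have e := ih (.sub t p.1 p.2.toPTm) fun q hq x hx G hG =>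
      h' q (by simp [hq]) x hx G (List.subset_cons_of_subset _ hG)
    refine e.trans ?_
    rw [PTm.toTm, PTm.toTm_append _ _ _ (fun x hx => by
      rw [PLam.fv_toPTm] at hx
      exact h' p (by simp) x hx F (List.subset_cons_self _ _)), PLam.toTm_toPTm]
    simp only [List.map_cons, Tm.subList, List.length_map]
    rfl

/-- The calculus leaves the new substitution around the body, the machine puts it at the head of the
environment. It crosses the stack, then the chain, in which its variable does not occur by
distinctness and scoping. -/
theorem Principal.project_beta {Q Q' : State} (hQ : Q.Inv) (h : Principal .dB Q Q') (c : Prop) :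
    ∃ u, Step .dB (SkMAD.decode Q) u ∧ ElemEq c u (SkMAD.decode Q') := by
  cases h with
  | beta C x t u S E =>
    have hC := hQ.chainOk
    have hn := hQ.nodup
    have hx : x ∉ dom E ∧ ∀ I C', C = I :: C' → x ≠ I.name := by
      have e : State.bound ⟨C, .lam x t, u :: S, E⟩ = x ::ₘ ((C.map Item.bound).sum + t.binders +
          stackBound (u :: S) + envBound E) := by
        simp only [State.bound, PLam.binders, ← Multiset.cons_coe, Multiset.add_cons,
          Multiset.cons_add]
      rw [e, Multiset.nodup_cons] at hn
      simp only [Multiset.mem_add, not_or] at hn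
      refine ⟨fun h => hn.1.2 (Multiset.mem_of_le (dom_le_envBound E) (Multiset.mem_coe.2 h)), ?_⟩
      rintro I C' rfl rfl
      exact hn.1.1.1.1 (by simp [Item.bound])
    have hS : ∀ w ∈ S, x ∉ w.fv := fun w hw h => hx.1 (hQ.stack w (by simp [hw]) x h)
    have hB : ∀ I C', C = I :: C' → x ∉ (I.body C').fv := by
      rintro I C' rfl h
      have hc := hQ.chain
      have := fv_read hc.2.2 hc.1 hc.2.1 (t := .var I.name) (by simp [PTm.fv]) x h
      rcases List.mem_cons.1 this with h | h
      · exact hx.2 I C' rfl h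
      · exact hx.1 h
    obtain ⟨K₁, -, hK₁⟩ := readEnv_ctx E []
    obtain ⟨K₂, -, hK₂⟩ := readChain_ctx C hC (dom E ++ [])
    obtain ⟨K, -, hK⟩ := read_ctx C hC S E []
    refine ⟨(readEnv E (readChain C (readStack S (.sub t.toPTm x u.toPTm)))).toTm [], ?_, ?_⟩
    -- The code is an abstraction itself, so the substitution context of the rule is empty.
    · have := Step.ctx K (Root.dB .hole (t.toLam (x :: (dom E ++ []))) (u.toPTm.toTm (dom E ++ [])))
      rw [SCtx.depth, Tm.shift_zero] at this
      change Step .dB ((readEnv E (readChain C (readStack S (.app (.lam x t) u.toPTm)))).toTm []) _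
      rw [hK, hK, PTm.toTm, PTm.toTm, PTm.toTm, t.toTm_toPTm]
      exact this
    · change ElemEq c _ ((readEnv E (.sub (readChain C (readStack S t.toPTm)) x u.toPTm)).toTm [])
      rw [hK₁, hK₁]
      refine ElemEq.plug (ElemEq.trans ?_ (readChain_move c x _ C hC hB _ _)) K₁
      rw [hK₂, hK₂]
      exact (readStack_move c x _ S hS _ _).plug K₂

theorem Principal.project_sk {Q Q' : State} (hQ : Q.Inv) (h : Principal .sk Q Q') :
    Step .sk (SkMAD.decode Q) (SkMAD.decode Q') := by
  cases h with
  | sk C x y b s F S E E' hd hn hf =>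
    have hC := hQ.chainOk
    have henv := envScoped_append.1 hQ.env
    have hdom := hQ.nodup_dom
    have hstack := hQ.stack
    have hchain := hQ.chain
    simp only [dom_append, dom_cons, Entry.name] at hdom hstack hchain
    have hxE : x ∉ dom E := fun h => List.disjoint_of_nodup_append hdom h (by simp)
    obtain ⟨K', -, hK'⟩ := readEnv_ctx E' []
    obtain ⟨K, hKd, hK⟩ := read_ctx C hC S E (x :: (dom E' ++ []))
    have hvar : (PTm.var x).toTm (dom E ++ x :: (dom E' ++ [])) = .var K.depth := by
      rw [PTm.toTm, index_dom_append hxE, hKd]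
    simp only [List.append_nil] at henv
    have hnames : ∀ z ∈ F.map Prod.fst, z ∉ dom E' ∧ z ≠ x ∧ z ≠ y ∧ z ∉ b.names := by
      intro z hz
      have := hf z hz
      simp only [State.names, List.mem_append, not_or, List.flatMap_append, List.flatMap_cons,
        Entry.names, PLam.names, List.mem_cons] at this
      refine ⟨fun h => this.2.2.2 (mem_env_names (Multiset.mem_of_le (dom_le_envBound _)
        (Multiset.mem_coe.2 h))), this.2.2.1.1, this.2.2.1.2.1, this.2.2.1.2.2⟩
    have hfl : ∀ p ∈ F, ∀ z ∈ p.2.fv, z ∉ F.map Prod.fst := fun p hp z hz hz' =>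
      (hnames z hz').2.2.2 (PLam.mem_names_of_mem_fv (hd.fv_flesh p hp z hz).1)
    -- The body of the entry has free names only in `x :: dom E'`, hence no flesh variable; this
    -- justifies its weakening at the end.
    have hfv := fv_read (C := C) (S := S) (E := E) (D := x :: dom E') hchain hstack henv.1
      (t := .var x) (by simp [PTm.fv])
    have h1 : (b.toLam (y :: (dom E' ++ []))).fleshList = F.map fun p => p.2.toLam (dom E' ++ []) := by
      have := hd.fleshAt_eq [y] (dom E' ++ []) (by simp)
      exact this
    have h2 : (b.toLam (y :: (dom E' ++ []))).skeleton =
        s.toLam (y :: (F.map Prod.fst ++ (dom E' ++ []))) := by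
      have := hd.skelAt_eq [y] (dom E' ++ []) [] [] (by simp) (by simpa using hn)
        (fun z hz => by
          have := hnames z (by simpa using hz)
          exact ⟨this.2.2.2, by simpa using this.2.2.1⟩)
      rw [Lam.skeleton, h1, List.length_map]
      simpa using this
    -- The entry contains the value itself, so here too the substitution context is empty.
    have hroot := Step.ctx K' (Root.sk K .hole (b.toLam (y :: (dom E' ++ []))))
    rw [ECtx.plugVar, flesh_plug, flesh_depth, h1, h2, List.length_map, SCtx.depth, Nat.add_zero]
      at hroot
    change Step .sk ((readEnv (E ++ .es x (.lam y b) :: E')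
        (readChain C (readStack S (.var x)))).toTm [])
      ((readEnv (E ++ .skes x y s :: (fleshEnv F ++ E'))
        (readChain C (readStack S (.var x)))).toTm [])
    rw [readEnv_append, readEnv_append, readEnv_cons, readEnv_cons, readEnv_append, hK', hK',
      toTm_readEnv_fleshEnv F _ _ hfl, Entry.wrap, Entry.wrap, PTm.toTm, PTm.toTm,
      PTm.toTm_cons_append _ x (F.map Prod.fst), hK, hvar, PLam.toTm_toPTm, List.length_map]
    · exact hroot
    · intro z hz hzx hzF
      exact (hnames z hzF).1 ((List.mem_cons.1 (hfv z hz)).resolve_left hzx)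

theorem Principal.project_ss {Q Q' : State} (hQ : Q.Inv) (h : Principal .ss Q Q') :
    Step .ss (SkMAD.decode Q) (SkMAD.decode Q') := by
  cases h with
  | ss C x y b w S E E' hα hw hf =>
    have hC := hQ.chainOk
    have henv := envScoped_append.1 hQ.env
    have hdom := hQ.nodup_dom
    simp only [dom_append, dom_cons, Entry.name] at hdom
    have hdis := List.disjoint_of_nodup_append hdom
    have hxE : x ∉ dom E := fun h => hdis h (by simp)
    have hxE' : x ∉ dom E' := (List.nodup_cons.1 (List.nodup_append'.1 hdom).2.1).1
    obtain ⟨K', -, hK'⟩ := readEnv_ctx E' []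
    obtain ⟨K, hKd, hK⟩ := read_ctx C hC S E (x :: (dom E' ++ []))
    have hvar : (PTm.var x).toTm (dom E ++ x :: (dom E' ++ [])) = .var K.depth := by
      rw [PTm.toTm, index_dom_append hxE, hKd]
    -- The value lives in the scope of `E'`, its copy below `x` and `E` too. Distinctness of the
    -- domain shows that none of its free names is captured on the way.
    have hwt : w.toPTm.toTm (dom E ++ x :: (dom E' ++ [])) =
        (Tm.lam (b.toLam (y :: (dom E' ++ [])))).shift (K.depth + 1) := by
      rw [PLam.toTm_toPTm, hα.toLam_eq, ← PLam.toTm_toPTm, List.append_cons, PTm.toTm_append, hKd]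
      · rw [List.length_append, dom, List.length_map]; rfl
      · intro z hz
        rw [PLam.fv_toPTm] at hz
        have hz' := henv.2.1 z hz
        rw [List.append_nil] at hz'
        rw [List.mem_append, List.mem_singleton]
        rintro (h | rfl)
        · exact hdis h (by simp [hz'])
        · exact hxE' hz'
    have hroot := Step.ctx K' (Root.ss K (b.toLam (y :: (dom E' ++ []))))
    rw [ECtx.plugVar] at hroot
    change Step .ss ((readEnv (E ++ .skes x y b :: E')
        (readChain C (readStack S (.var x)))).toTm [])
      ((readEnv (E ++ .skes x y b :: E') (readChain C (readStack S w.toPTm))).toTm [])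
    rw [readEnv_append, readEnv_append, readEnv_cons, readEnv_cons, hK', hK',
      Entry.wrap, Entry.wrap, PTm.toTm, PTm.toTm, hK, hK, hvar, hwt]
    exact hroot

/-! ### Final states -/

theorem PLam.exists_fresh (t : PLam) (A : Finset ℕ) :
    ∃ w : PLam, w.AlphaEq t ∧ w.WellBound ∧ ∀ z ∈ w.binders, z ∉ A :=
  t.exists_fresh_toLam [] [] A rfl .nil (by simp)

theorem mem_dom_split {E : List Entry} {x : ℕ} (h : x ∈ dom E) :
    ∃ E₁ e E₂, E = E₁ ++ e :: E₂ ∧ e.name = x := by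
  obtain ⟨e, he, hx⟩ := List.mem_map.1 h
  obtain ⟨E₁, E₂, rfl⟩ := List.append_of_mem he
  exact ⟨E₁, e, E₂, rfl, hx⟩

/-- A variable is bound in the environment by scoping, and its entry enables a transition since
fresh decompositions and renamings exist. An abstraction is stuck only with an empty stack and an
empty chain. -/
theorem final_shape {Q : State} (hQ : Q.Inv) (hF : SkMAD.Final Q) :
    ∃ (x : ℕ) (b : PLam) (E : List Entry), Q = ⟨[], .lam x b, [], E⟩ := by
  have hp : ∀ a Q', ¬ Principal a Q Q' := fun a Q' => (hF Q').1 a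
  have hs : ∀ l Q', ¬ Search l Q Q' := fun l Q' h => (hF Q').2 ⟨l, h⟩
  clear hF
  obtain ⟨C, t, S, E⟩ := Q
  cases t with
  | app t u => exact absurd (.sea1 C t u S E) (hs _ _)
  | var x =>
    obtain ⟨E₁, e, E₂, rfl, rfl⟩ := mem_dom_split (hQ.code x (by simp [PLam.fv]))
    cases e with
    | es x t =>
      by_cases hv : t.IsValue
      · cases t with
        | lam y b =>
          obtain ⟨s, F, hd, hn, hf⟩ := b.exists_skelDec {y}
            (State.names ⟨C, .var x, S, E₁ ++ .es x (.lam y b) :: E₂⟩).toFinset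
          refine absurd (.sk C x y b s F S E₁ E₂ hd hn fun z hz => ?_) (hp _ _)
          exact fun h => hf z hz (List.mem_toFinset.2 h)
        | var y => exact absurd hv (by simp [PLam.IsValue])
        | app t u => exact absurd hv (by simp [PLam.IsValue])
      · exact absurd (.sea2 C x t S E₁ E₂ hv) (hs _ _)
    | skes x y b =>
      obtain ⟨w, hα, hw, hf⟩ := (PLam.lam y b).exists_fresh
        (State.names ⟨C, .var x, S, E₁ ++ .skes x y b :: E₂⟩).toFinset
      refine absurd (.ss C x y b w S E₁ E₂ hα hw fun z hz => ?_) (hp _ _)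
      exact fun h => hf z hz (List.mem_toFinset.2 h)
  | lam x b =>
    cases S with
    | cons u S => exact absurd (.beta C x b u S E) (hp _ _)
    | nil =>
      cases C with
      | nil => exact ⟨x, b, E, rfl⟩
      | cons I C => exact absurd (.sea3 C I.name (.lam x b) I.stack I.env E trivial) (hs _ _)

theorem head_readEnv (E : List Entry) (Γ : List ℕ) (t : PTm)
    (h : (t.toTm (dom E ++ Γ)).head = .ans) : ((readEnv E t).toTm Γ).head = .ans := by
  induction E generalizing t with
  | nil => exact h
  | cons e E ih =>
    have h' : (t.toTm (e.name :: (dom E ++ Γ))).head = .ans := h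
    rw [readEnv_cons]
    refine ih _ ?_
    rw [Entry.toTm_wrap, Tm.head_wrap (by simp [h']), h']
    rfl

theorem final_normal {Q : State} (hQ : Q.Inv) (hF : SkMAD.Final Q) :
    IsNormal Step (SkMAD.decode Q) := by
  obtain ⟨x, b, E, rfl⟩ := final_shape hQ hF
  intro a u h
  have h1 := h.next_eq.1
  have h2 : (SkMAD.decode ⟨[], .lam x b, [], E⟩).head = .ans :=
    head_readEnv E [] (.lam x b) rfl
  rw [h2] at h1; cases h1

/-! ### Skeletal values -/

namespace Lam

/-- With nothing to extract there are no flesh variables, so `k = 0` and outer indices are not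
shifted. -/
theorem skelAt_eq_self (t : Lam) : ∀ d o : ℕ, t.fleshAt d = [] → t.skelAt d o 0 = t := by
  induction t with
  | var i => intro d o _; simp [skelAt]
  | lam b ih =>
    intro d o h
    simp only [fleshAt] at h
    simp only [skelAt]
    split_ifs at h ⊢ with hE
    rw [ih _ _ h]
  | app t u iht ihu =>
    intro d o h
    simp only [fleshAt] at h
    simp only [skelAt]
    split_ifs at h ⊢ with hE
    rw [List.append_eq_nil_iff] at h
    rw [iht _ _ h.1, ihu _ _ h.2]

theorem skeleton_eq_self {b : Lam} (h : b.fleshAt 1 = []) : b.skeleton = b := by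
  have h' : b.fleshList = [] := h
  rw [skeleton, h']
  exact skelAt_eq_self b 1 0 h

theorem isSk_toTm (t : Lam) : t.toTm.IsSk := by
  induction t with
  | var i => trivial
  | lam b _ => trivial
  | app t u iht ihu => exact ⟨iht, ihu⟩

end Lam

theorem isSk_readStack (S : List PLam) (Γ : List ℕ) (t : PTm) (h : (t.toTm Γ).IsSk) :
    ((readStack S t).toTm Γ).IsSk := by
  induction S generalizing t with
  | nil => exact h
  | cons u S ih =>
    refine ih (.app t u.toPTm) ⟨h, ?_⟩
    rw [PLam.toTm_toPTm]; exact Lam.isSk_toTm _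

theorem isSk_readEnv (E : List Entry) (hE : ∀ e ∈ E, e.Skeletal) (Γ : List ℕ) (t : PTm)
    (h : (t.toTm (dom E ++ Γ)).IsSk) : ((readEnv E t).toTm Γ).IsSk := by
  induction E generalizing t with
  | nil => exact h
  | cons e E ih =>
    rw [readEnv_cons]
    refine ih (fun e he => hE e (by simp [he])) _ ?_
    rw [Entry.toTm_wrap]
    have he := hE e (by simp)
    cases e with
    | es x u => exact ⟨h, Lam.isSk_toTm _⟩
    | skes x y b => exact ⟨h, Lam.skeleton_eq_self (he _)⟩

theorem isSk_readChain (C : List Item) (hC : ∀ I ∈ C, ∀ e ∈ I.env, e.Skeletal) (Γ : List ℕ)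
    (t : PTm) (h : (t.toTm Γ).IsSk) : ((readChain C t).toTm Γ).IsSk := by
  induction C generalizing Γ t with
  | nil => exact h
  | cons I C ih =>
    refine ⟨isSk_readEnv _ (hC I (by simp)) _ _ (ih (fun J hJ => hC J (by simp [hJ])) _ _
      (isSk_readStack _ _ _ trivial)), h⟩

theorem isSk_decode {Q : State} (hQ : Q.Inv) : (SkMAD.decode Q).IsSk := by
  refine isSk_readEnv _ hQ.skel _ _ (isSk_readChain _ hQ.skel_chain _ _ (isSk_readStack _ _ _ ?_))
  rw [PLam.toTm_toPTm]; exact Lam.isSk_toTm _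

/-! ### The skeletal MAD is a distillery -/

theorem decode_of_init (t : Tm) (Q : State) (h : SkMAD.init t Q) : SkMAD.decode Q = t := by
  obtain ⟨s, p, -, rfl, rfl, -, rfl⟩ := h
  exact p.toTm_toPTm []

theorem isDistillery_elemEq (c : Prop) : IsDistillery SkMAD Step (ElemEq c) where
  projection a Q Q' hQ h := by
    have hI := State.Inv.of_reachable hQ
    cases a with
    | dB => exact Principal.project_beta hI h c
    | sk => exact ⟨_, Principal.project_sk hI h, .refl _⟩
    | ss => exact ⟨_, Principal.project_ss hI h, .refl _⟩
  transparency Q Q' _ h := by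
    obtain ⟨l, h⟩ := h
    exact congrArg (PTm.toTm []) h.readBack_eq
  termination := search_wellFounded
  determinism _ _ _ _ _ h h' := h.deterministic h'
  halt Q hQ hF := final_normal (.of_reachable hQ) hF

theorem mechBisimilar_elemEq (c : Prop) : MechBisimilar SkMAD Step (ElemEq c) :=
  (isDistillery_elemEq c).mechBisimilar (ElemEq.isStructuralStrategy c) decode_of_init

end SkNeed

theorem mainTheorem3 :
    -- the read-back inverts the initialization and gives terms of the skeletal calculus
    (∀ t Q, SkMAD.init t Q → SkMAD.decode Q = t) ∧
    (∀ Q, SkMAD.Reachable Q → (SkMAD.decode Q).IsSk) ∧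
    -- the strategy is structural, and forms a distillery with the machine
    IsStructuralStrategy Step StrEq ∧
    IsDistillery SkMAD Step StrEq ∧
    -- the projections of `sk` and `ss` do not need structural equivalence
    (∀ Q Q', SkMAD.Reachable Q → SkMAD.principal .sk Q Q' →
      Step .sk (SkMAD.decode Q) (SkMAD.decode Q')) ∧
    (∀ Q Q', SkMAD.Reachable Q → SkMAD.principal .ss Q Q' →
      Step .ss (SkMAD.decode Q) (SkMAD.decode Q')) ∧
    -- shape of the final states
    (∀ Q : State, SkMAD.Reachable Q → SkMAD.Final Q →
      ∃ (x : ℕ) (b : PLam) (E : List Entry), Q = ⟨[], .lam x b, [], E⟩) ∧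
    -- mechanical bisimulation
    MechBisimilar SkMAD Step StrEq ∧
    -- the same with the narrower structural equivalence
    IsDistillery SkMAD Step StrEqNarrow ∧
    MechBisimilar SkMAD Step StrEqNarrow := by
  exact ⟨decode_of_init,
    fun Q hQ => isSk_decode (.of_reachable hQ),
    strEq_isStructuralStrategy,
    (isDistillery_elemEq True).mono fun _ _ => ElemEq.strEq,
    fun Q Q' hQ h => Principal.project_sk (.of_reachable hQ) h,
    fun Q Q' hQ h => Principal.project_ss (.of_reachable hQ) h,
    fun Q hQ hF => final_shape (.of_reachable hQ) hF,
    (mechBisimilar_elemEq True).mono fun _ _ => ElemEq.strEq,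
    -- With `c` false the machine results already hold for a bisimulation contained in the narrow
    -- relation.
    (isDistillery_elemEq False).mono fun _ _ => ElemEq.strEqNarrow,
    (mechBisimilar_elemEq False).mono fun _ _ => ElemEq.strEqNarrow⟩
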